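/- Fix $n\ge 1$ and $\delta\in[0,1]$. A trace of a string $x\in\{0,1\}^n$ is the random string obtained by deleting each bit of $x$ independently with probability $\delta$ and concatenating the retained bits in order. For an integer $L\ge 0$, the string $x$ is called $L$-separated if there are at least $L$ zeros between any two consecutive ones of $x$. There are universal constants $C>0$ and $c_0\in(0,1)$ and a (single, deterministic) algorithm with the following properties. For every $n\ge 1$, the algorithm receives $n$ and $N=\lceil K n\log n\rceil = O(n\log n)$ strings of length at most $n$, where $K$ is a universal constant, and it always halts after at most $T(n)$ steps, where $T$ is a polynomial (on a random access machine whose instructions are assignment, addition, truncated subtraction, reading and writing array cells, and branching on zero, each at unit cost). For every $n\ge 1$, every $\delta\in[0,c_0]$, every integer $L\ge C(\log n)^8$ and every $L$-separated string $x\in\{0,1\}^n$, if the $N$ strings are independent traces of $x$ with deletion probability $\delta$, then the algorithm outputs $x$ with probability at least $1-A/n^3$, where $A$ is a universal constant. (The algorithm is not told $\delta$ or $L$.) -/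

import Mathlib

open MeasureTheory ProbabilityTheory

namespace TraceReconstruction

/-! ### Strings, separation, and the deletion channel -/

/-- The bit string `x₀ x₁ ⋯ xₙ₋₁` is `L`-separated: between any two consecutive ones, at positions
`i < j`, there are at least `L` zeros. (All of the `j - i - 1` positions strictly between two
consecutive ones hold zeros.) -/
def IsSeparated {n : ℕ} (L : ℕ) (x : Fin n → Bool) : Prop :=
  ∀ i j : Fin n, i < j → x i = true → x j = true →
    (∀ k : Fin n, i < k → k < j → x k = false) → i.val + 1 + L ≤ j.val

/-- The trace of `x` in which exactly the positions `i` with `keep i = true` are retained, in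
their order, and concatenated. -/
def trace {n : ℕ} (x : Fin n → Bool) (keep : Fin n → Bool) : List Bool :=
  ((List.finRange n).filter keep).map x

/-- The law of the retention pattern of one string of length `n`: each position is independently
deleted (`false`) with probability `δ` and retained (`true`) with probability `1 - δ`. -/
noncomputable def keepLaw (n : ℕ) (δ : unitInterval) : Measure (Fin n → Bool) :=
  Measure.pi fun _ => bernoulliMeasure false true δ

/-- The joint law of the retention patterns of `N` independent traces. -/
noncomputable def keepLaws (N n : ℕ) (δ : unitInterval) : Measure (Fin N → Fin n → Bool) :=
  Measure.pi fun _ => keepLaw n δ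

/-! ### Algorithms: random access machines with a step count

A program works on finitely many registers and finitely many arrays, all holding natural numbers.
Each elementary instruction and each evaluation of a test costs one step. The only arithmetic is
addition and truncated subtraction, so that numbers grow by at most one bit per step and running
times are polynomially related to those of Turing machines. -/

/-- Contents of the memory: `reg r` is the value of register `r`, and `arr a k` is the value of
cell `k` of array `a`. -/
structure State where
  reg : ℕ → ℕ
  arr : ℕ → ℕ → ℕ

/-- Write the value `v` into register `r`. -/
def State.setReg (s : State) (r v : ℕ) : State :=
  { s with reg := Function.update s.reg r v }

/-- Write the value `v` into cell `k` of array `a`. -/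
def State.setArr (s : State) (a k v : ℕ) : State :=
  { s with arr := Function.update s.arr a (Function.update (s.arr a) k v) }

/-- Programs. In the elementary instructions, `r`, `p`, `q` are names of registers, `a` is the
name of an array, and `c` is a constant. -/
inductive Prog where
  /-- `r := c` -/
  | const (r c : ℕ)
  /-- `r := p + q` -/
  | add (r p q : ℕ)
  /-- `r := p - q`, truncated at zero -/
  | sub (r p q : ℕ)
  /-- `r := a[p]` -/
  | load (r a p : ℕ)
  /-- `a[p] := r` -/
  | store (a p r : ℕ)
  /-- first `P`, then `Q` -/
  | seq (P Q : Prog)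
  /-- if register `r` is nonzero then `P` else `Q` -/
  | ite (r : ℕ) (P Q : Prog)
  /-- while register `r` is nonzero do `P` -/
  | loop (r : ℕ) (P : Prog)

/-- `Exec P s t s'`: started in the memory state `s`, the program `P` halts after exactly `t`
steps in the memory state `s'`. -/
inductive Exec : Prog → State → ℕ → State → Prop where
  | const (r c : ℕ) (s : State) : Exec (.const r c) s 1 (s.setReg r c)
  | add (r p q : ℕ) (s : State) : Exec (.add r p q) s 1 (s.setReg r (s.reg p + s.reg q))
  | sub (r p q : ℕ) (s : State) : Exec (.sub r p q) s 1 (s.setReg r (s.reg p - s.reg q))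
  | load (r a p : ℕ) (s : State) : Exec (.load r a p) s 1 (s.setReg r (s.arr a (s.reg p)))
  | store (a p r : ℕ) (s : State) : Exec (.store a p r) s 1 (s.setArr a (s.reg p) (s.reg r))
  | seq {P Q : Prog} {s₀ s₁ s₂ : State} {t₁ t₂ : ℕ} :
      Exec P s₀ t₁ s₁ → Exec Q s₁ t₂ s₂ → Exec (.seq P Q) s₀ (t₁ + t₂) s₂
  | iteTrue {r : ℕ} {P Q : Prog} {s s' : State} {t : ℕ} :
      s.reg r ≠ 0 → Exec P s t s' → Exec (.ite r P Q) s (t + 1) s'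
  | iteFalse {r : ℕ} {P Q : Prog} {s s' : State} {t : ℕ} :
      s.reg r = 0 → Exec Q s t s' → Exec (.ite r P Q) s (t + 1) s'
  | loopDone {r : ℕ} {P : Prog} {s : State} :
      s.reg r = 0 → Exec (.loop r P) s 1 s
  | loopStep {r : ℕ} {P : Prog} {s₀ s₁ s₂ : State} {t₁ t₂ : ℕ} :
      s₀.reg r ≠ 0 → Exec P s₀ t₁ s₁ → Exec (.loop r P) s₁ t₂ s₂ →
        Exec (.loop r P) s₀ (t₁ + t₂ + 1) s₂

/-- The initial memory on input `n` and `N` strings `y₀, …, y_{N-1}` of length at most `n`: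
register `0` holds `n`, register `1` holds `N`, cell `i < N` of array `0` holds the length of `yᵢ`,
cell `i * n + j` of array `1` holds bit `j` of `yᵢ`, and everything else is `0`. -/
def initState (n : ℕ) {N : ℕ} (y : Fin N → List Bool) : State where
  reg r := if r = 0 then n else if r = 1 then N else 0
  arr a k :=
    if a = 0 then
      if h : k < N then (y ⟨k, h⟩).length else 0
    else if a = 1 then
      if h : k / n < N then ((y ⟨k / n, h⟩).getD (k % n) false).toNat else 0
    else 0

/-- The memory state `s` holds the answer `x`: the first `n` cells of array `2` are the bits of
`x`. -/
def State.Outputs {n : ℕ} (s : State) (x : Fin n → Bool) : Prop :=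
  ∀ i : Fin n, s.arr 2 i = (x i).toNat

/-- On input `n` and the strings `y`, the program `P` halts within `T` steps with answer `x`. -/
def Reconstructs (P : Prog) (T : ℕ) {n N : ℕ} (y : Fin N → List Bool) (x : Fin n → Bool) : Prop :=
  ∃ t s, t ≤ T ∧ Exec P (initState n y) t s ∧ s.Outputs x

/-- The number of traces, `⌈K n log n⌉`. -/
noncomputable def numTraces (K n : ℕ) : ℕ :=
  ⌈(K : ℝ) * n * Real.log n⌉₊

end TraceReconstruction

namespace TraceReconstruction

/-! ### Embeddings of retained blocks -/

/-! Put an extra one at either end of the string, so that the ones have indices 0, …, m. With high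
probability all retained lengths between ones agree with their expectations up to a relative error
of order 1/D, where D is of order (log n)^2 (`Concentrated.gapsClose`). Separation enters only here;
the two end gaps may be short and are therefore padded by n. A first batch of n traces gives a
coarse picture of the line of ones, one gap per stage. The remaining traces, scanned along this
picture from both sides, give every gap exactly.

The scan assigns to each one of a trace the least index compatible with its distance from the
preceding one. The true index is always compatible, so assigned indices are never too large
(`srcScan_spec`). If one is too small, then the blocks between retained ones embed, up to relative
error 2/D, into the line itself in such a way that they arrive at least one place early. This is the
event `Lags`, which depends on the deleted indices alone. The heart of the proof is that it has
probability at most 1/20 for every line, nearly periodic ones included (`measureReal_lags_le`).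

The bound is a union bound over inclusion-minimal deletion sets. In a minimal set let s be the last
start on the diagonal and e the first place where the line without deletions can finish, at shift g.
The places from which the latest start that still arrives in time is shifted by exactly g form an
interval beginning at some ρ. If s ≥ ρ, the line would match itself at the shifts 0 and g all along
(s, e], and a comparison of masses shows that few deletions cannot lead from one shift to the other
(`not_emb_shift`). Hence s < ρ ≤ e, and cutting at the block across ρ leaves a minimal set for the
part on the left and one for the reversed and shifted line on the right (`IsExcursion.decompose`),
either of which may be empty. As ρ does not depend on the set, its position costs no factor, and the
weighted counts obey a recursion of Catalan type whose solution does not depend on n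
(`sum_minHits_le`). The comparison of masses needs sets of size O(log n). A larger minimal set
contains a long run of deletions or a minimal set of medium size for one of polynomially many
related problems, and these have negligible total weight (`exists_cover`).

Majority votes then make every stage of the coarse picture accurate (`coarseY_spec`). In the second
batch a gap is recognized when the indices assigned from the left and from the right add up; since
neither scan overestimates, recognition is always correct (`isRecognized_iff`). Whether a gap is
visible depends only on what happens outside it, so conditioning on visibility does not bias the
number of zeros retained inside (`hasSubgaussianMGF_visible`). Averages over about n log n traces,
together with the trace lengths, which replace the unknown δ, determine each gap up to an error
below 1/2 (`roundRatio_eq`).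

The algorithm is written with bounded sums and counting loops only, so its polynomial running time
can be read off its syntax (`Stmt.compile_correct`). -/

/-- The block `(i', i]` of the line `X` matches the block `(k', k]` of the line `Y` up to the
relative error `ε`. -/
def Matches (ε : ℝ) (X Y : ℤ → ℝ) (k' k i' i : ℤ) : Prop :=
  |(Y k - Y k') - (X i - X i')| ≤ ε * (X i - X i')

/-- `Emb R E s α e β`: after deletion of the indices in `E`, the consecutive blocks of `(s, e]`
can be matched through `R`, in order, with disjoint blocks of `(α, β]`. -/
inductive Emb (R : ℤ → ℤ → ℤ → ℤ → Prop) (E : Finset ℤ) (s α : ℤ) : ℤ → ℤ → Prop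
  | refl {β : ℤ} : α ≤ β → Emb R E s α s β
  | step {t κ e β k' k : ℤ} : Emb R E s α t κ → t < e → (∀ u, t < u → u < e → u ∈ E) → e ∉ E →
      κ ≤ k' → k' < k → k ≤ β → R k' k t e → Emb R E s α e β

namespace Emb

variable {R : ℤ → ℤ → ℤ → ℤ → Prop} {E E' : Finset ℤ} {s α e β t κ : ℤ}

theorem le_left (h : Emb R E s α e β) : s ≤ e := by
  induction h with
  | refl _ => exact le_rfl
  | step _ h1 _ _ _ _ _ _ ih => omega

theorem le_right (h : Emb R E s α e β) : α ≤ β := by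
  induction h with
  | refl h => exact h
  | step _ h1 _ _ _ _ _ _ ih => omega

theorem mono_right (h : Emb R E s α e β) {β' : ℤ} (hβ : β ≤ β') : Emb R E s α e β' := by
  cases h with
  | refl h => exact .refl (h.trans hβ)
  | step a b c d e f g h => exact .step a b c d e f (g.trans hβ) h

theorem mono_left (h : Emb R E s α e β) {α' : ℤ} (hα : α' ≤ α) : Emb R E s α' e β := by
  induction h with
  | refl h => exact .refl (hα.trans h)
  | step _ b c d e f g h ih => exact .step ih b c d e f g h

theorem trans (h : Emb R E s α t κ) (h' : Emb R E t κ e β) : Emb R E s α e β := by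
  induction h' with
  | refl h1 => exact h.mono_right h1
  | step _ b c d e f g h ih => exact .step ih b c d e f g h

theorem end_notMem (h : Emb R E s α e β) : s = e ∨ e ∉ E := by
  cases h with
  | refl h => exact .inl rfl
  | step a b c d e f g h => exact .inr d

/-- Blocks end at retained indices, so a retained `t` never lies strictly inside a block. -/
theorem split (h : Emb R E s α e β) (hst : s ≤ t) (hte : t ≤ e) (ht : t ∉ E) :
    ∃ κ, Emb R E s α t κ ∧ Emb R E t κ e β := by
  induction h with
  | @refl β h =>
    obtain rfl : t = s := by omega
    exact ⟨α, .refl le_rfl, .refl h⟩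
  | @step t0 κ0 e0 β0 k' k h1 b c d e f g h ih =>
    rcases hte.eq_or_lt with rfl | hlt
    · exact ⟨β0, .step h1 b c d e f g h, .refl le_rfl⟩
    · have : t ≤ t0 := by
        by_contra hc
        exact ht (c t (by omega) hlt)
      obtain ⟨κ, p1, p2⟩ := ih this
      exact ⟨κ, p1, .step p2 b c d e f g h⟩

theorem congr (h : Emb R E s α e β) (hE : ∀ u, s < u → u ≤ e → (u ∈ E ↔ u ∈ E')) :
    Emb R E' s α e β := by
  induction h with
  | refl h => exact .refl h
  | @step t0 κ0 e0 β0 k' k h1 b c d e f g h ih =>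
    have hs := h1.le_left
    refine .step (ih fun u h1 h2 => hE u h1 (by omega)) b
      (fun u h1 h2 => (hE u (by omega) (by omega)).1 (c u h1 h2)) ?_ e f g h
    rw [← hE _ (by omega) le_rfl]
    exact d

/-- Every matched block takes at least one place of the target, so places can be gained only at
deleted indices. -/
theorem count (h : Emb R E s α e β) : e - s ≤ β - α + (E ∩ Finset.Ioo s e).card := by
  induction h with
  | refl h => simp; omega
  | @step t0 κ0 e0 β0 k' k h1 b c d e f g h ih =>
    have hs := h1.le_left
    have hsub : (E ∩ Finset.Ioo s t0) ∪ Finset.Ioo t0 e0 ⊆ E ∩ Finset.Ioo s e0 := by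
      intro u
      simp only [Finset.mem_union, Finset.mem_inter, Finset.mem_Ioo]
      rintro (⟨h1, h2, h3⟩ | ⟨h1, h2⟩)
      · exact ⟨h1, h2, by omega⟩
      · exact ⟨c u h1 h2, by omega, h2⟩
    have hcard := Finset.card_le_card hsub
    rw [Finset.card_union_of_disjoint] at hcard
    · rw [Int.card_Ioo] at hcard
      omega
    · rw [Finset.disjoint_left]
      simp only [Finset.mem_inter, Finset.mem_Ioo]
      intro a; omega

theorem block (h : Emb R E s α e β) (hse : s < e) (hE : ∀ u, s < u → u < e → u ∈ E) :
    ∃ k' k, α ≤ k' ∧ k' < k ∧ k ≤ β ∧ R k' k s e := by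
  cases h with
  | refl h => omega
  | @step t0 κ0 _ _ k' k h1 b c d e f g h =>
    have hs := h1.le_left
    rcases h1.end_notMem with rfl | hn
    · exact ⟨k', k, h1.le_right.trans e, f, g, h⟩
    · rcases hs.eq_or_lt with rfl | hlt
      · exact ⟨k', k, h1.le_right.trans e, f, g, h⟩
      · exact absurd (hE _ hlt b) hn

theorem single {k' k : ℤ} (hse : s < e) (hE : ∀ u, s < u → u < e → u ∈ E) (he : e ∉ E)
    (h1 : α ≤ k') (h2 : k' < k) (h3 : k ≤ β) (h : R k' k s e) : Emb R E s α e β :=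
  .step (.refl le_rfl) hse hE he h1 h2 h3 h

end Emb

/-- The matching relation of the two lines read backwards, the second one shifted by `g`. -/
def reflectRel (R : ℤ → ℤ → ℤ → ℤ → Prop) (g k' k i' i : ℤ) : Prop :=
  R (-k - g) (-k' - g) (-i) (-i')

/-- The reversed problem is again a matching problem between two increasing lines. This is why the
counting bound is proved for arbitrary pairs `X`, `Y` and not only for a line and itself. -/
theorem reflectRel_matches (ε : ℝ) (X Y : ℤ → ℝ) (g : ℤ) :
    reflectRel (Matches ε X Y) g =
      Matches ε (fun j => -X (-j)) (fun j => -Y (-j - g)) := by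
  funext k' k i' i
  simp only [reflectRel, Matches]
  rw [show Y (-k' - g) - Y (-k - g) = -Y (-k - g) - -Y (-k' - g) by ring,
    show X (-i') - X (-i) = -X (-i) - -X (-i') by ring]

/-- Reversal of an embedding. -/
theorem Emb.reflect {R : ℤ → ℤ → ℤ → ℤ → Prop} {E : Finset ℤ} {s α e β : ℤ}
    (h : Emb R E s α e β) (hs : s ∉ E) (g : ℤ) :
    Emb (reflectRel R g) (E.image (fun u => -u)) (-e) (-β - g) (-s) (-α - g) := by
  induction h with
  | refl h => exact .refl (by omega)
  | @step t0 κ0 e0 β0 k' k h1 b c d e f g' h ih =>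
    have ht : t0 ∉ E := by
      rcases h1.end_notMem with rfl | h
      · exact hs
      · exact h
    refine Emb.trans (Emb.single (k' := -k - g) (k := -k' - g) (by omega) ?_ ?_ (by omega) (by omega)
      (by omega) ?_) ih
    · intro u h1 h2
      exact Finset.mem_image.2 ⟨-u, c _ (by omega) (by omega), by simp⟩
    · simpa using ht
    · simpa [reflectRel] using h

theorem Emb.of_reflect {R : ℤ → ℤ → ℤ → ℤ → Prop} {E : Finset ℤ} {s α e β g : ℤ}
    (h : Emb (reflectRel R g) E s α e β) (hs : s ∉ E) :
    Emb R (E.image (fun u => -u)) (-e) (-β - g) (-s) (-α - g) := by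
  have := h.reflect hs g
  convert this using 1
  funext a b c d
  simp [reflectRel]

/-- A chain of positions through which an embedding passes. -/
theorem Emb.exists_chain {R : ℤ → ℤ → ℤ → ℤ → Prop} {E : Finset ℤ} {s α e β : ℤ}
    (h : Emb R E s α e β) : ∃ κ : ℤ → ℤ, α ≤ κ s ∧ κ e = β ∧
      (∀ u, s < u → u ≤ e → u ∈ E → κ u = κ (u - 1)) ∧
      (∀ u, s < u → u ≤ e → u ∉ E → κ (u - 1) + 1 ≤ κ u) ∧
      ∀ u v, s ≤ u → u ≤ v → v ≤ e → (u = s ∨ u ∉ E) → (v = s ∨ v ∉ E) →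
        Emb R E u (κ u) v (κ v) := by
  induction h with
  | @refl β h =>
    refine ⟨fun _ => β, h, rfl, by intros; omega, by intros; omega, ?_⟩
    intro u v h1 h2 h3 _ _
    obtain rfl : v = s := by omega
    obtain rfl : u = v := by omega
    exact .refl le_rfl
  | @step t0 κ0 e0 β0 k' k h1 b c d e f g h ih =>
    obtain ⟨κ, a1, a2, a3, a4, a5⟩ := ih
    have hs := h1.le_left
    -- The chain stands still on the deleted indices of a block and makes the whole jump at its
    -- retained end.
    refine ⟨fun u => if u ≤ t0 then κ u else if u < e0 then κ t0 else β0, ?_, ?_, ?_, ?_, ?_⟩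
    · simp [hs, a1]
    · simp [b]
    · intro u h1 h2 h3
      by_cases hu : u ≤ t0
      · simp only [hu, if_true, (by omega : u - 1 ≤ t0)]
        exact a3 u h1 hu h3
      · have : u < e0 := lt_of_le_of_ne h2 (by rintro rfl; exact d h3)
        simp only [hu, if_false, this, if_true]
        by_cases hu' : u - 1 ≤ t0
        · obtain rfl : u = t0 + 1 := by omega
          simp
        · simp [hu', (by omega : u - 1 < e0)]
    · intro u h1 h2 h3
      by_cases hu : u ≤ t0
      · simp only [hu, if_true, (by omega : u - 1 ≤ t0)]
        exact a4 u h1 hu h3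
      · have : u = e0 := by
          by_contra hc
          exact h3 (c u (by omega) (by omega))
        subst this
        simp only [hu, if_false, lt_irrefl]
        by_cases hu' : u - 1 ≤ t0
        · obtain rfl : u = t0 + 1 := by omega
          simp; omega
        · simp [hu']; omega
    · intro u v h1' h2 h3 h4 h5
      by_cases hv : v ≤ t0
      · simp only [hv, if_true, h2.trans hv]
        exact a5 u v h1' h2 hv h4 h5
      · have : v = e0 := by
          by_contra hc
          rcases h5 with rfl | h5
          · omega
          · exact h5 (c v (by omega) (by omega))
        subst this
        simp only [hv, if_false, lt_irrefl]
        by_cases hu : u ≤ t0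
        · simp only [hu, if_true]
          refine .step (a5 u t0 h1' hu le_rfl h4 ?_) b c d (by omega) f g h
          rcases h1.end_notMem with h | h
          · exact .inl h.symm
          · exact .inr h
        · have : u = v := by
            by_contra hc
            rcases h4 with rfl | h4
            · omega
            · exact h4 (c u (by omega) (by omega))
          subst this
          simp only [hu, if_false, lt_irrefl]
          exact .refl le_rfl

/-! ### Comparison of masses and the impossibility of changing between two persistent shifts -/

/-- A block loses at most the fraction `ε` of its length when it is matched, and the target blocks
are disjoint. -/
theorem Emb.mass {ε : ℝ} {X Y : ℤ → ℝ} (hY : StrictMono Y) {E : Finset ℤ} {s α e β : ℤ}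
    (h : Emb (Matches ε X Y) E s α e β) : (1 - ε) * (X e - X s) ≤ Y β - Y α := by
  induction h with
  | refl h => simpa using hY.monotone h
  | @step t0 κ0 e0 β0 k' k h1 b c d e f g h ih =>
    have := (abs_le.1 h).1
    have h2 := hY.monotone e
    have h3 := hY.monotone g
    nlinarith

theorem sub_le_of_gaps {X : ℤ → ℝ} {M : ℝ} {t e : ℤ} (hte : t ≤ e)
    (h : ∀ u, t < u → u ≤ e → X u - X (u - 1) ≤ M) : X e - X t ≤ (e - t) * M := by
  induction e, hte using Int.leInduction with
  | base => simp
  | succ e hte ih =>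
    have h1 := ih fun u h1 h2 => h u h1 (by omega)
    have h2 := h (e + 1) (by omega) le_rfl
    rw [add_sub_cancel_right] at h2
    push_cast
    linarith

/-- Hopping downwards in steps of length `g` until the window `(p - g, p]`. -/
theorem gap_le_of_hops {y : ℤ → ℝ} {ρ Δ : ℝ} {g p q : ℤ} (hg : 1 ≤ g) (hρ : 1 ≤ ρ) (hΔ : 0 ≤ Δ)
    (h : ∀ u, p < u → u ≤ q → y u ≤ ρ * y (u - g)) (h0 : ∀ u, p - g < u → u ≤ p → y u ≤ Δ)
    (n : ℕ) : ∀ u, p - g < u → u ≤ q → u ≤ p + n → y u ≤ ρ ^ n * Δ := by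
  induction n with
  | zero => intro u h1 h2 h3; simpa using h0 u h1 (by simpa using h3)
  | succ n ih =>
    intro u h1 h2 h3
    by_cases hu : u ≤ p
    · exact (h0 u h1 hu).trans (le_mul_of_one_le_left hΔ (one_le_pow₀ hρ))
    · rw [pow_succ', mul_assoc]
      refine (h u (by omega) h2).trans ?_
      gcongr
      exact ih _ (by omega) (by omega) (by push_cast at h3; omega)

theorem one_add_pow_le_two {x : ℝ} {n : ℕ} (hx : 0 ≤ x) (h : n * x ≤ 1 / 2) : (1 + x) ^ n ≤ 2 := by
  have h1 : (1 + x) ^ n ≤ Real.exp (n * x) := by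
    rw [Real.exp_nat_mul]
    gcongr
    linarith [Real.add_one_le_exp x]
  refine h1.trans ((Real.exp_le_exp.2 h).trans ?_)
  have := Real.exp_one_lt_d9
  have h2 : Real.exp (1 / 2) ^ 2 = Real.exp 1 := by
    rw [← Real.exp_nat_mul]; norm_num
  nlinarith [Real.exp_pos (1 / 2)]

/-- In a window where every increment is `1` outside few places, some run of length `g + 1` has all
increments equal to `1`. -/
theorem exists_run {B : Finset ℤ} {g e : ℤ} (hg : 0 ≤ g) {c : ℕ} (hB : B.card ≤ c) :
    ∃ j : ℤ, 1 ≤ j ∧ j ≤ c + 1 ∧ ∀ u, e - (j + 1) * (g + 1) < u → u ≤ e - j * (g + 1) → u ∉ B := by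
  by_contra! hc
  choose! f hf1 hf2 hf3 using hc
  -- The `c + 1` windows of length `g + 1` below `e` are disjoint; if each contained a point of `B`,
  -- there would be more than `c` points.
  have : (Finset.Icc (1 : ℤ) (c + 1)).card ≤ B.card := by
    refine Finset.card_le_card_of_injOn f ?_ ?_
    · intro j hj
      simp only [Finset.coe_Icc, Set.mem_Icc] at hj
      exact hf3 j hj.1 hj.2
    · intro i hi j hj hij
      simp only [Finset.coe_Icc, Set.mem_Icc] at hi hj
      have a1 := hf1 i hi.1 hi.2
      have a2 := hf2 i hi.1 hi.2
      have b1 := hf1 j hj.1 hj.2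
      have b2 := hf2 j hj.1 hj.2
      rw [hij] at a1 a2
      have c1 : (i - (j + 1)) * (g + 1) < 0 := by linarith
      have c2 : (j - (i + 1)) * (g + 1) < 0 := by linarith
      have c3 : i - (j + 1) < 0 := by
        by_contra hcc
        have := mul_nonneg (not_lt.1 hcc) (by omega : 0 ≤ g + 1)
        omega
      have c4 : j - (i + 1) < 0 := by
        by_contra hcc
        have := mul_nonneg (not_lt.1 hcc) (by omega : 0 ≤ g + 1)
        omega
      omega
  rw [Int.card_Icc] at this
  omega

/-- The chain starts on or above the diagonal and ends at or below it, while only deleted indices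
fall behind. The surplus steps at retained indices are therefore paid for by deletions, and each
deletion accounts for at most two irregular steps: itself and one surplus step. -/
theorem card_slow_steps {E : Finset ℤ} {s e g : ℤ} (hse : s ≤ e) (hg : 0 ≤ g) {κ : ℤ → ℤ}
    (h0 : s ≤ κ s) (h1 : κ e = e - g)
    (h2 : ∀ u, s < u → u ≤ e → u ∈ E → κ u = κ (u - 1))
    (h3 : ∀ u, s < u → u ≤ e → u ∉ E → κ (u - 1) + 1 ≤ κ u) (he : e ∉ E) {c : ℕ}
    (hc : (E ∩ Finset.Ioo s e).card ≤ c) :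
    ((Finset.Ioc s e).filter fun u => κ u ≠ κ (u - 1) + 1).card ≤ 2 * c := by
  have key : ∀ v, s ≤ v → v ≤ e →
      (((Finset.Ioc s v).filter fun u => κ u ≠ κ (u - 1) + 1).card : ℤ) + (v - s) ≤
        κ v - κ s + 2 * (E ∩ Finset.Ioc s v).card := by
    intro v hv
    induction v, hv using Int.leInduction with
    | base => simp
    | succ v hv ih =>
      intro hve
      have ih := ih (by omega)
      have hI : Finset.Ioc s (v + 1) = insert (v + 1) (Finset.Ioc s v) := by
        ext; simp; omega
      rw [hI, Finset.filter_insert]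
      have hn : v + 1 ∉ Finset.Ioc s v := by simp
      have hn1 : v + 1 ∉ (Finset.Ioc s v).filter fun u => κ u ≠ κ (u - 1) + 1 :=
        fun h => hn (Finset.mem_filter.1 h).1
      have hn2 : v + 1 ∉ E ∩ Finset.Ioc s v := fun h => hn (Finset.mem_inter.1 h).2
      by_cases hE : v + 1 ∈ E
      · have := h2 _ (by omega) hve hE
        rw [add_sub_cancel_right] at this
        rw [Finset.inter_insert_of_mem hE, if_pos (by rw [add_sub_cancel_right]; omega), Finset.card_insert_of_notMem hn1,
          Finset.card_insert_of_notMem hn2]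
        push_cast
        omega
      · have := h3 _ (by omega) hve hE
        rw [add_sub_cancel_right] at this
        rw [Finset.inter_insert_of_notMem hE]
        split_ifs with hk
        · rw [Finset.card_insert_of_notMem hn1]
          rw [add_sub_cancel_right] at hk
          push_cast
          omega
        · omega
  have := key e hse le_rfl
  have hE : E ∩ Finset.Ioc s e = E ∩ Finset.Ioo s e := by
    ext u
    simp only [Finset.mem_inter, Finset.mem_Ioc, Finset.mem_Ioo]
    constructor
    · rintro ⟨a, b, c⟩
      refine ⟨a, b, lt_of_le_of_ne c ?_⟩
      rintro rfl
      exact he a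
    · rintro ⟨a, b, c⟩
      exact ⟨a, b, c.le⟩
  rw [hE] at this
  omega

/-- While the lines at shifts `0` and `g` both persist, an embedding that starts at shift `0`
cannot arrive at shift `g` with the help of few deletions. -/
theorem not_emb_shift {ε : ℝ} {X Y : ℤ → ℝ} (hX : StrictMono X) (hY : StrictMono Y) {c : ℕ}
    (hε0 : 0 ≤ ε) (hε : ε * (1000 * ((c : ℝ) + 1) ^ 2) ≤ 1) {g : ℤ} (hg : 1 ≤ g) {E : Finset ℤ}
    {s e : ℤ} (hbase : ∀ u, s < u → u ≤ e → Matches ε X Y (u - 1) u (u - 1) u)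
    (hshift : ∀ u, s < u → u ≤ e → Matches ε X Y (u - 1 - g) (u - g) (u - 1) u)
    (hE : (E ∩ Finset.Ioo s e).card ≤ c) : ¬ Emb (Matches ε X Y) E s s e (e - g) := by
  obtain ⟨n, hn⟩ : ∃ n : ℕ, e - s ≤ n := ⟨(e - s).toNat, by omega⟩
  -- The long case below needs the statement on shorter intervals.
  induction n using Nat.strong_induction_on generalizing s e with
  | _ n IH =>
  intro h
  have hcount := h.count
  have hse : s < e := by
    rcases h.le_left.eq_or_lt with rfl | h'
    · simp at hcount; omega
    · exact h'
  have hgc : g ≤ c := by omega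
  have hgc' : (g : ℝ) ≤ c := by exact_mod_cast hgc
  have hg' : (1 : ℝ) ≤ g := by exact_mod_cast hg
  have IH' : ∀ s' e', s ≤ s' → e' ≤ e → e' - s' < e - s → ¬ Emb (Matches ε X Y) E s' s' e' (e' - g) := by
    intro s' e' h1 h2 h3 hemb
    have := hemb.le_left
    refine IH (e' - s').toNat (by omega) (s := s') (e := e') (fun u a b => hbase u (by omega) (by omega))
      (fun u a b => hshift u (by omega) (by omega)) (le_trans (Finset.card_le_card ?_) hE)
      (by omega) hemb
    refine Finset.inter_subset_inter_left (Finset.Ioo_subset_Ioo h1 h2)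
  have he : e ∉ E := by
    rcases h.end_notMem with h | h
    · omega
    · exact h
  have hε1 : ε ≤ 1 / 1000 := by nlinarith [sq_nonneg (c : ℝ), (Nat.cast_nonneg c : (0 : ℝ) ≤ c)]
  have hb : ∀ u, s < u → u ≤ e → X u - X (u - 1) ≤ 2 * (Y u - Y (u - 1)) := by
    intro u h1 h2
    have := (abs_le.1 (hbase u h1 h2)).1
    have hx := hX (sub_one_lt u)
    nlinarith
  -- Both lines match the same gap of `X` at `u`, so the gaps of `Y` are periodic with period `g` up
  -- to the factor (1 + ε)/(1 - ε) ≤ 1 + 3ε.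
  have hhop : ∀ u, s < u → u ≤ e → Y u - Y (u - 1) ≤ (1 + 3 * ε) * (Y (u - g) - Y (u - g - 1)) := by
    intro u h1 h2
    have a := (abs_le.1 (hbase u h1 h2)).2
    have b := (abs_le.1 (hshift u h1 h2)).1
    rw [show u - 1 - g = u - g - 1 by ring] at b
    have hx := hX (sub_one_lt u)
    have hx' : 0 ≤ X u - X (u - 1) := by linarith
    have b' : (1 - ε) * (X u - X (u - 1)) ≤ Y (u - g) - Y (u - g - 1) := by linarith
    have : (1 + ε) * (X u - X (u - 1)) ≤ (1 + 3 * ε) * ((1 - ε) * (X u - X (u - 1))) := by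
      have : 0 ≤ (ε - 3 * ε * ε) * (X u - X (u - 1)) :=
        mul_nonneg (by nlinarith) hx'
      nlinarith
    have h3 : (1 + 3 * ε) * ((1 - ε) * (X u - X (u - 1))) ≤ (1 + 3 * ε) * (Y (u - g) - Y (u - g - 1)) := by
      gcongr
    linarith
  have hline : ∀ u, s ≤ u → u ≤ e → Y (e - g) - Y (u - g) ≤ (1 + ε) * (X e - X u) := by
    intro u hsu hue
    have : ∀ v, u ≤ v → v ≤ e → Y (v - g) - Y (u - g) ≤ (1 + ε) * (X v - X u) := by
      intro v hv
      induction v, hv using Int.leInduction with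
      | base => intro; simp
      | succ v hv ih =>
        intro hve
        have a := ih (by omega)
        have b := (abs_le.1 (hshift (v + 1) (by omega) hve)).2
        rw [add_sub_cancel_right] at b
        linarith
    exact this e hue le_rfl
  -- The embedding puts at least 1 - ε of the mass of (t, e] into (κ, e - g], and the line at shift
  -- `g` puts at most 1 + ε of it into (t - g, e - g]. Almost nothing is left between t - g and κ.
  have hstar : ∀ t κ, s ≤ t → t ≤ e → Emb (Matches ε X Y) E t κ e (e - g) →
      Y κ - Y (t - g) ≤ 2 * ε * (X e - X t) := by
    intro t κ h1 h2 h3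
    have a := h3.mass hY
    have b := hline t h1 h2
    linarith
  -- a gap bound on `(t, e]` contradicts the mass balance
  have hfinal : ∀ t Δ, s ≤ t → t < e → ((e - t : ℤ) : ℝ) ≤ 2 * ((c : ℝ) + 1) ^ 2 →
      0 ≤ Δ → Δ ≤ 2 * ε * (X e - X t) →
      (∀ u, t < u → u ≤ e → Y u - Y (u - 1) ≤ 2 * Δ) → False := by
    intro t Δ h1 h2 h3 h4 h5 h6
    have a := sub_le_of_gaps (M := 4 * Δ) h2.le fun u h7 h8 =>
      (hb u (by omega) h8).trans (by linarith [h6 u h7 h8])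
    have hx : 0 < X e - X t := sub_pos.2 (hX h2)
    push_cast at h3
    have b : (e - t : ℝ) * (4 * Δ) ≤ 2 * ((c : ℝ) + 1) ^ 2 * (4 * (2 * ε * (X e - X t))) := by
      gcongr
    have b2 : 2 * ((c : ℝ) + 1) ^ 2 * (4 * (2 * ε * (X e - X t))) =
        (ε * (1000 * ((c : ℝ) + 1) ^ 2)) * (X e - X t) * (16 / 1000) := by ring
    have b3 : (ε * (1000 * ((c : ℝ) + 1) ^ 2)) * (X e - X t) ≤ 1 * (X e - X t) := by gcongr
    linarith
  have hpow : ∀ n : ℕ, (n : ℝ) ≤ 5 * ((c : ℝ) + 1) ^ 2 → (1 + 3 * ε) ^ n ≤ 2 := by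
    intro n hn
    refine one_add_pow_le_two (by linarith) ?_
    calc (n : ℝ) * (3 * ε) ≤ 5 * ((c : ℝ) + 1) ^ 2 * (3 * ε) := by gcongr
      _ = ε * (1000 * ((c : ℝ) + 1) ^ 2) * (15 / 1000) := by ring
      _ ≤ 1 / 2 := by linarith
  have hYgap : ∀ u : ℤ, 0 ≤ Y u - Y (u - 1) := fun u => by linarith [hY (sub_one_lt u)]
  by_cases hlong : (2 * c + 2) * (g + 1) ≤ e - s
  · -- the long case
    obtain ⟨κ, k1, k2, k3, k4, k5⟩ := h.exists_chain
    -- At most `2 * c` steps of the chain are irregular, so near `e` there is a window of length `g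
    -- + 1` on which the chain keeps a constant shift `b`.
    obtain ⟨j, hj1, hj2, hj⟩ := exists_run (e := e) (g := g) (by omega)
      (card_slow_steps hse.le (by omega) k1 k2 k3 k4 he hE)
    push_cast at hj2
    set t := e - j * (g + 1) with ht
    have ht1 : e - (j + 1) * (g + 1) = t - g - 1 := by rw [ht]; ring
    rw [ht1] at hj
    have hjg : (j + 1) * (g + 1) ≤ (2 * c + 2) * (g + 1) :=
      mul_le_mul_of_nonneg_right (by omega) (by omega)
    have hst : s ≤ t - g - 1 := by omega
    have hjp : 0 < j * (g + 1) := mul_pos (by omega) (by omega)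
    have hte : t < e := by omega
    have hgood : ∀ u, t - g - 1 < u → u ≤ t → κ u = κ (u - 1) + 1 := by
      intro u h1 h2
      by_contra hc
      exact hj u h1 h2 (Finset.mem_filter.2 ⟨Finset.mem_Ioc.2 ⟨by omega, by omega⟩, hc⟩)
    have hret : ∀ u, t - g - 1 < u → u ≤ t → u ∉ E := by
      intro u h1 h2 h3
      have := hgood u h1 h2
      rw [k3 u (by omega) (by omega) h3] at this
      omega
    set b := t - κ t with hbdef
    have hκ : ∀ u, t - g ≤ u → u ≤ t → κ u = u - b := by
      have : ∀ i : ℕ, (i : ℤ) ≤ g → κ (t - i) = t - i - b := by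
        intro i
        induction i with
        | zero => intro; simp [hbdef]
        | succ i ih =>
          intro hi
          push_cast at hi ⊢
          have a := ih (by omega)
          have b := hgood (t - i) (by omega) (by omega)
          rw [show t - (i + 1 : ℤ) = t - i - 1 by ring]
          omega
      intro u h1 h2
      have := this (t - u).toNat (by omega)
      rw [show t - ((t - u).toNat : ℤ) = u by omega] at this
      exact this
    have htE := hret t (by omega) le_rfl
    have e1 : Emb (Matches ε X Y) E s s t (κ t) :=
      (k5 s t le_rfl (by omega) hte.le (.inl rfl) (.inr htE)).mono_left k1
    have e2 : Emb (Matches ε X Y) E t (κ t) e (e - g) := by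
      have := k5 t e (by omega) hte.le le_rfl (.inr htE) (.inr he)
      rwa [k2] at this
    -- A shift `b ≤ 0` gives a shorter counterexample on (t, e], and `b ≥ g` gives one on (s, t].
    have hb1 : 0 < b := by
      by_contra hc
      exact IH' t e (by omega) le_rfl (by omega) (e2.mono_left (by omega))
    have hb2 : b < g := by
      by_contra hc
      exact IH' s t le_rfl hte.le (by omega) (e1.mono_right (by omega))
    have hmatch : ∀ u, t - g < u → u ≤ t → Matches ε X Y (u - 1 - b) (u - b) (u - 1) u := by
      intro u h1 h2
      have := k5 (u - 1) u (by omega) (by omega) (by omega) (.inr (hret _ (by omega) (by omega)))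
        (.inr (hret _ (by omega) h2))
      rw [hκ u h1.le h2, hκ (u - 1) (by omega) (by omega)] at this
      obtain ⟨k', k, h3, h4, h5, h6⟩ := this.block (by omega) (by intros; omega)
      obtain rfl : k' = u - 1 - b := by omega
      obtain rfl : k = u - b := by omega
      exact h6
    set Δ := Y (κ t) - Y (t - g) with hΔ
    have hκt : κ t = t - b := by omega
    have hΔ0 : 0 ≤ Δ := by
      rw [hΔ, hκt]
      linarith [hY (by omega : t - g < t - b)]
    -- On the window both shifts `b` and `g` match, so gaps of `Y` also repeat at distance `g - b`.
    -- Hops of this length carry each gap of (t - 2g, t - g] into (t - g, t - b], whose total mass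
    -- `Δ` is small.
    have hup : ∀ v, t - g - g < v → v ≤ t - g →
        Y v - Y (v - 1) ≤ (1 + 3 * ε) * (Y (v + (g - b)) - Y (v + (g - b) - 1)) := by
      intro v h1 h2
      have a := (abs_le.1 (hmatch (v + g) (by omega) (by omega))).1
      have b' := (abs_le.1 (hshift (v + g) (by omega) (by omega))).2
      rw [show v + g - 1 - b = v + (g - b) - 1 by ring, show v + g - b = v + (g - b) by ring] at a
      rw [show v + g - 1 - g = v - 1 by ring, show v + g - g = v by ring] at b'
      have hx := hX (sub_one_lt (v + g))
      have hx' : 0 ≤ X (v + g) - X (v + g - 1) := by linarith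
      have c' : (1 - ε) * (X (v + g) - X (v + g - 1)) ≤ Y (v + (g - b)) - Y (v + (g - b) - 1) := by
        linarith
      have : (1 + ε) * (X (v + g) - X (v + g - 1)) ≤
          (1 + 3 * ε) * ((1 - ε) * (X (v + g) - X (v + g - 1))) := by
        have : 0 ≤ (ε - 3 * ε * ε) * (X (v + g) - X (v + g - 1)) :=
          mul_nonneg (by nlinarith) hx'
        nlinarith
      have h3 : (1 + 3 * ε) * ((1 - ε) * (X (v + g) - X (v + g - 1))) ≤
          (1 + 3 * ε) * (Y (v + (g - b)) - Y (v + (g - b) - 1)) := by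
        gcongr
      linarith
    have hwin : ∀ v, t - g - g < v → v ≤ t - g → Y v - Y (v - 1) ≤ (1 + 3 * ε) ^ g.toNat * Δ := by
      intro v h1 h2
      -- Hops go downwards in `gap_le_of_hops`, so the line is read backwards here.
      have := gap_le_of_hops (y := fun v => Y (-v) - Y (-v - 1)) (ρ := 1 + 3 * ε) (Δ := Δ)
        (g := g - b) (p := -(t - g) - 1) (q := -(t - g - g) - 1) (by omega) (by linarith) hΔ0 ?_ ?_
        g.toNat (-v) (by omega) (by omega) (by omega)
      · simpa using this
      · intro u h3 h4
        have := hup (-u) (by omega) (by omega)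
        rw [show -u + (g - b) = -(u - (g - b)) by ring] at this
        exact this
      · intro u h3 h4
        rw [hΔ, hκt]
        have a := hY.monotone (by omega : -u ≤ t - b)
        have b := hY.monotone (by omega : t - g ≤ -u - 1)
        linarith
    have hgtoNat : ((g.toNat : ℕ) : ℝ) = g := by
      have : ((g.toNat : ℕ) : ℤ) = g := by omega
      exact_mod_cast this
    have hlen : e - t ≤ (2 * c + 1) * (g + 1) := by
      have : j * (g + 1) ≤ (2 * c + 1) * (g + 1) := mul_le_mul_of_nonneg_right (by omega) (by omega)
      omega
    have hlenR : ((e - t : ℤ) : ℝ) ≤ (2 * c + 1) * (g + 1) := by exact_mod_cast hlen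
    refine hfinal t Δ (by omega) hte ?_ hΔ0 (hstar t _ (by omega) hte.le e2) ?_
    · refine hlenR.trans ?_
      nlinarith
    · intro u h1 h2
      have := gap_le_of_hops (y := fun v => Y v - Y (v - 1)) (ρ := 1 + 3 * ε)
        (Δ := (1 + 3 * ε) ^ g.toNat * Δ) (g := g) (p := t - g) (q := e) hg (by linarith)
        (mul_nonneg (pow_nonneg (by linarith) _) hΔ0)
        (fun u h3 h4 => hhop u (by omega) h4) hwin (e - t + g).toNat u (by omega) h2
        (by omega)
      refine this.trans ?_
      rw [← mul_assoc, ← pow_add]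
      gcongr
      apply hpow
      have h3 : (((e - t + g).toNat : ℕ) : ℤ) = e - t + g := by omega
      have h4 : (((e - t + g).toNat : ℕ) : ℝ) = ((e - t : ℤ) : ℝ) + g := by exact_mod_cast h3
      push_cast
      rw [h4, hgtoNat]
      nlinarith
  · -- the short case
    have hlen : e - s ≤ (2 * c + 2) * (g + 1) := by omega
    have hlenR : ((e - s : ℤ) : ℝ) ≤ (2 * c + 2) * (g + 1) := by exact_mod_cast hlen
    have hlenR' : ((e - s : ℤ) : ℝ) ≤ 2 * ((c : ℝ) + 1) ^ 2 := by nlinarith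
    -- Here the period (s - g, s] just before the start is itself of small mass, by `hstar` at `t =
    -- κ = s`.
    refine hfinal s (Y s - Y (s - g)) le_rfl hse hlenR' ?_ (hstar s s le_rfl hse.le h) ?_
    · linarith [hY (by omega : s - g < s)]
    · intro u h1 h2
      have := gap_le_of_hops (y := fun v => Y v - Y (v - 1)) (ρ := 1 + 3 * ε)
        (Δ := Y s - Y (s - g)) (g := g) (p := s) (q := e) hg (by linarith)
        (by linarith [hY (by omega : s - g < s)])
        hhop (fun v h3 h4 => ?_) (e - s).toNat u (by omega) h2 (by omega)
      · refine this.trans ?_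
        gcongr
        · linarith [hY (by omega : s - g < s)]
        · apply hpow
          have h3 : (((e - s).toNat : ℕ) : ℤ) = e - s := by omega
          have h4 : (((e - s).toNat : ℕ) : ℝ) = ((e - s : ℤ) : ℝ) := by exact_mod_cast h3
          rw [h4]
          nlinarith
      · have a := hY.monotone h4
        have b := hY.monotone (by omega : s - g ≤ v - 1)
        linarith

/-! ### Minimal deletion sets that make an embedding arrive too early -/

/-- Some retained position `s ∈ [l, r)` from which the embedding along the diagonal reaches `r`
within `k`. -/
def Hits (R : ℤ → ℤ → ℤ → ℤ → Prop) (l r k : ℤ) (E : Finset ℤ) : Prop :=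
  ∃ s, l ≤ s ∧ s < r ∧ s ∉ E ∧ Emb R E s s r k

/-- An inclusion-minimal set with `Hits`. -/
structure IsMinHit (R : ℤ → ℤ → ℤ → ℤ → Prop) (l r k : ℤ) (E : Finset ℤ) : Prop where
  subset : E ⊆ Finset.Ioo l r
  hits : Hits R l r k E
  minimal : ∀ E', E' ⊂ E → ¬ Hits R l r k E'

/-- The latest start for which the undeleted line from `j` still arrives in time is `j - g`. -/
def AtLevel (R : ℤ → ℤ → ℤ → ℤ → Prop) (r k g j : ℤ) : Prop :=
  Emb R ∅ j (j - g) r k ∧ ¬ Emb R ∅ j (j - g + 1) r k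

variable {R : ℤ → ℤ → ℤ → ℤ → Prop} {l r k g : ℤ} {E : Finset ℤ}

theorem Hits.exists_isMinHit (h : Hits R l r k E) :
    ∃ E', E' ⊆ E ∧ IsMinHit R l r k E' := by
  have key : ∀ F : Finset ℤ, F ⊆ Finset.Ioo l r → Hits R l r k F →
      ∃ E', E' ⊆ F ∧ IsMinHit R l r k E' := by
    intro F
    induction F using Finset.strongInduction with
    | H F ih =>
      intro h1 h2
      by_cases hm : ∀ E', E' ⊂ F → ¬ Hits R l r k E'
      · exact ⟨F, subset_rfl, h1, h2, hm⟩
      · push Not at hm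
        obtain ⟨E', h3, h4⟩ := hm
        obtain ⟨E'', h5, h6⟩ := ih E' h3 (h3.subset.trans h1) h4
        exact ⟨E'', h5.trans h3.subset, h6⟩
  obtain ⟨s, h1, h2, h3, h4⟩ := h
  have hr : r ∉ E := by
    rcases h4.end_notMem with h | h
    · omega
    · exact h
  obtain ⟨E', h5, h6⟩ := key (E ∩ Finset.Ioo l r) Finset.inter_subset_right
    ⟨s, h1, h2, fun h => h3 (Finset.mem_inter.1 h).1, h4.congr fun u h5 h6 => by
      rw [Finset.mem_inter, Finset.mem_Ioo]
      refine ⟨fun h => ⟨h, by omega, lt_of_le_of_ne h6 ?_⟩, fun h => h.1⟩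
      rintro rfl
      exact hr h⟩
  exact ⟨E', h5.trans Finset.inter_subset_left, h6⟩

/-- The first block of the undeleted line from `u - 1` cannot end beyond `u - g`, since `u - g` is
the latest start at `u`. So it is exactly one place long. -/
theorem AtLevel.rel {u : ℤ} (h1 : AtLevel R r k g (u - 1)) (h2 : AtLevel R r k g u) (hu : u ≤ r) :
    R (u - 1 - g) (u - g) (u - 1) u := by
  obtain ⟨κ, e1, e2⟩ := h1.1.split (by omega : u - 1 ≤ u) hu (by simp)
  have hκ : κ ≤ u - g := by
    by_contra hc
    exact h2.2 (e2.mono_left (by omega))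
  obtain ⟨k', k, h3, h4, h5, h6⟩ := e1.block (by omega) (by intros; omega)
  obtain rfl : k' = u - 1 - g := by omega
  obtain rfl : k = u - g := by omega
  exact h6

/-- Without deletions an embedding can only fall back towards larger targets, so the level is
monotone along the line and its level sets are intervals. -/
theorem AtLevel.between {a b j : ℤ} (ha : AtLevel R r k g a) (hb : AtLevel R r k g b) (h1 : a ≤ j)
    (h2 : j ≤ b) (hb' : b ≤ r) : AtLevel R r k g j := by
  constructor
  · obtain ⟨κ, e1, e2⟩ := ha.1.split h1 (h2.trans hb') (by simp)
    have := e1.count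
    simp at this
    exact e2.mono_left (by omega)
  · intro h
    obtain ⟨κ, e1, e2⟩ := h.split h2 hb' (by simp)
    have := e1.count
    simp at this
    exact hb.2 (e2.mono_left (by omega))

/-- The endpoints are chosen before `e`: they depend on the problem and on `g` alone. The later
union bound rests on this, since one `ρ` serves all minimal sets of level `g`. -/
theorem exists_level_interval (R : ℤ → ℤ → ℤ → ℤ → Prop) (l r k g : ℤ) :
    ∃ ρ σ : ℤ, ∀ e, l ≤ e → e ≤ r → AtLevel R r k g e → l ≤ ρ ∧ ρ ≤ e ∧ e ≤ σ ∧ σ ≤ r ∧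
      (∀ j, ρ ≤ j → j ≤ σ → AtLevel R r k g j) ∧
      ∀ j, l ≤ j → j ≤ e → AtLevel R r k g j → ρ ≤ j := by
  classical
  set J := (Finset.Icc l r).filter (AtLevel R r k g) with hJ
  by_cases hne : J.Nonempty
  · refine ⟨J.min' hne, J.max' hne, ?_⟩
    intro e h1 h2 h3
    have he : e ∈ J := by simp [hJ, h1, h2, h3]
    have a := J.min'_mem hne
    have b := J.max'_mem hne
    replace a := Finset.mem_filter.1 a
    replace b := Finset.mem_filter.1 b
    rw [Finset.mem_Icc] at a b
    refine ⟨a.1.1, J.min'_le _ he, J.le_max' _ he, b.1.2, ?_, ?_⟩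
    · intro j h4 h5
      exact a.2.between b.2 h4 h5 b.1.2
    · intro j h4 h5 h6
      exact J.min'_le _ (by simp [hJ, h4, h6]; omega)
  · refine ⟨0, 0, ?_⟩
    intro e h1 h2 h3
    exact absurd ⟨e, by simp [hJ, h1, h2, h3]⟩ hne

/-- The last witness `s`, the first return `e` to the undeleted line and the level `g` there. -/
structure IsExcursion (R : ℤ → ℤ → ℤ → ℤ → Prop) (l r k : ℤ) (E : Finset ℤ) (s e g : ℤ) : Prop where
  le_start : l ≤ s
  start_lt : s < e
  end_le : e ≤ r
  start_notMem : s ∉ E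
  end_notMem : e ∉ E
  subset : E ⊆ Finset.Ioo s e
  le_level : r - k ≤ g
  emb : Emb R E s s e (e - g)
  atLevel : AtLevel R r k g e
  lt_of_emb : ∀ t, t ∉ E → s < t → t < r → ∀ κ, Emb R E t κ r k → κ < t
  not_emb : ∀ t, t ∉ E → s < t → t < e → ∀ κ, Emb R E s s t κ → ¬ Emb R ∅ t κ r k

/-- Extremal choices: the last start on the diagonal that succeeds, then the first retained place
from which no further deletion is needed, then the latest target from which the undeleted line still
arrives. -/
theorem IsMinHit.exists_isExcursion (h : IsMinHit R l r k E) :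
    ∃ s e g, IsExcursion R l r k E s e g := by
  classical
  obtain ⟨s0, a1, a2, a3, a4⟩ := h.hits
  set W := (Finset.Ico l r).filter fun s => s ∉ E ∧ Emb R E s s r k with hW
  have hWne : W.Nonempty := ⟨s0, by simp [*]⟩
  obtain ⟨s, hs, hsmax⟩ : ∃ s ∈ W, ∀ s' ∈ W, s' ≤ s := ⟨_, W.max'_mem hWne, fun s' h => W.le_max' _ h⟩
  rw [hW, Finset.mem_filter, Finset.mem_Ico] at hs
  obtain ⟨⟨hs1, hs2⟩, hs3, hs4⟩ := hs
  have hr : r ∉ E := fun hr => by simpa using h.subset hr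
  set V := (Finset.Ioc s r).filter fun t => t ∉ E ∧ ∃ κ, Emb R E s s t κ ∧ Emb R ∅ t κ r k with hV
  have hVne : V.Nonempty := ⟨r, by
    simp only [hV, Finset.mem_filter, Finset.mem_Ioc]
    exact ⟨⟨hs2, le_rfl⟩, hr, k, hs4, .refl le_rfl⟩⟩
  obtain ⟨e, he, hemin⟩ : ∃ e ∈ V, ∀ e' ∈ V, e ≤ e' := ⟨_, V.min'_mem hVne, fun s' h => V.min'_le _ h⟩
  rw [hV, Finset.mem_filter, Finset.mem_Ioc] at he
  obtain ⟨⟨he1, he2⟩, he3, κ, he4, he5⟩ := he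
  obtain ⟨β, hβ1, hβ2⟩ := Int.exists_greatest_of_bdd (P := fun β => Emb R ∅ e β r k)
    ⟨k - (r - e), fun z hz => by have := hz.count; simp at this; omega⟩ ⟨κ, he5⟩
  have hcount := hβ1.count
  simp at hcount
  have hsub : E ⊆ Finset.Ioo s e := by
    -- Up to `e` the embedding sees only deletions inside (s, e), and beyond `e` the undeleted line
    -- serves. By minimality there are no others.
    have h1 : ¬ (E ∩ Finset.Ioo s e ⊂ E) := by
      intro hss
      refine h.minimal _ hss ⟨s, hs1, hs2, fun h => hs3 (Finset.mem_inter.1 h).1, ?_⟩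
      refine (he4.congr ?_).trans (he5.congr ?_)
      · intro u h1 h2
        simp only [Finset.mem_inter, Finset.mem_Ioo]
        refine ⟨fun h => ⟨h, h1, lt_of_le_of_ne h2 ?_⟩, fun h => h.1⟩
        rintro rfl
        exact he3 h
      · intro u h1 h2
        simp; omega
    have h2 : E ∩ Finset.Ioo s e = E := by
      by_contra hne
      exact h1 (lt_of_le_of_ne Finset.inter_subset_left hne)
    exact Finset.inter_eq_left.1 h2
  refine ⟨s, e, e - β, hs1, he1, he2, hs3, he3, hsub, by omega, ?_, ⟨?_, ?_⟩, ?_, ?_⟩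
  · rw [sub_sub_cancel]; exact he4.mono_right (hβ2 _ he5)
  · rw [sub_sub_cancel]; exact hβ1
  · rw [sub_sub_cancel]
    intro hc
    have := hβ2 _ hc
    omega
  · intro t h1 h2 h3 κ h4
    by_contra hc
    have := hsmax t (by
      simp only [hW, Finset.mem_filter, Finset.mem_Ico]
      exact ⟨⟨by omega, h3⟩, h1, h4.mono_left (by omega)⟩)
    omega
  · intro t h1 h2 h3 κ h4 h5
    have := hemin t (by
      simp only [hV, Finset.mem_filter, Finset.mem_Ioc]
      exact ⟨⟨h2, by omega⟩, h1, κ, h4, h5⟩)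
    omega

namespace IsExcursion

variable {s e t κ : ℤ}

theorem tail (hx : IsExcursion R l r k E s e g) : Emb R E e (e - g) r k :=
  hx.atLevel.1.congr fun u h1 h2 => by
    have : u ∉ E := fun h => by have := Finset.mem_Ioo.1 (hx.subset h); omega
    simp [this]

/-- Each of the `g` places gained between `s` and `e` costs a deletion. -/
theorem level_le_card (hx : IsExcursion R l r k E s e g) : g ≤ E.card := by
  have := hx.emb.count
  rw [Finset.inter_eq_left.2 hx.subset] at this
  omega

/-- The part of a minimal set to the right of `t`, read backwards. -/
theorem right (hm : IsMinHit R l r k E) (hx : IsExcursion R l r k E s e g) {σ : ℤ}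
    (heσ : e ≤ σ) (hlev : ∀ j, t ≤ j → j ≤ σ → AtLevel R r k g j) (ht : t ∉ E) (hst : s < t)
    (hte : t < e) (h1 : Emb R E s s t κ) (h2 : Emb R E t κ e (e - g)) :
    κ < t ∧ t - g < κ ∧ IsMinHit (reflectRel R g) (-σ) (-t) (-t - (g - (t - κ)))
      ((E ∩ Finset.Ioo t e).image fun u => -u) := by
  have hel := hx.end_le
  refine ⟨hx.lt_of_emb t ht hst (by omega) κ (h2.trans hx.tail), ?_, ?_, ?_, ?_⟩
  -- If `κ ≤ t - g`, the undeleted line could already be taken at `t`, before the first return `e`.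
  · by_contra hc
    exact hx.not_emb t ht hst hte κ h1 ((hlev t le_rfl (by omega)).1.mono_left (by omega))
  · intro u hu
    obtain ⟨v, hv, rfl⟩ := Finset.mem_image.1 hu
    simp only [Finset.mem_inter, Finset.mem_Ioo] at hv ⊢
    omega
  · have he : e ∉ E ∩ Finset.Ioo t e := by simp
    have ht' : t ∉ E ∩ Finset.Ioo t e := by simp
    refine ⟨-e, by omega, by omega, ?_, ?_⟩
    · simp
    · have := (h2.congr (E' := E ∩ Finset.Ioo t e) ?_).reflect ht' g
      · convert this using 1 <;> ring
      · intro u h3 h4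
        rw [Finset.mem_inter, Finset.mem_Ioo]
        refine ⟨fun h => ⟨h, h3, lt_of_le_of_ne h4 ?_⟩, fun h => h.1⟩
        rintro rfl
        exact hx.end_notMem h
  · rintro E'' hE'' ⟨s', h3, h4, h5, h6⟩
    have h7 := h6.of_reflect h5
    rw [neg_neg, show -(-t - (g - (t - κ))) - g = κ by ring] at h7
    set F := E''.image fun u => -u with hF
    have hFss : F ⊂ E ∩ Finset.Ioo t e := by
      have := (Finset.image_ssubset_image (f := fun u : ℤ => -u) neg_injective).2 hE''
      rw [Finset.image_image] at this
      simpa [Function.comp_def] using this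
    have hFs := hFss.subset
    obtain ⟨w, hw1, hw2⟩ := Finset.exists_of_ssubset hFss
    have hFmem : ∀ u ∈ F, u ∈ E ∧ t < u ∧ u < e := by
      intro u hu
      have := hFs hu
      simpa only [Finset.mem_inter, Finset.mem_Ioo] using this
    have hs'F : -s' ∉ F := by simpa [hF] using h5
    -- A smaller solution of the reversed problem leads from `t` to the diagonal of level `g` at
    -- `-s'`. From there the undeleted line takes over, so the deletions after `-s'` can be dropped
    -- and the minimality of `E` is violated.
    set E' := E.filter (· ≤ t) ∪ F.filter (· < -s') with hE'
    have hmemE' : ∀ u, u ∈ E' ↔ (u ∈ E ∧ u ≤ t) ∨ (u ∈ F ∧ u < -s') := by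
      intro u; simp [hE']
    refine hm.minimal E' ?_ ⟨s, hx.le_start, by have := hx.start_lt; omega, ?_, ?_⟩
    · refine Finset.ssubset_iff_subset_ne.2 ⟨?_, ?_⟩
      · intro u hu
        rcases (hmemE' u).1 hu with h | h
        · exact h.1
        · exact (hFmem u h.1).1
      · intro heq
        have hw : w ∈ E' := by rw [heq]; exact (Finset.mem_inter.1 hw1).1
        rw [Finset.mem_inter, Finset.mem_Ioo] at hw1
        rcases (hmemE' w).1 hw with h | h
        · omega
        · exact hw2 h.1
    · rw [hmemE']
      rintro (h | h)
      · exact hx.start_notMem h.1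
      · have := hFmem _ h.1; omega
    · refine (h1.congr ?_).trans ((h7.congr ?_).trans ((hlev (-s') (by omega) (by omega)).1.congr ?_))
      · intro u h8 h9
        rw [hmemE']
        refine ⟨fun h => .inl ⟨h, h9⟩, ?_⟩
        rintro (h | h)
        · exact h.1
        · exact (hFmem u h.1).1
      · intro u h8 h9
        rw [hmemE']
        constructor
        · intro h
          refine .inr ⟨h, lt_of_le_of_ne h9 ?_⟩
          rintro rfl
          exact hs'F h
        · rintro (h | h)
          · omega
          · exact h.1
      · intro u h8 h9
        rw [hmemE']
        simp only [Finset.notMem_empty, false_iff]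
        omega

/-- The part of a minimal set to the left of `t`. -/
theorem left (hm : IsMinHit R l r k E) (hx : IsExcursion R l r k E s e g) (ht : t ∉ E)
    (hst : s < t) (hte : t < e) (h1 : Emb R E s s t κ) (h2 : Emb R E t κ e (e - g)) :
    κ < t ∧ IsMinHit R l t κ (E ∩ Finset.Ioo s t) := by
  have hel := hx.end_le
  have hls := hx.le_start
  refine ⟨hx.lt_of_emb t ht hst (by omega) κ (h2.trans hx.tail), ?_, ?_, ?_⟩
  · intro u hu
    simp only [Finset.mem_inter, Finset.mem_Ioo] at hu ⊢
    omega
  · refine ⟨s, hls, hst, by simp, h1.congr ?_⟩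
    intro u h3 h4
    rw [Finset.mem_inter, Finset.mem_Ioo]
    refine ⟨fun h => ⟨h, h3, lt_of_le_of_ne h4 ?_⟩, fun h => h.1⟩
    rintro rfl
    exact ht h
  · rintro F hF ⟨s', h3, h4, h5, h6⟩
    obtain ⟨w, hw1, hw2⟩ := Finset.exists_of_ssubset hF
    have hFmem : ∀ u ∈ F, u ∈ E ∧ s < u ∧ u < t := by
      intro u hu
      simpa only [Finset.mem_inter, Finset.mem_Ioo] using hF.subset hu
    set E' := F ∪ E.filter (t < ·) with hE'
    have hmemE' : ∀ u, u ∈ E' ↔ u ∈ F ∨ (u ∈ E ∧ t < u) := by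
      intro u; simp [hE']
    refine hm.minimal E' ?_ ⟨s', h3, by omega, ?_, ?_⟩
    · refine Finset.ssubset_iff_subset_ne.2 ⟨?_, ?_⟩
      · intro u hu
        rcases (hmemE' u).1 hu with h | h
        · exact (hFmem u h).1
        · exact h.1
      · intro heq
        have hw : w ∈ E' := by rw [heq]; exact (Finset.mem_inter.1 hw1).1
        rw [Finset.mem_inter, Finset.mem_Ioo] at hw1
        rcases (hmemE' w).1 hw with h | h
        · exact hw2 h
        · omega
    · rw [hmemE']
      rintro (h | h)
      · exact h5 h
      · omega
    · refine (h6.congr ?_).trans ((h2.trans hx.tail).congr ?_)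
      · intro u h8 h9
        rw [hmemE']
        refine ⟨fun h => .inl h, ?_⟩
        rintro (h | h)
        · exact h
        · omega
      · intro u h8 h9
        rw [hmemE']
        refine ⟨fun h => .inr ⟨h, h8⟩, ?_⟩
        rintro (h | h)
        · have := hFmem u h; omega
        · exact h.1

/-- The two retained positions around the place `ρ` where the level `g` begins. -/
theorem exists_around (hx : IsExcursion R l r k E s e g) {ρ : ℤ} (h1 : s < ρ) (h2 : ρ ≤ e) :
    ∃ i' i, s ≤ i' ∧ i' < ρ ∧ ρ ≤ i ∧ i ≤ e ∧ i' ∉ E ∧ i ∉ E ∧ ∀ u, i' < u → u < i → u ∈ E := by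
  obtain ⟨i, ⟨a1, a2⟩, a3⟩ := Int.exists_least_of_bdd (P := fun i => ρ ≤ i ∧ i ∉ E)
    ⟨ρ, fun z hz => hz.1⟩ ⟨e, h2, hx.end_notMem⟩
  obtain ⟨i', ⟨b1, b2⟩, b3⟩ := Int.exists_greatest_of_bdd (P := fun i => i < ρ ∧ i ∉ E)
    ⟨ρ, fun z hz => hz.1.le⟩ ⟨s, h1, hx.start_notMem⟩
  refine ⟨i', i, b3 s ⟨h1, hx.start_notMem⟩, b1, a1, a3 e ⟨h2, hx.end_notMem⟩, b2, a2, ?_⟩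
  intro u h3 h4
  by_contra hu
  rcases lt_or_ge u ρ with h | h
  · have := b3 u ⟨h, hu⟩; omega
  · have := a3 u ⟨h, hu⟩; omega

/-- Splitting a minimal set at the place `ρ` where the level `g` begins. -/
theorem decompose (hm : IsMinHit R l r k E) (hx : IsExcursion R l r k E s e g) {ρ σ i' i : ℤ}
    (hk : k < r) (heσ : e ≤ σ) (hlev : ∀ j, ρ ≤ j → j ≤ σ → AtLevel R r k g j)
    (h1 : s ≤ i') (h2 : i' < ρ) (h3 : ρ ≤ i) (h4 : i ≤ e) (h5 : i' ∉ E) (h6 : i ∉ E)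
    (h7 : ∀ u, i' < u → u < i → u ∈ E) :
    ∃ b₁ b₂ : ℤ, 1 ≤ b₁ ∧ b₁ ≤ b₂ + (i - i' - 1) ∧
      ((i = e ∧ b₁ = g ∧ i' + 1 < i) ∨ (i < e ∧ b₁ < g ∧
        IsMinHit (reflectRel R g) (-σ) (-i) (-i - (g - b₁))
          ((E ∩ Finset.Ioo i e).image fun u => -u))) ∧
      ((i' = s ∧ b₂ = 0) ∨ (s < i' ∧ 1 ≤ b₂ ∧ IsMinHit R l i' (i' - b₂) (E ∩ Finset.Ioo s i'))) := by
  have hg := hx.le_level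
  obtain ⟨κ', c1, c2⟩ := hx.emb.split h1 (by omega) h5
  obtain ⟨κ, c3, c4⟩ := c2.split (by omega) h4 h6
  -- The block across `ρ` occupies at least one place of the target. This is the inequality between
  -- `b₁` and `b₂`: the gain grows by at most the number of deletions in the block.
  obtain ⟨k', k'', d1, d2, d3, d4⟩ := c3.block (by omega) h7
  have hE : E.Nonempty := by
    rw [Finset.nonempty_iff_ne_empty]
    rintro rfl
    have := hx.level_le_card
    simp at this
    omega
  have hκ := c4.le_right
  obtain ⟨b₂, hb2, hb2'⟩ : ∃ b₂ : ℤ, i' - b₂ ≤ κ' ∧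
      ((i' = s ∧ b₂ = 0) ∨ (s < i' ∧ 1 ≤ b₂ ∧ IsMinHit R l i' (i' - b₂) (E ∩ Finset.Ioo s i'))) := by
    rcases h1.eq_or_lt with h | h
    · exact ⟨0, by have := c1.le_right; omega, .inl ⟨h.symm, rfl⟩⟩
    · obtain ⟨e1, e2⟩ := left hm hx h5 h (by omega) c1 c2
      exact ⟨i' - κ', by omega, .inr ⟨h, by omega, by rwa [sub_sub_cancel]⟩⟩
  rcases h4.eq_or_lt with hie | h
  · refine ⟨g, b₂, by omega, by omega, .inl ⟨hie, rfl, ?_⟩, hb2'⟩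
    -- A block of length one ending at `e` would need no deletion, and `i'` would be an earlier
    -- return.
    by_contra hc
    obtain rfl : i' = i - 1 := by omega
    rcases h1.eq_or_lt with h | h
    · obtain ⟨w, hw⟩ := hE
      have := Finset.mem_Ioo.1 (hx.subset hw)
      omega
    · refine hx.not_emb _ h5 h (by omega) κ' c1 ?_
      subst hie
      exact (Emb.single (by omega) (by intros; omega) (by simp) d1 d2 (d3.trans hκ) d4).trans
        hx.atLevel.1
  · obtain ⟨e1, e2, e3⟩ := right hm hx heσ (fun j a b => hlev j (by omega) b) h6 (by omega) h
      (c1.trans c3) c4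
    exact ⟨i - κ, b₂, by omega, by omega, .inr ⟨h, by omega, e3⟩, hb2'⟩

end IsExcursion

/-! ### The generating bound for minimal sets -/

/-- The bound for the weighted number of minimal sets that gain `n` places. -/
noncomputable def hitBound (n : ℕ) : ℝ :=
  if n = 0 then 1 else 1 / 100 * (1 / 8) ^ n * catalan (n - 1)

theorem hitBound_zero : hitBound 0 = 1 := by simp [hitBound]

theorem hitBound_succ (n : ℕ) : hitBound (n + 1) = 1 / 100 * (1 / 8) ^ (n + 1) * catalan n := by
  simp [hitBound]

theorem catalan_pos (n : ℕ) : 0 < catalan n := by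
  have := succ_mul_catalan_eq_centralBinom n
  have h := Nat.centralBinom_pos n
  by_contra hc
  simp only [not_lt, Nat.le_zero] at hc
  rw [hc] at this
  omega

theorem succ_succ_mul_catalan_succ (n : ℕ) :
    (n + 2) * catalan (n + 1) = 2 * (2 * n + 1) * catalan n := by
  have h1 := succ_mul_catalan_eq_centralBinom n
  have h2 := succ_mul_catalan_eq_centralBinom (n + 1)
  have h3 := Nat.succ_mul_centralBinom_succ n
  rw [← h1, ← h2] at h3
  have : (n + 1) * ((n + 2) * catalan (n + 1)) = (n + 1) * (2 * (2 * n + 1) * catalan n) := by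
    linarith
  exact Nat.eq_of_mul_eq_mul_left (by omega) this

theorem catalan_succ_le (n : ℕ) : catalan (n + 1) ≤ 4 * catalan n := by
  have := succ_succ_mul_catalan_succ n
  have h : (n + 2) * catalan (n + 1) ≤ (n + 2) * (4 * catalan n) := by
    rw [this]; nlinarith
  exact Nat.le_of_mul_le_mul_left h (by omega)

theorem catalan_le_succ (n : ℕ) : catalan n ≤ catalan (n + 1) := by
  rcases n with _ | n
  · simp
  have := succ_succ_mul_catalan_succ (n + 1)
  have h : (n + 1 + 2) * catalan (n + 1) ≤ (n + 1 + 2) * catalan (n + 1 + 1) := by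
    rw [this]; nlinarith
  exact Nat.le_of_mul_le_mul_left h (by omega)

theorem hitBound_pos (n : ℕ) : 0 < hitBound n := by
  rcases n with _ | n
  · simp [hitBound_zero]
  · rw [hitBound_succ]
    have := catalan_pos n
    positivity

theorem hitBound_succ_le (n : ℕ) : hitBound (n + 1) ≤ hitBound n / 2 := by
  rcases n with _ | n
  · rw [hitBound_succ, hitBound_zero]; norm_num
  · rw [hitBound_succ, hitBound_succ, pow_succ]
    have h : (catalan (n + 1) : ℝ) ≤ 4 * catalan n := by exact_mod_cast catalan_succ_le n
    have hp : (0 : ℝ) ≤ 1 / 100 * (1 / 8) ^ (n + 1) := by positivity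
    nlinarith

theorem hitBound_le_succ (n : ℕ) : hitBound n ≤ 800 * hitBound (n + 1) := by
  rcases n with _ | n
  · rw [hitBound_succ, hitBound_zero]; norm_num
  · rw [hitBound_succ, hitBound_succ, pow_succ _ (n + 1)]
    have h : (catalan n : ℝ) ≤ catalan (n + 1) := by exact_mod_cast catalan_le_succ n
    have hp : (0 : ℝ) ≤ 1 / 100 * (1 / 8) ^ (n + 1) := by positivity
    have := mul_le_mul_of_nonneg_left h hp
    have hc : (0 : ℝ) ≤ 1 / 100 * (1 / 8) ^ (n + 1) * catalan n := by positivity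
    nlinarith

/-- The terms decrease at least by the factor 1/2. -/
theorem sum_hitBound_le (a c : ℕ) : ∑ b ∈ Finset.Icc a c, hitBound b ≤ 2 * hitBound a := by
  rcases le_or_gt a c with h | h
  · have : ∑ b ∈ Finset.Icc a c, hitBound b ≤ 2 * hitBound a - hitBound c := by
      induction c, h using Nat.le_induction with
      | base => simp; linarith
      | succ c hc ih =>
        rw [Finset.sum_Icc_succ_top (by omega)]
        have := hitBound_succ_le c
        linarith
    linarith [hitBound_pos c]
  · rw [Finset.Icc_eq_empty (by omega)]
    simpa using (hitBound_pos a).le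

/-- This is the Catalan recursion. The product of the two prefactors 1/100 leaves one of them over,
which makes the convolution small compared with `hitBound g`. -/
theorem sum_hitBound_mul_le (g : ℕ) :
    ∑ b ∈ Finset.Ico 1 g, hitBound (g - b) * hitBound b ≤ 1 / 100 * hitBound g := by
  rcases g with _ | _ | n
  · simp [hitBound_zero]
  · simp [(hitBound_pos 1).le]
  · rw [hitBound_succ (n + 1), catalan_succ', Finset.Nat.sum_antidiagonal_eq_sum_range_succ_mk,
      Finset.sum_Ico_eq_sum_range]
    push_cast
    rw [Finset.mul_sum, Finset.mul_sum]
    refine Finset.sum_le_sum fun j hj => ?_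
    have hj' : j ≤ n := by simpa [Nat.lt_succ_iff] using hj
    rw [show n + 1 + 1 - (1 + j) = (n - j) + 1 by omega, show 1 + j = j + 1 by omega, hitBound_succ,
      hitBound_succ]
    have : (1 / 8 : ℝ) ^ (n + 1 + 1) = (1 / 8) ^ (n - j + 1) * (1 / 8) ^ (j + 1) := by
      rw [← pow_add]; congr 1; omega
    rw [this]
    apply le_of_eq
    ring

/-- Raising `r` by one shifts the index and adds the term `b = 1`. By `hitBound_le_succ` both cost a
constant factor, for which 1200 suffices. -/
theorem sum_hitBound_shift_le (r g : ℕ) :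
    ∑ b ∈ Finset.Icc 1 g, hitBound (g - b) * hitBound (b - r) ≤ 2 * 1200 ^ r * hitBound g := by
  induction r generalizing g with
  | zero =>
    rcases g with _ | g
    · simp [hitBound_zero]
    · have h : Finset.Icc 1 (g + 1) = insert (g + 1) (Finset.Ico 1 (g + 1)) := by
        ext; simp
      rw [h, Finset.sum_insert (by simp)]
      have := sum_hitBound_mul_le (g + 1)
      simp only [Nat.sub_zero, Nat.sub_self, hitBound_zero]
      have h2 := hitBound_pos (g + 1)
      linarith
  | succ r ih =>
    rcases g with _ | g
    · simp [hitBound_zero]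
    · have h : Finset.Icc 1 (g + 1) = insert 1 ((Finset.Icc 1 g).image (· + 1)) := by
        ext x
        simp only [Finset.mem_Icc, Finset.mem_insert, Finset.mem_image]
        constructor
        · rintro ⟨h1, h2⟩
          rcases h1.eq_or_lt with h1 | h1
          · exact .inl h1.symm
          · exact .inr ⟨x - 1, by omega, by omega⟩
        · rintro (rfl | ⟨y, hy, rfl⟩) <;> omega
      rw [h, Finset.sum_insert (by simp), Finset.sum_image (by simp)]
      have h1 := ih g
      have h2 := hitBound_le_succ g
      simp only [Nat.add_sub_add_right, Nat.add_sub_cancel, (by omega : 1 - (r + 1) = 0),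
        hitBound_zero, mul_one]
      have h3 : (1 : ℝ) ≤ 1200 ^ r := one_le_pow₀ (by norm_num)
      have h4 : 2 * 1200 ^ r * hitBound g ≤ 2 * 1200 ^ r * (800 * hitBound (g + 1)) := by gcongr
      rw [pow_succ]
      have h5 : 1 * hitBound (g + 1) ≤ 1200 ^ r * hitBound (g + 1) := by
        gcongr; exact (hitBound_pos _).le
      nlinarith

/-- The weight of one deletion. -/
noncomputable def hitWeight : ℝ := 1 / 8000000

theorem hitWeight_pos : 0 < hitWeight := by norm_num [hitWeight]

/-- The numerical form of the recursion: `r` deletions in the block across `ρ`, an offset of its end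
with `r + 1` possibilities, and the gains `b` and `b'` on its two sides. For `r = 0` smallness comes
from the factor 1/100 of the Catalan convolution, and for `r ≥ 1` from the small weight of a
deletion, which beats the factor 1200 per shift. -/
theorem sum_level_le (g c : ℕ) :
    ∑ r ∈ Finset.range (c + 1), ∑ _o ∈ Finset.range (r + 1), ∑ b ∈ Finset.Icc 1 g,
      ∑ b' ∈ Finset.Icc (b - r) c,
        (if r = 0 ∧ b = g then 0 else hitWeight ^ r * (hitBound (g - b) * hitBound b')) ≤
      hitBound g / 4 := by
  have hq := hitWeight_pos
  have key : ∀ r ∈ Finset.range (c + 1), ∑ _o ∈ Finset.range (r + 1), ∑ b ∈ Finset.Icc 1 g,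
      ∑ b' ∈ Finset.Icc (b - r) c,
        (if r = 0 ∧ b = g then 0 else hitWeight ^ r * (hitBound (g - b) * hitBound b')) ≤
      (1 / 2) ^ r * (hitBound g / 8) := by
    intro r _
    rw [Finset.sum_const, Finset.card_range, nsmul_eq_mul]
    have h1 : ∀ b ∈ Finset.Icc 1 g, ∑ b' ∈ Finset.Icc (b - r) c,
        (if r = 0 ∧ b = g then 0 else hitWeight ^ r * (hitBound (g - b) * hitBound b')) ≤
        if r = 0 ∧ b = g then 0 else 2 * hitWeight ^ r * (hitBound (g - b) * hitBound (b - r)) := by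
      intro b _
      split_ifs
      · simp
      · rw [← Finset.mul_sum, ← Finset.mul_sum]
        have := sum_hitBound_le (b - r) c
        have h2 : 0 ≤ hitWeight ^ r * hitBound (g - b) :=
          mul_nonneg (pow_nonneg hq.le _) (hitBound_pos _).le
        nlinarith
    refine (mul_le_mul_of_nonneg_left (Finset.sum_le_sum h1) (by positivity)).trans ?_
    rcases Nat.eq_zero_or_pos r with rfl | hr
    · rcases g with _ | g
      · simp [hitBound_zero]
      · have h : Finset.Icc 1 (g + 1) = insert (g + 1) (Finset.Ico 1 (g + 1)) := by
          ext; simp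
        rw [h, Finset.sum_insert (by simp)]
        have h3 := sum_hitBound_mul_le (g + 1)
        have h4 : ∑ b ∈ Finset.Ico 1 (g + 1), (if 0 = 0 ∧ b = g + 1 then 0 else
            2 * hitWeight ^ 0 * (hitBound (g + 1 - b) * hitBound (b - 0))) =
            2 * ∑ b ∈ Finset.Ico 1 (g + 1), hitBound (g + 1 - b) * hitBound b := by
          rw [Finset.mul_sum]
          refine Finset.sum_congr rfl fun b hb => ?_
          rw [if_neg (by simp at hb; omega)]
          simp
        rw [h4]
        simp only [and_self, if_true]
        have := hitBound_pos (g + 1)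
        simp
        linarith
    · have h2 := sum_hitBound_shift_le r g
      have h3 : ∀ b ∈ Finset.Icc 1 g, (if r = 0 ∧ b = g then 0 else
          2 * hitWeight ^ r * (hitBound (g - b) * hitBound (b - r))) =
          2 * hitWeight ^ r * (hitBound (g - b) * hitBound (b - r)) := by
        intro b _
        rw [if_neg (by omega)]
      rw [Finset.sum_congr rfl h3, ← Finset.mul_sum]
      have h4 : ((r + 1 : ℕ) : ℝ) ≤ 2 ^ r := by exact_mod_cast Nat.lt_two_pow_self
      have h5 := hitBound_pos g
      calc ((r + 1 : ℕ) : ℝ) * (2 * hitWeight ^ r *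
            ∑ b ∈ Finset.Icc 1 g, hitBound (g - b) * hitBound (b - r))
          ≤ 2 ^ r * (2 * hitWeight ^ r * (2 * 1200 ^ r * hitBound g)) := by
            gcongr
            exact mul_nonneg (by positivity) (Finset.sum_nonneg fun b _ =>
              mul_nonneg (hitBound_pos _).le (hitBound_pos _).le)
        _ = (1 / 2) ^ r * (hitBound g / 8) * (32 * (4800 * hitWeight) ^ r) := by
            rw [show (4800 : ℝ) * hitWeight = 2 * 2 * 1200 * hitWeight by ring]
            simp only [mul_pow, one_div, inv_pow]
            have : (2 : ℝ) ^ r ≠ 0 := by positivity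
            field_simp
            ring
        _ ≤ (1 / 2) ^ r * (hitBound g / 8) * (32 * (4800 * hitWeight) ^ 1) := by
            have : (4800 * hitWeight) ^ r ≤ (4800 * hitWeight) ^ 1 :=
              pow_le_pow_of_le_one (by positivity) (by norm_num [hitWeight]) hr
            exact mul_le_mul_of_nonneg_left (mul_le_mul_of_nonneg_left this (by norm_num))
              (by positivity)
        _ ≤ (1 / 2) ^ r * (hitBound g / 8) * 1 := by
            gcongr
            norm_num [hitWeight]
        _ = _ := mul_one _
  refine (Finset.sum_le_sum key).trans ?_
  rw [← Finset.sum_mul]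
  have := sum_geometric_two_le (c + 1)
  have h5 := hitBound_pos g
  nlinarith

/-! ### The weighted count of minimal sets of bounded size -/

open Classical in
/-- The minimal sets with at most `c` elements. -/
noncomputable def minHits (R : ℤ → ℤ → ℤ → ℤ → Prop) (l r k : ℤ) (c : ℕ) : Finset (Finset ℤ) :=
  (Finset.Ioo l r).powerset.filter fun E => IsMinHit R l r k E ∧ E.card ≤ c

theorem mem_minHits {R : ℤ → ℤ → ℤ → ℤ → Prop} {l r k : ℤ} {c : ℕ} {E : Finset ℤ} :
    E ∈ minHits R l r k c ↔ IsMinHit R l r k E ∧ E.card ≤ c := by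
  classical
  simp only [minHits, Finset.mem_filter, Finset.mem_powerset]
  exact ⟨fun h => h.2, fun h => ⟨h.1.subset, h⟩⟩

/-- A union bound for sums. -/
theorem sum_le_sum_fibers {α β : Type*} {S : Finset α} {P : Finset β} (rel : α → β → Prop)
    [∀ p, DecidablePred (rel · p)] {f : α → ℝ} (hf : ∀ a ∈ S, 0 ≤ f a)
    (h : ∀ a ∈ S, ∃ p ∈ P, rel a p) : ∑ a ∈ S, f a ≤ ∑ p ∈ P, ∑ a ∈ S with rel a p, f a := by
  simp_rw [Finset.sum_filter]
  rw [Finset.sum_comm]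
  refine Finset.sum_le_sum fun a ha => ?_
  obtain ⟨p, hp, hr⟩ := h a ha
  have := Finset.single_le_sum (f := fun p => if rel a p then f a else 0) (fun q _ => by
    split_ifs
    · exact hf a ha
    · exact le_rfl) hp
  simpa [hr] using this

/-- Comparison of sums along a map that has a left inverse. -/
theorem sum_le_sum_of_exists {α β : Type*} {S : Finset α} {T : Finset β} {f : α → ℝ} {h : β → ℝ}
    (φ : β → α) (hh : ∀ b ∈ T, 0 ≤ h b) (hex : ∀ a ∈ S, ∃ b ∈ T, φ b = a ∧ f a ≤ h b) :
    ∑ a ∈ S, f a ≤ ∑ b ∈ T, h b := by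
  classical
  rcases isEmpty_or_nonempty β with hβ | hβ
  · rw [Finset.sum_eq_zero fun a ha => (hβ.elim (hex a ha).choose)]
    exact Finset.sum_nonneg hh
  choose! ψ h1 h2 h3 using hex
  calc ∑ a ∈ S, f a ≤ ∑ a ∈ S, h (ψ a) := Finset.sum_le_sum h3
    _ = ∑ b ∈ S.image ψ, h b := by
        rw [Finset.sum_image]
        intro a ha b hb hab
        rw [← h2 a ha, ← h2 b hb, hab]
    _ ≤ ∑ b ∈ T, h b := by
        refine Finset.sum_le_sum_of_subset_of_nonneg ?_ fun b hb _ => hh b hb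
        intro b hb
        obtain ⟨a, ha, rfl⟩ := Finset.mem_image.1 hb
        exact h1 a ha

/-- Along an interval of level `g`, the line at shift `g` matches place by place; after reversal and
shift this becomes the diagonal, as the induction requires of the right-hand part. -/
theorem base_reflect {ε : ℝ} {X Y : ℤ → ℝ} {g r k t σ : ℤ} (hσ : σ ≤ r)
    (h : ∀ j, t ≤ j → j ≤ σ → AtLevel (Matches ε X Y) r k g j) (u : ℤ) (h1 : -σ < u) (h2 : u ≤ -t) :
    Matches ε (fun j => -X (-j)) (fun j => -Y (-j - g)) (u - 1) u (u - 1) u := by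
  rw [← congrFun (congrFun (congrFun (congrFun (reflectRel_matches ε X Y g) _) _) _) _, reflectRel]
  have := (h (-(u - 1) - 1) (by omega) (by omega)).rel (h _ (by omega) (by omega)) (by omega)
  convert this using 1 <;> ring

theorem card_eq_of_split {E : Finset ℤ} {s e i' i : ℤ} (hE : E ⊆ Finset.Ioo s e) (h5 : i' ∉ E)
    (h6 : i ∉ E) (hi : i' < i) (h1 : s ≤ i') (h2 : i ≤ e) (h7 : ∀ u, i' < u → u < i → u ∈ E) :
    E = (E ∩ Finset.Ioo s i') ∪ Finset.Ioo i' i ∪ (E ∩ Finset.Ioo i e) ∧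
      E.card = (E ∩ Finset.Ioo s i').card + (i - i' - 1).toNat + (E ∩ Finset.Ioo i e).card := by
  have : E = (E ∩ Finset.Ioo s i') ∪ Finset.Ioo i' i ∪ (E ∩ Finset.Ioo i e) := by
    ext u
    simp only [Finset.mem_union, Finset.mem_inter, Finset.mem_Ioo]
    constructor
    · intro hu
      have h8 := Finset.mem_Ioo.1 (hE hu)
      have h9 : u ≠ i' := by rintro rfl; exact h5 hu
      have h10 : u ≠ i := by rintro rfl; exact h6 hu
      rcases lt_or_gt_of_ne h9 with h | h
      · exact .inl (.inl ⟨hu, h8.1, h⟩)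
      · rcases lt_or_gt_of_ne h10 with h' | h'
        · exact .inl (.inr ⟨h, h'⟩)
        · exact .inr ⟨hu, h', h8.2⟩
    · rintro ((h | h) | h)
      · exact h.1
      · exact h7 u h.1 h.2
      · exact h.1
  refine ⟨this, ?_⟩
  conv_lhs => rw [this]
  rw [Finset.card_union_of_disjoint, Finset.card_union_of_disjoint, Int.card_Ioo]
  · rw [Finset.disjoint_left]
    simp only [Finset.mem_inter, Finset.mem_Ioo]
    intro a; omega
  · rw [Finset.disjoint_left]
    simp only [Finset.mem_inter, Finset.mem_Ioo, Finset.mem_union]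
    intro a; omega

/-- The weighted number of small minimal sets. -/
theorem sum_minHits_le {ε : ℝ} {c : ℕ} (hε0 : 0 ≤ ε) (hε : ε * (1000 * ((c : ℝ) + 1) ^ 2) ≤ 1)
    (n : ℕ) : ∀ {X Y : ℤ → ℝ}, StrictMono X → StrictMono Y → ∀ {l r : ℤ}, r - l ≤ n →
      (∀ u, l < u → u ≤ r → Matches ε X Y (u - 1) u (u - 1) u) → ∀ d : ℕ, 1 ≤ d →
      ∑ E ∈ minHits (Matches ε X Y) l r (r - d) c, hitWeight ^ E.card ≤ hitBound d := by
  classical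
  induction n using Nat.strong_induction_on with
  | _ n IH =>
  intro X Y hX hY l r hn hbase d hd
  have hq := hitWeight_pos
  set R := Matches ε X Y with hR
  set S := minHits R l r (r - d) c with hS
  have hex : ∀ E ∈ S, ∃ g ∈ Finset.Icc d c, ∃ s e : ℤ, IsExcursion R l r (r - d) E s e g := by
    intro E hE
    obtain ⟨hm, hc⟩ := mem_minHits.1 hE
    obtain ⟨s, e, g, hx⟩ := hm.exists_isExcursion
    have h1 := hx.le_level
    have h2 := hx.level_le_card
    refine ⟨g.toNat, Finset.mem_Icc.2 ⟨by omega, by omega⟩, s, e, ?_⟩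
    rwa [show ((g.toNat : ℕ) : ℤ) = g by omega]
  have hlevel : ∀ g ∈ Finset.Icc d c,
      ∑ E ∈ S with ∃ s e : ℤ, IsExcursion R l r (r - d) E s e g, hitWeight ^ E.card ≤
        hitBound g / 4 := by
    intro g hg
    rw [Finset.mem_Icc] at hg
    set Sg := S.filter fun E => ∃ s e : ℤ, IsExcursion R l r (r - d) E s e g with hSg
    obtain ⟨ρ, σ, hρσ⟩ := exists_level_interval R l r (r - d) g
    rcases Sg.eq_empty_or_nonempty with h0 | ⟨E0, hE0⟩
    · rw [h0]
      simpa using div_nonneg (hitBound_pos g).le (by norm_num)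
    have hmem : ∀ E ∈ Sg, ∃ s e : ℤ, IsMinHit R l r (r - d) E ∧ E.card ≤ c ∧
        IsExcursion R l r (r - d) E s e g := by
      intro E hE
      rw [hSg, Finset.mem_filter] at hE
      obtain ⟨h1, s, e, h2⟩ := hE
      obtain ⟨h3, h4⟩ := mem_minHits.1 h1
      exact ⟨s, e, h3, h4, h2⟩
    have hfacts : ∀ E s e, E.card ≤ c → IsExcursion R l r (r - d) E s e g → s < ρ ∧ l ≤ ρ ∧
        ρ ≤ e ∧ e ≤ σ ∧ σ ≤ r ∧ ∀ j, ρ ≤ j → j ≤ σ → AtLevel R r (r - d) g j := by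
      intro E s e hc hx
      have hle := hx.le_start
      have hlt := hx.start_lt
      have hel := hx.end_le
      obtain ⟨a1, a2, a3, a4, a5, a6⟩ := hρσ e (by omega) hel hx.atLevel
      refine ⟨?_, a1, a2, a3, a4, a5⟩
      -- If the start were at `ρ` or later, both shifts 0 and `g` would persist on (s, e].
      by_contra hcon
      refine not_emb_shift hX hY hε0 hε (g := g) (by omega) (s := s) (e := e) (E := E)
        (fun u h1 h2 => hbase u (by omega) (by omega)) ?_
        ((Finset.card_le_card Finset.inter_subset_left).trans hc) hx.emb
      intro u h1 h2
      exact (a5 _ (by omega) (by omega)).rel (a5 _ (by omega) (by omega)) (by omega)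
    obtain ⟨hlρ, hσr, hJ⟩ : l < ρ ∧ σ ≤ r ∧ ∀ j, ρ ≤ j → j ≤ σ → AtLevel R r (r - d) g j := by
      obtain ⟨s, e, hm, hc, hx⟩ := hmem E0 hE0
      obtain ⟨a0, a1, a2, a3, a4, a5⟩ := hfacts E0 s e hc hx
      have := hx.le_start
      exact ⟨by omega, a4, a5⟩
    have hρr : ρ ≤ r := by
      obtain ⟨s, e, hm, hc, hx⟩ := hmem E0 hE0
      have := (hfacts E0 s e hc hx).2.2.1
      have := hx.end_le
      omega
    -- the two families from which a minimal set of level `g` is put together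
    let T₁ : ℤ → ℕ → Finset (Finset ℤ) := fun i b =>
      if b = g then {∅} else
        (minHits (reflectRel R g) (-σ) (-i) (-i - ((g - b : ℕ) : ℤ)) c).image
          fun E => E.image fun u => -u
    let T₂ : ℤ → ℕ → Finset (Finset ℤ) := fun i b =>
      if b = 0 then {∅} else minHits R l i (i - b) c
    have hT₁ : ∀ i b, ρ ≤ i → 1 ≤ b → b ≤ g →
        ∑ E ∈ T₁ i b, hitWeight ^ E.card ≤ hitBound (g - b) := by
      intro i b h1 h2 h3
      simp only [T₁]
      split_ifs with h
      · simp [h, hitBound_zero]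
      · rw [Finset.sum_image (fun a _ b _ hab =>
          (Finset.image_injective neg_injective) hab)]
        simp_rw [Finset.card_image_of_injective _ neg_injective]
        rw [hR, reflectRel_matches]
        rcases le_or_gt i σ with hiσ | hiσ
        · exact IH (σ - i).toNat (by omega) (fun a b hab => neg_lt_neg (hX (neg_lt_neg hab)))
            (fun a b hab => neg_lt_neg (hY (by omega))) (by omega)
            (fun u h1 h2 => base_reflect hσr (fun j h3 h4 => hJ j (by omega) h4) u h1 h2)
            (g - b) (by omega)
        · refine IH 0 (by omega) (fun a b hab => neg_lt_neg (hX (neg_lt_neg hab)))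
            (fun a b hab => neg_lt_neg (hY (by omega))) (by omega) (by intros; omega)
            (g - b) (by omega)
    have hT₂ : ∀ i b, i < ρ → ∑ E ∈ T₂ i b, hitWeight ^ E.card ≤ hitBound b := by
      intro i b h1
      simp only [T₂]
      split_ifs with h
      · simp [h, hitBound_zero]
      · rcases le_or_gt l i with hli | hli
        · exact IH (i - l).toNat (by omega) hX hY (by omega)
            (fun u h1 h2 => hbase u h1 (by omega)) b (by omega)
        · exact IH 0 (by omega) hX hY (by omega) (by intros; omega) b (by omega)
    -- A code records the deletions in the block across `ρ`, the distance from `ρ` to its end, and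
    -- the gains on its two sides. Given `ρ`, it fixes both ends of the block, and the minimal set
    -- is then a pair from the two families.
    let P : Finset (Σ _ : ℕ, Σ _ : ℕ, Σ _ : ℕ, ℕ) :=
      (Finset.range (c + 1)).sigma fun r' => (Finset.range (r' + 1)).sigma fun _ =>
        (Finset.Icc 1 g).sigma fun b => Finset.Icc (b - r') c
    let rel : Finset ℤ → (Σ _ : ℕ, Σ _ : ℕ, Σ _ : ℕ, ℕ) → Prop := fun E p =>
      -- A block without deletions is impossible when nothing remains on its right; without this
      -- exclusion the recursion would bound `hitBound g` by itself.
      ¬ (p.1 = 0 ∧ p.2.2.1 = g) ∧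
      ∃ q ∈ T₁ (ρ + p.2.1) p.2.2.1 ×ˢ T₂ (ρ + p.2.1 - p.1 - 1) p.2.2.2,
        (q.2 ∪ Finset.Ioo (ρ + p.2.1 - p.1 - 1 : ℤ) (ρ + p.2.1)) ∪ q.1 = E ∧
          E.card = q.2.card + p.1 + q.1.card
    have hrel : ∀ E ∈ Sg, ∃ p ∈ P, rel E p := by
      intro E hE
      obtain ⟨s, e, hm, hc, hx⟩ := hmem E hE
      obtain ⟨a0, a1, a2, a3, a4, a5⟩ := hfacts E s e hc hx
      obtain ⟨i', i, h1, h2, h3, h4, h5, h6, h7⟩ := hx.exists_around a0 a2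
      obtain ⟨b₁, b₂, c1, c2, c3, c4⟩ := hx.decompose hm (by omega) a3 hJ h1 h2 h3 h4 h5 h6 h7
      obtain ⟨f1, f2⟩ := card_eq_of_split hx.subset h5 h6 (by omega) h1 h4 h7
      have hE1c : (E ∩ Finset.Ioo i e).card ≤ c :=
        (Finset.card_le_card Finset.inter_subset_left).trans hc
      have hE2c : (E ∩ Finset.Ioo s i').card ≤ c :=
        (Finset.card_le_card Finset.inter_subset_left).trans hc
      have hb1g : b₁ ≤ g := by
        rcases c3 with h | h <;> omega
      have hb2 : 0 ≤ b₂ ∧ b₂ ≤ c := by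
        rcases c4 with h | ⟨h, h', h''⟩
        · omega
        · obtain ⟨s', e', g', hx'⟩ := h''.exists_isExcursion
          have := hx'.level_le_card
          have := hx'.le_level
          omega
      refine ⟨⟨(i - i' - 1).toNat, (i - ρ).toNat, b₁.toNat, b₂.toNat⟩, ?_, ?_, ?_⟩
      · simp only [P, Finset.mem_sigma, Finset.mem_range, Finset.mem_Icc]
        omega
      · simp only
        rcases c3 with h | h <;> omega
      · have z1 : ρ + ((i - ρ).toNat : ℤ) = i := by omega
        have z2 : i - ((i - i' - 1).toNat : ℤ) - 1 = i' := by omega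
        simp only [z1, z2]
        refine ⟨(E ∩ Finset.Ioo i e, E ∩ Finset.Ioo s i'), ?_, f1.symm, f2⟩
        rw [Finset.mem_product]
        constructor
        · simp only [T₁]
          rcases c3 with ⟨g1, g2, g3⟩ | ⟨g1, g2, g3⟩
          · rw [if_pos (by omega)]
            simp [g1]
          · rw [if_neg (by omega)]
            refine Finset.mem_image.2
              ⟨(E ∩ Finset.Ioo i e).image fun u => -u, mem_minHits.2 ⟨?_, ?_⟩, ?_⟩
            · rwa [show (((g - b₁.toNat : ℕ)) : ℤ) = g - b₁ by omega]
            · exact (Finset.card_image_le).trans hE1c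
            · simp [Finset.image_image]
        · simp only [T₂]
          rcases c4 with ⟨g1, g2⟩ | ⟨g1, g2, g3⟩
          · rw [if_pos (by omega)]
            simp [g1]
          · rw [if_neg (by omega)]
            refine mem_minHits.2 ⟨?_, hE2c⟩
            rwa [show ((b₂.toNat : ℕ) : ℤ) = b₂ by omega]
    have hterm : ∀ p ∈ P, ∑ E ∈ Sg with rel E p, hitWeight ^ E.card ≤
        if p.1 = 0 ∧ p.2.2.1 = g then 0 else
          hitWeight ^ p.1 * (hitBound (g - p.2.2.1) * hitBound p.2.2.2) := by
      rintro ⟨r', o, b, b'⟩ hp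
      simp only [P, Finset.mem_sigma, Finset.mem_range, Finset.mem_Icc] at hp
      simp only
      split_ifs with hcase
      · rw [Finset.sum_eq_zero]
        intro E hE
        exact absurd hcase (Finset.mem_filter.1 hE).2.1
      · have h1 := hT₁ (ρ + o) b (by omega) hp.2.2.1.1 hp.2.2.1.2
        have h2 := hT₂ (ρ + o - r' - 1) b' (by omega)
        calc ∑ E ∈ Sg with rel E ⟨r', o, b, b'⟩, hitWeight ^ E.card
            ≤ ∑ q ∈ T₁ (ρ + o) b ×ˢ T₂ (ρ + o - r' - 1) b',
                hitWeight ^ r' * (hitWeight ^ q.1.card * hitWeight ^ q.2.card) := by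
              refine sum_le_sum_of_exists (fun q => (q.2 ∪ Finset.Ioo (ρ + o - r' - 1 : ℤ) (ρ + o)) ∪ q.1)
                (fun q _ => by positivity) ?_
              intro E hE
              obtain ⟨hE1, _, q, hq1, hq2, hq3⟩ := Finset.mem_filter.1 hE
              refine ⟨q, hq1, hq2, ?_⟩
              rw [hq3]
              apply le_of_eq
              simp only
              ring
          _ = hitWeight ^ r' * ((∑ E ∈ T₁ (ρ + o) b, hitWeight ^ E.card) *
                ∑ E ∈ T₂ (ρ + o - r' - 1) b', hitWeight ^ E.card) := by
              rw [← Finset.mul_sum, Finset.sum_product, Finset.sum_mul_sum]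
          _ ≤ _ := by
              gcongr
              exact (hitBound_pos _).le
    calc ∑ E ∈ Sg, hitWeight ^ E.card
        ≤ ∑ p ∈ P, ∑ E ∈ Sg with rel E p, hitWeight ^ E.card :=
          sum_le_sum_fibers rel (fun E _ => by positivity) hrel
      _ ≤ ∑ p ∈ P, if p.1 = 0 ∧ p.2.2.1 = g then 0 else
          hitWeight ^ p.1 * (hitBound (g - p.2.2.1) * hitBound p.2.2.2) := Finset.sum_le_sum hterm
      _ = _ := by
          simp only [P, Finset.sum_sigma]
      _ ≤ hitBound g / 4 := sum_level_le g c
  calc ∑ E ∈ S, hitWeight ^ E.card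
      ≤ ∑ g ∈ Finset.Icc d c, ∑ E ∈ S with ∃ s e : ℤ, IsExcursion R l r (r - d) E s e g,
          hitWeight ^ E.card :=
        sum_le_sum_fibers (fun E (g : ℕ) => ∃ s e : ℤ, IsExcursion R l r (r - d) E s e g)
          (fun E _ => by positivity) hex
    _ ≤ ∑ g ∈ Finset.Icc d c, hitBound g / 4 := Finset.sum_le_sum hlevel
    _ ≤ hitBound d := by
        rw [← Finset.sum_div]
        linarith [sum_hitBound_le d c, hitBound_pos d]

/-- A large minimal set without long runs contains a minimal set of medium size of a related
problem. -/
theorem IsMinHit.exists_medium {R : ℤ → ℤ → ℤ → ℤ → Prop} {l : ℤ} {c : ℕ} (hc : 1 ≤ c)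
    {σ : ℤ → ℕ → ℕ → ℤ} {ρ : ℤ → ℕ → ℕ → ℤ}
    (hσ : ∀ (r : ℤ) (d g : ℕ), ∀ e, l ≤ e → e ≤ r → AtLevel R r (r - d) g e →
      l ≤ ρ r d g ∧ ρ r d g ≤ e ∧ e ≤ σ r d g ∧ σ r d g ≤ r ∧
      (∀ j, ρ r d g ≤ j → j ≤ σ r d g → AtLevel R r (r - d) g j) ∧
      ∀ j, l ≤ j → j ≤ e → AtLevel R r (r - d) g j → ρ r d g ≤ j) (n : ℕ) :
    ∀ {r : ℤ} {E : Finset ℤ} {d : ℕ}, r - l ≤ n → 1 ≤ d → IsMinHit R l r (r - d) E → c ≤ E.card →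
      (∀ i' i, i' < i → (∀ u, i' < u → u < i → u ∈ E) → i - i' - 1 < c) →
      ∃ E', E' ⊆ E ∧ c ≤ E'.card ∧ E'.card ≤ 4 * c ∧ ∃ r' d', r' ∈ Finset.Ioc l r ∧
        d' ∈ Finset.Icc 1 n ∧ (IsMinHit R l r' (r' - (d' : ℕ)) E' ∨
          ∃ t g h, t ∈ Finset.Ioc l r ∧ g ∈ Finset.Icc 1 n ∧ h ∈ Finset.Icc 1 n ∧
            (t ≤ σ r' d' g ∧ σ r' d' g ≤ r' ∧
              ∀ j, t ≤ j → j ≤ σ r' d' g → AtLevel R r' (r' - d') (g : ℕ) j) ∧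
            IsMinHit (reflectRel R g) (-σ r' d' g) (-t) (-t - (h : ℕ)) (E'.image fun u => -u)) := by
  induction n using Nat.strong_induction_on with
  | _ n IH =>
  intro r E d hn hd hm hcard hrun
  obtain ⟨s, e, g', hx⟩ := hm.exists_isExcursion
  have hg1 := hx.le_level
  have hg2 := hx.level_le_card
  have hEn : E.card ≤ n := by
    have := Finset.card_le_card hm.subset
    rw [Int.card_Ioo] at this
    omega
  have hls := hx.le_start
  have hse := hx.start_lt
  have her := hx.end_le
  by_cases hsmall : E.card ≤ 4 * c
  · refine ⟨E, subset_rfl, hcard, hsmall, r, d, ?_, ?_, .inl hm⟩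
    · rw [Finset.mem_Ioc]; omega
    · rw [Finset.mem_Icc]; omega
  obtain ⟨g, rfl⟩ : ∃ g : ℕ, g' = g := ⟨g'.toNat, by omega⟩
  obtain ⟨a1, a2, a3, a4, a5, -⟩ := hσ r d g e (by omega) her hx.atLevel
  have hEse : E ∩ Finset.Ioo s e = E := Finset.inter_eq_left.2 hx.subset
  -- The last cut past `ρ` with at least `c` deletions on its right leaves at most `2 * c` of them:
  -- up to the next retained place there is a run shorter than `c`, and beyond it fewer than `c`
  -- remain. If there is no such cut, the block across `ρ` and the part on its right are both short,
  -- and the large remainder on the left is treated by induction.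
  by_cases hA : ∃ t, (s ≤ t ∧ ρ r d g ≤ t ∧ t < e ∧ t ∉ E ∧ c ≤ (E ∩ Finset.Ioo t e).card)
  · obtain ⟨t, ⟨b1, b2, b3, b4, b5⟩, b6⟩ := Int.exists_greatest_of_bdd ⟨e, fun z hz => hz.2.2.1.le⟩ hA
    obtain ⟨t', ⟨c1, c2⟩, c3⟩ := Int.exists_least_of_bdd (P := fun i => t < i ∧ i ∉ E)
      ⟨t, fun z hz => hz.1.le⟩ ⟨e, b3, hx.end_notMem⟩
    have hte' := c3 e ⟨b3, hx.end_notMem⟩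
    have hcard3 : (E ∩ Finset.Ioo t e).card ≤ 2 * c := by
      have h1 : E ∩ Finset.Ioo t e ⊆ Finset.Ioo t t' ∪ (E ∩ Finset.Ioo t' e) := by
        intro u hu
        simp only [Finset.mem_union, Finset.mem_inter, Finset.mem_Ioo] at hu ⊢
        have : u ≠ t' := by rintro rfl; exact c2 hu.1
        rcases lt_or_gt_of_ne this with h | h
        · exact .inl ⟨hu.2.1, h⟩
        · exact .inr ⟨hu.1, h, hu.2.2⟩
      have h2 := (Finset.card_le_card h1).trans (Finset.card_union_le _ _)
      rw [Int.card_Ioo] at h2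
      have h3 := hrun t t' c1 (by
        intro u hu1 hu2
        by_contra hu
        have := c3 u ⟨hu1, hu⟩
        omega)
      have h4 : (E ∩ Finset.Ioo t' e).card < c := by
        rcases hte'.eq_or_lt with h | h
        · rw [h]; simp; omega
        · by_contra hcon
          have := b6 t' ⟨by omega, by omega, h, c2, by omega⟩
          omega
      omega
    have hst : s < t := by
      rcases b1.eq_or_lt with h | h
      · rw [← h, hEse] at hcard3; omega
      · exact h
    obtain ⟨κ, e1, e2⟩ := hx.emb.split b1 b3.le b4
    obtain ⟨f1, f2, f3⟩ := hx.right hm a3 (fun j h1 h2 => a5 j (by omega) h2) b4 hst b3 e1 e2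
    refine ⟨E ∩ Finset.Ioo t e, Finset.inter_subset_left, b5, by omega, r, d, ?_, ?_,
      .inr ⟨t, g, (g - (t - κ)).toNat, ?_, ?_, ?_,
        ⟨by omega, a4, fun j h1 h2 => a5 j (by omega) h2⟩, ?_⟩⟩
    · rw [Finset.mem_Ioc]; omega
    · rw [Finset.mem_Icc]; omega
    · rw [Finset.mem_Ioc]; omega
    · rw [Finset.mem_Icc]; omega
    · rw [Finset.mem_Icc]; omega
    · rwa [show (((g - (t - κ)).toNat : ℕ) : ℤ) = g - (t - κ) by omega]
  · have hsρ : s < ρ r d g := by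
      by_contra hcon
      exact hA ⟨s, le_rfl, by omega, hse, hx.start_notMem, by rw [hEse]; exact hcard⟩
    obtain ⟨i', i, h1, h2, h3, h4, h5, h6, h7⟩ := hx.exists_around hsρ a2
    obtain ⟨f1, f2⟩ := card_eq_of_split hx.subset h5 h6 (by omega) h1 h4 h7
    have hr' := hrun i' i (by omega) h7
    have hE1 : (E ∩ Finset.Ioo i e).card < c := by
      rcases h4.eq_or_lt with h | h
      · rw [h]; simp; omega
      · by_contra hcon
        exact hA ⟨i, by omega, h3, h, h6, by omega⟩
    have hsi : s < i' := by
      rcases h1.eq_or_lt with h | h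
      · rw [← h] at f2
        simp at f2
        omega
      · exact h
    obtain ⟨κ, e1, e2⟩ := hx.emb.split h1 (by omega) h5
    obtain ⟨g1, g2⟩ := hx.left hm h5 hsi (by omega) e1 e2
    have := e1.le_right
    obtain ⟨E', q1, q2, q3, r', d', q4, q5, q6⟩ := IH (i' - l).toNat (by omega) (r := i')
      (E := E ∩ Finset.Ioo s i') (d := (i' - κ).toNat) (by omega) (by omega)
      (by rwa [show i' - (((i' - κ).toNat : ℕ) : ℤ) = κ by omega]) (by omega)
      (fun j' j hj hu => hrun j' j hj fun u hu1 hu2 => (Finset.mem_inter.1 (hu u hu1 hu2)).1)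
    rw [Finset.mem_Ioc] at q4
    rw [Finset.mem_Icc] at q5
    refine ⟨E', q1.trans Finset.inter_subset_left, q2, q3, r', d', ?_, ?_, ?_⟩
    · rw [Finset.mem_Ioc]; omega
    · rw [Finset.mem_Icc]; omega
    · rcases q6 with h | ⟨t, g, h, w1, w2, w3, w4⟩
      · exact .inl h
      · rw [Finset.mem_Ioc] at w1
        rw [Finset.mem_Icc] at w2 w3
        refine .inr ⟨t, g, h, ?_, ?_, ?_, w4⟩
        · rw [Finset.mem_Ioc]; omega
        · rw [Finset.mem_Icc]; omega
        · rw [Finset.mem_Icc]; omega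

/-! ### A cover of all early arrivals by sets of small total weight -/

theorem sum_biUnion_le_sum {α β : Type*} [DecidableEq α] (P : Finset β) (S : β → Finset α)
    {f : α → ℝ} (hf : ∀ a, 0 ≤ f a) : ∑ a ∈ P.biUnion S, f a ≤ ∑ p ∈ P, ∑ a ∈ S p, f a := by
  classical
  refine (sum_le_sum_fibers (P := P) (fun a p => a ∈ S p) (fun a _ => hf a) ?_).trans ?_
  · intro a ha
    simpa using ha
  · refine Finset.sum_le_sum fun p _ => Finset.sum_le_sum_of_subset_of_nonneg ?_ fun a _ _ => hf a
    intro a ha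
    exact (Finset.mem_filter.1 ha).2

theorem hitBound_le_one (d : ℕ) : hitBound d ≤ 1 := by
  induction d with
  | zero => rw [hitBound_zero]
  | succ d ih => linarith [hitBound_succ_le d, hitBound_pos d]

theorem sum_union_le_add {α : Type*} [DecidableEq α] (S T : Finset α) {f : α → ℝ}
    (hf : ∀ a, 0 ≤ f a) : ∑ a ∈ S ∪ T, f a ≤ ∑ a ∈ S, f a + ∑ a ∈ T, f a := by
  rw [← Finset.sum_union_inter]
  have : 0 ≤ ∑ a ∈ S ∩ T, f a := Finset.sum_nonneg fun a _ => hf a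
  linarith

/-- A family of small total weight such that each deletion set for which the embedding along the
diagonal arrives early contains a member of the family. -/
theorem exists_cover {ε δ : ℝ} {c N : ℕ} {X Y : ℤ → ℝ} (hX : StrictMono X) (hY : StrictMono Y)
    (hc : 100 * N ^ 5 ≤ 2 ^ c) (hε0 : 0 ≤ ε)
    (hε : ε * (1000 * (((4 * c : ℕ) : ℝ) + 1) ^ 2) ≤ 1) (hδ0 : 0 ≤ δ) (hδ : δ ≤ hitWeight / 2)
    (hbase : ∀ u : ℤ, 0 < u → u ≤ N → Matches ε X Y (u - 1) u (u - 1) u) {r : ℤ} (hr1 : 1 ≤ r)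
    (hrN : r ≤ N) :
    ∃ F : Finset (Finset ℤ), (∀ E ∈ F, E ⊆ Finset.Ioo 0 r) ∧ ∑ E ∈ F, δ ^ E.card ≤ 1 / 20 ∧
      ∀ S, Emb (Matches ε X Y) S 0 0 r (r - 1) → ∃ E ∈ F, E ⊆ S := by
  classical
  have hq := hitWeight_pos
  have hq1 : hitWeight ≤ 1 := by norm_num [hitWeight]
  set R := Matches ε X Y with hR
  have hN : 1 ≤ N := by omega
  have hc1 : 1 ≤ c := by
    by_contra h
    obtain rfl : c = 0 := by omega
    have : 1 ≤ N ^ 5 := Nat.one_le_pow _ _ (by omega)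
    omega
  have hσ0 := fun (r : ℤ) (d g : ℕ) => exists_level_interval R 0 r (r - d) g
  choose ρ σ hσ using hσ0
  -- Since `δ` is at most half the weight for which the count is bounded, sets with at least `c`
  -- elements gain the factor `2 ^ (-c)`.
  have hfar : ∀ {R' : ℤ → ℤ → ℤ → ℤ → Prop} {l r k : ℤ},
      ∑ E ∈ minHits R' l r k (4 * c), hitWeight ^ E.card ≤ 1 →
      ∑ E ∈ (minHits R' l r k (4 * c)).filter (fun E => c ≤ E.card), δ ^ E.card ≤ (1 / 2) ^ c := by
    intro R' l r k h
    have h1 : ∀ E ∈ (minHits R' l r k (4 * c)).filter (fun E => c ≤ E.card),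
        δ ^ E.card ≤ (1 / 2) ^ c * hitWeight ^ E.card := by
      intro E hE
      have hE' := (Finset.mem_filter.1 hE).2
      calc δ ^ E.card ≤ (hitWeight / 2) ^ E.card := by gcongr
        _ = (1 / 2) ^ E.card * hitWeight ^ E.card := by rw [← mul_pow]; congr 1; ring
        _ ≤ _ := mul_le_mul_of_nonneg_right
            (pow_le_pow_of_le_one (by norm_num) (by norm_num) hE') (by positivity)
    refine (Finset.sum_le_sum h1).trans ?_
    rw [← Finset.mul_sum]
    have h2 : ∑ E ∈ (minHits R' l r k (4 * c)).filter (fun E => c ≤ E.card), hitWeight ^ E.card ≤ 1 :=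
      (Finset.sum_le_sum_of_subset_of_nonneg (Finset.filter_subset _ _)
        fun E _ _ => by positivity).trans h
    exact mul_le_of_le_one_right (by positivity) h2
  -- the four parts of the family
  let F₀ := minHits R 0 r (r - (1 : ℕ)) (4 * c)
  let P₁ := Finset.Ioc (0 : ℤ) r ×ˢ Finset.Icc 1 N
  let F₁ := P₁.biUnion fun p => (minHits R 0 p.1 (p.1 - (p.2 : ℕ)) (4 * c)).filter
    fun E => c ≤ E.card
  let P₂ := Finset.Ioc (0 : ℤ) r ×ˢ Finset.Icc 1 N ×ˢ Finset.Ioc (0 : ℤ) r ×ˢ Finset.Icc 1 N ×ˢ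
    Finset.Icc 1 N
  let cond : ℤ × ℕ × ℤ × ℕ × ℕ → Prop := fun p =>
    p.2.2.1 ≤ σ p.1 p.2.1 p.2.2.2.1 ∧ σ p.1 p.2.1 p.2.2.2.1 ≤ p.1 ∧
      ∀ j, p.2.2.1 ≤ j → j ≤ σ p.1 p.2.1 p.2.2.2.1 → AtLevel R p.1 (p.1 - p.2.1) p.2.2.2.1 j
  let F₂ := (P₂.filter cond).biUnion fun p =>
    ((minHits (reflectRel R p.2.2.2.1) (-σ p.1 p.2.1 p.2.2.2.1) (-p.2.2.1)
      (-p.2.2.1 - (p.2.2.2.2 : ℕ)) (4 * c)).filter fun E => c ≤ E.card).image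
        fun E => E.image fun u => -u
  let F₃ := (Finset.Ico (0 : ℤ) r).image fun i : ℤ => Finset.Ioo i (i + c + 1)
  have hpos : ∀ E : Finset ℤ, 0 ≤ δ ^ E.card := fun E => by positivity
  have hc' : (100 * N ^ 5 : ℝ) ≤ 2 ^ c := by exact_mod_cast hc
  have hr : (r.toNat : ℝ) ≤ N := by exact_mod_cast (by omega : r.toNat ≤ N)
  have hNR : (1 : ℝ) ≤ N := by exact_mod_cast hN
  -- At most `N ^ 5` families occur, indexed by up to five parameters; this is what fixes the size
  -- of `c`.
  have hrow : ∀ k : ℕ, k ≤ 5 → (N : ℝ) ^ k * (1 / 2) ^ c ≤ 1 / 100 := by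
    intro k hk
    have : (N : ℝ) ^ k ≤ N ^ 5 := pow_le_pow_right₀ hNR hk
    rw [one_div, inv_pow, ← div_eq_mul_inv, div_le_iff₀ (by positivity)]
    linarith
  have w0 : ∑ E ∈ F₀, δ ^ E.card ≤ 1 / 800 := by
    calc ∑ E ∈ F₀, δ ^ E.card ≤ ∑ E ∈ F₀, hitWeight ^ E.card := by
          refine Finset.sum_le_sum fun E _ => ?_
          gcongr
          linarith
      _ ≤ hitBound 1 := sum_minHits_le hε0 hε r.toNat hX hY (by omega)
          (fun u h1 h2 => hbase u h1 (by omega)) 1 le_rfl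
      _ = 1 / 800 := by rw [hitBound_succ]; norm_num
  have w1 : ∑ E ∈ F₁, δ ^ E.card ≤ 1 / 100 := by
    refine (sum_biUnion_le_sum _ _ hpos).trans ?_
    refine (Finset.sum_le_card_nsmul _ _ ((1 / 2) ^ c) ?_).trans ?_
    · intro p hp
      simp only [P₁, Finset.mem_product, Finset.mem_Ioc, Finset.mem_Icc] at hp
      exact hfar ((sum_minHits_le hε0 hε p.1.toNat hX hY (by omega)
          (fun u h1 h2 => hbase u h1 (by omega)) p.2 hp.2.1).trans (hitBound_le_one _))
    · rw [nsmul_eq_mul]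
      refine le_trans ?_ (hrow 2 (by norm_num))
      gcongr
      simp only [P₁, Finset.card_product, Int.card_Ioc, Nat.card_Icc, sub_zero, Nat.add_sub_cancel]
      push_cast
      rw [pow_two]
      gcongr
  have w2 : ∑ E ∈ F₂, δ ^ E.card ≤ 1 / 100 := by
    refine (sum_biUnion_le_sum _ _ hpos).trans ?_
    refine (Finset.sum_le_card_nsmul _ _ ((1 / 2) ^ c) ?_).trans ?_
    · intro p hp
      simp only [P₂, cond, Finset.mem_product, Finset.mem_Ioc, Finset.mem_Icc, Finset.mem_filter] at hp
      rw [Finset.sum_image (fun a _ b _ hab => (Finset.image_injective neg_injective) hab)]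
      simp_rw [Finset.card_image_of_injective _ neg_injective]
      refine hfar (le_trans ?_ (hitBound_le_one p.2.2.2.2))
      rw [hR, reflectRel_matches]
      exact sum_minHits_le hε0 hε (σ p.1 p.2.1 p.2.2.2.1 - p.2.2.1).toNat
        (fun a b hab => neg_lt_neg (hX (neg_lt_neg hab)))
        (fun a b hab => neg_lt_neg (hY (by omega))) (by omega)
        (fun u h1 h2 => base_reflect hp.2.2.1 hp.2.2.2 u h1 h2) _ hp.1.2.2.2.2.1
    · rw [nsmul_eq_mul]
      refine le_trans ?_ (hrow 5 (by norm_num))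
      gcongr
      refine (Nat.cast_le.2 (Finset.card_filter_le _ _)).trans ?_
      simp only [P₂, Finset.card_product, Int.card_Ioc, Nat.card_Icc, sub_zero, Nat.add_sub_cancel]
      push_cast
      rw [show (N : ℝ) ^ 5 = N * (N * (N * (N * N))) by ring]
      gcongr
  have w3 : ∑ E ∈ F₃, δ ^ E.card ≤ 1 / 100 := by
    refine (Finset.sum_le_card_nsmul _ _ ((1 / 2) ^ c) ?_).trans ?_
    · intro E hE
      obtain ⟨i, -, rfl⟩ := Finset.mem_image.1 hE
      rw [Int.card_Ioo, show (i + c + 1 - i - 1).toNat = c by omega]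
      gcongr
      linarith
    · rw [nsmul_eq_mul]
      refine le_trans ?_ (hrow 1 (by norm_num))
      gcongr
      refine (Nat.cast_le.2 Finset.card_image_le).trans ?_
      simpa using hr
  refine ⟨(F₀ ∪ F₁ ∪ (F₂ ∪ F₃)).filter (· ⊆ Finset.Ioo 0 r), ?_, ?_, ?_⟩
  · intro E hE
    exact (Finset.mem_filter.1 hE).2
  · refine (Finset.sum_le_sum_of_subset_of_nonneg (Finset.filter_subset _ _)
      fun E _ _ => hpos E).trans ?_
    have u1 := sum_union_le_add (F₀ ∪ F₁) (F₂ ∪ F₃) hpos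
    have u2 := sum_union_le_add F₀ F₁ hpos
    have u3 := sum_union_le_add F₂ F₃ hpos
    linarith
  · intro S hS
    have h0 : Hits R 0 r (r - 1) (S ∩ Finset.Ioo 0 r) := by
      have hr : r ∉ S := by
        rcases hS.end_notMem with h | h
        · omega
        · exact h
      refine ⟨0, le_rfl, by omega, by simp, hS.congr fun u h1 h2 => ?_⟩
      rw [Finset.mem_inter, Finset.mem_Ioo]
      refine ⟨fun h => ⟨h, h1, lt_of_le_of_ne h2 ?_⟩, fun h => h.1⟩
      rintro rfl
      exact hr h
    obtain ⟨E, hES, hE⟩ := h0.exists_isMinHit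
    have hES' : E ⊆ S := hES.trans Finset.inter_subset_left
    -- A minimal set falls under the runs `F₃`, under the small sets `F₀`, or contains a medium set
    -- of a related problem, from `F₁` or, in reversed form, from `F₂`.
    by_cases hrun : ∃ i' i, i' < i ∧ (∀ u, i' < u → u < i → u ∈ E) ∧ (c : ℤ) ≤ i - i' - 1
    · obtain ⟨i', i, h1, h2, h3⟩ := hrun
      have hsub : Finset.Ioo i' (i' + c + 1) ⊆ E := by
        intro u hu
        rw [Finset.mem_Ioo] at hu
        exact h2 u hu.1 (by omega)
      have h4 := Finset.mem_Ioo.1 (hE.subset (hsub (Finset.mem_Ioo.2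
        (⟨by omega, by omega⟩ : i' < i' + 1 ∧ i' + 1 < i' + c + 1))))
      refine ⟨_, Finset.mem_filter.2 ⟨?_, hsub.trans hE.subset⟩, hsub.trans hES'⟩
      refine Finset.mem_union_right _ (Finset.mem_union_right _ (Finset.mem_image.2 ⟨i', ?_, rfl⟩))
      rw [Finset.mem_Ico]; omega
    by_cases hcard : E.card ≤ 4 * c
    · refine ⟨E, Finset.mem_filter.2 ⟨?_, hE.subset⟩, hES'⟩
      refine Finset.mem_union_left _ (Finset.mem_union_left _ (mem_minHits.2 ⟨?_, hcard⟩))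
      exact_mod_cast hE
    · obtain ⟨E', q1, q2, q3, r', d', q4, q5, q6⟩ := IsMinHit.exists_medium hc1 hσ r.toNat (r := r)
        (d := 1) (by omega) le_rfl (by exact_mod_cast hE) (by omega : c ≤ E.card)
        (fun i' i h1 h2 => by
          by_contra hcon
          exact hrun ⟨i', i, h1, h2, by omega⟩)
      refine ⟨E', Finset.mem_filter.2 ⟨?_, q1.trans hE.subset⟩, q1.trans hES'⟩
      rw [Finset.mem_Icc] at q5
      rcases q6 with h | ⟨t, g, h, w1, w2, w3, w4, w5⟩
      · refine Finset.mem_union_left _ (Finset.mem_union_right _ (Finset.mem_biUnion.2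
          ⟨(r', d'), ?_, Finset.mem_filter.2 ⟨mem_minHits.2 ⟨h, q3⟩, q2⟩⟩))
        simp only [P₁, Finset.mem_product, Finset.mem_Icc]
        exact ⟨q4, by omega, by omega⟩
      · rw [Finset.mem_Icc] at w2 w3
        refine Finset.mem_union_right _ (Finset.mem_union_left _ (Finset.mem_biUnion.2
          ⟨(r', d', t, g, h), ?_, ?_⟩))
        · simp only [P₂, cond, Finset.mem_filter, Finset.mem_product, Finset.mem_Icc]
          exact ⟨⟨q4, ⟨by omega, by omega⟩, w1, ⟨by omega, by omega⟩, by omega, by omega⟩, w4⟩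
        · refine Finset.mem_image.2 ⟨E'.image fun u => -u, Finset.mem_filter.2
            ⟨mem_minHits.2 ⟨w5, Finset.card_image_le.trans q3⟩, ?_⟩, ?_⟩
          · rwa [Finset.card_image_of_injective _ neg_injective]
          · simp [Finset.image_image]

/-! ### A small language of bounded loops and its compilation -/

/-- Expressions over loop variables and arrays. All sums range over one of three fixed bounds. -/
inductive Expr where
  | bnd (b : Fin 3)
  | var (j : ℕ)
  | const (c : ℕ)
  | add (e f : Expr)
  | sub (e f : Expr)
  | arr (a : ℕ) (e : Expr)
  | ite (e f g : Expr)
  | sum (j : ℕ) (b : Fin 3) (e : Expr)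

/-- The value of an expression. -/
def Expr.eval (β : Fin 3 → ℕ) : Expr → (ℕ → ℕ) → (ℕ → ℕ → ℕ) → ℕ
  | .bnd b, _, _ => β b
  | .var j, env, _ => env j
  | .const c, _, _ => c
  | .add e f, env, A => e.eval β env A + f.eval β env A
  | .sub e f, env, A => e.eval β env A - f.eval β env A
  | .arr a e, env, A => A a (e.eval β env A)
  | .ite e f g, env, A => if e.eval β env A ≠ 0 then f.eval β env A else g.eval β env A
  | .sum j b e, env, A => ∑ v ∈ Finset.range (β b), e.eval β (Function.update env j v) A

/-- A program that leaves the value of an expression in register `d`; variable `j` is kept in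
register `ρ j`. -/
def Expr.compile : Expr → (ℕ → ℕ) → ℕ → Prog
  | .bnd b, _, d => .seq (.const d 0) (.add d d b)
  | .var j, ρ, d => .seq (.const d 0) (.add d d (ρ j))
  | .const c, _, d => .const d c
  | .add e f, ρ, d => .seq (e.compile ρ d) (.seq (f.compile ρ (d + 1)) (.add d d (d + 1)))
  | .sub e f, ρ, d => .seq (e.compile ρ d) (.seq (f.compile ρ (d + 1)) (.sub d d (d + 1)))
  | .arr a e, ρ, d => .seq (e.compile ρ d) (.load d a d)
  | .ite e f g, ρ, d => .seq (e.compile ρ d) (.ite d (f.compile ρ d) (g.compile ρ d))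
  | .sum j b e, ρ, d =>
    .seq (.const d 0) (.seq (.const (d + 1) 0) (.seq (.const (d + 2) 0) (.seq (.add (d + 2) (d + 2) b)
      (.loop (d + 2) (.seq (e.compile (Function.update ρ j (d + 1)) (d + 3))
        (.seq (.add d d (d + 3)) (.seq (.const (d + 3) 1)
          (.seq (.add (d + 1) (d + 1) (d + 3)) (.sub (d + 2) (d + 2) (d + 3))))))))))

/-- A bound for the number of steps when all loop bounds are at most the argument. -/
noncomputable def Expr.time : Expr → Polynomial ℕ
  | .bnd _ => 2
  | .var _ => 2
  | .const _ => 1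
  | .add e f => e.time + f.time + 1
  | .sub e f => e.time + f.time + 1
  | .arr _ e => e.time + 1
  | .ite e f g => e.time + f.time + g.time + 1
  | .sum _ _ e => Polynomial.X * (e.time + 5) + 5

/-- Registers below `d` and all arrays agree. -/
structure State.SameBelow (s s' : State) (d : ℕ) : Prop where
  reg : ∀ r < d, s'.reg r = s.reg r
  arr : s'.arr = s.arr

theorem State.SameBelow.trans {s s' s'' : State} {d : ℕ} (h : s.SameBelow s' d)
    (h' : s'.SameBelow s'' d) : s.SameBelow s'' d :=
  ⟨fun r hr => (h'.reg r hr).trans (h.reg r hr), h'.arr.trans h.arr⟩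

theorem State.SameBelow.mono {s s' : State} {d d' : ℕ} (h : s.SameBelow s' d) (hd : d' ≤ d) :
    s.SameBelow s' d' :=
  ⟨fun r hr => h.reg r (by omega), h.arr⟩

@[simp] theorem State.setReg_reg (s : State) (r v r' : ℕ) :
    (s.setReg r v).reg r' = if r' = r then v else s.reg r' := by
  simp [State.setReg, Function.update_apply]

@[simp] theorem State.setReg_arr (s : State) (r v : ℕ) : (s.setReg r v).arr = s.arr := rfl

theorem State.sameBelow_setReg (s : State) {r v d : ℕ} (h : d ≤ r) :
    s.SameBelow (s.setReg r v) d :=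
  ⟨fun r' hr' => by simp; omega, rfl⟩

/-- The registers hold the bounds and the variables. -/
structure State.Holds (s : State) (β : Fin 3 → ℕ) (env ρ : ℕ → ℕ) (d : ℕ) : Prop where
  three_le : 3 ≤ d
  bnd : ∀ b : Fin 3, s.reg b = β b
  lt : ∀ j, ρ j < d
  var : ∀ j, s.reg (ρ j) = env j

theorem State.Holds.of_sameBelow {s s' : State} {β : Fin 3 → ℕ} {env ρ : ℕ → ℕ} {d : ℕ}
    (h : s.Holds β env ρ d) (h' : s.SameBelow s' d) : s'.Holds β env ρ d :=
  ⟨h.three_le, fun b => (h'.reg _ (by have := h.three_le; omega)).trans (h.bnd b), h.lt,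
    fun j => (h'.reg _ (h.lt j)).trans (h.var j)⟩

theorem State.Holds.mono {s : State} {β : Fin 3 → ℕ} {env ρ : ℕ → ℕ} {d d' : ℕ}
    (h : s.Holds β env ρ d) (hd : d ≤ d') : s.Holds β env ρ d' :=
  ⟨h.three_le.trans hd, h.bnd, fun j => (h.lt j).trans_le hd, h.var⟩

theorem State.Holds.update {s : State} {β : Fin 3 → ℕ} {env ρ : ℕ → ℕ} {d : ℕ}
    (h : s.Holds β env ρ d) {j r v d' : ℕ} (hr : s.reg r = v) (hrd : r < d') (hd : d ≤ d') :
    s.Holds β (Function.update env j v) (Function.update ρ j r) d' := by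
  refine ⟨h.three_le.trans hd, h.bnd, fun i => ?_, fun i => ?_⟩
  · by_cases hi : i = j
    · subst hi; simpa using hrd
    · simpa [hi] using (h.lt i).trans_le hd
  · by_cases hi : i = j
    · subst hi; simpa using hr
    · simpa [hi] using h.var i

/-- A counting loop whose body is correct runs through all values of the counter. -/
theorem exec_counting_loop {P : Prog} {Inv : ℕ → State → Prop} {rem τ : ℕ}
    (hstep : ∀ v s, Inv v s → s.reg rem ≠ 0 → ∃ t s', t ≤ τ ∧ Exec P s t s' ∧ Inv (v + 1) s' ∧
      s'.reg rem = s.reg rem - 1) :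
    ∀ (k v : ℕ) (s : State), Inv v s → s.reg rem = k →
      ∃ t s', t ≤ k * (τ + 1) + 1 ∧ Exec (.loop rem P) s t s' ∧ Inv (v + k) s' := by
  intro k
  induction k with
  | zero => intro v s h hk; exact ⟨1, s, by omega, .loopDone hk, h⟩
  | succ k ih =>
    intro v s h hk
    obtain ⟨t, s', h1, h2, h3, h4⟩ := hstep v s h (by omega)
    obtain ⟨t', s'', h5, h6, h7⟩ := ih (v + 1) s' h3 (by omega)
    refine ⟨t + t' + 1, s'', ?_, .loopStep (by omega) h2 h6, ?_⟩
    · rw [Nat.add_mul]; omega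
    · rwa [show v + (k + 1) = v + 1 + k by omega]

/-- A stack discipline: evaluation at `d` changes no register below `d`. A sum keeps its value in
`d`, the running variable in `d + 1` and the number of remaining rounds in `d + 2`, and evaluates
the summand from `d + 3` on. -/
theorem Expr.compile_correct {β : Fin 3 → ℕ} {B : ℕ} (hB : ∀ b, β b ≤ B) (e : Expr) :
    ∀ (env ρ : ℕ → ℕ) (d : ℕ) (s : State), s.Holds β env ρ d →
      ∃ t s', t ≤ e.time.eval B ∧ Exec (e.compile ρ d) s t s' ∧ s.SameBelow s' d ∧
        s'.reg d = e.eval β env s.arr := by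
  induction e with
  | bnd b =>
    intro env ρ d s h
    refine ⟨_, _, ?_, .seq (.const ..) (.add ..),
      (s.sameBelow_setReg le_rfl).trans (State.sameBelow_setReg _ le_rfl), ?_⟩
    · simp [Expr.time]
    · have := h.three_le
      have hb : (b : ℕ) ≠ d := by omega
      rw [State.setReg_reg, if_pos rfl, State.setReg_reg, if_pos rfl, State.setReg_reg, if_neg hb,
        h.bnd, Expr.eval, Nat.zero_add]
  | var j =>
    intro env ρ d s h
    refine ⟨_, _, ?_, .seq (.const ..) (.add ..),
      (s.sameBelow_setReg le_rfl).trans (State.sameBelow_setReg _ le_rfl), ?_⟩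
    · simp [Expr.time]
    · simp [Expr.eval, h.var, (h.lt j).ne]
  | const c =>
    intro env ρ d s h
    refine ⟨_, _, ?_, .const .., s.sameBelow_setReg le_rfl, ?_⟩
    · simp [Expr.time]
    · simp [Expr.eval]
  | add e f ihe ihf =>
    intro env ρ d s h
    obtain ⟨t1, s1, a1, a2, a3, a4⟩ := ihe env ρ d s h
    obtain ⟨t2, s2, b1, b2, b3, b4⟩ := ihf env ρ (d + 1) s1 ((h.of_sameBelow a3).mono (by omega))
    refine ⟨_, _, ?_, .seq a2 (.seq b2 (.add ..)),
      (a3.trans (b3.mono (by omega))).trans (State.sameBelow_setReg _ le_rfl), ?_⟩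
    · simp [Expr.time]; omega
    · simp [Expr.eval, b4, b3.reg d (by omega), a4, a3.arr]
  | sub e f ihe ihf =>
    intro env ρ d s h
    obtain ⟨t1, s1, a1, a2, a3, a4⟩ := ihe env ρ d s h
    obtain ⟨t2, s2, b1, b2, b3, b4⟩ := ihf env ρ (d + 1) s1 ((h.of_sameBelow a3).mono (by omega))
    refine ⟨_, _, ?_, .seq a2 (.seq b2 (.sub ..)),
      (a3.trans (b3.mono (by omega))).trans (State.sameBelow_setReg _ le_rfl), ?_⟩
    · simp [Expr.time]; omega
    · simp [Expr.eval, b4, b3.reg d (by omega), a4, a3.arr]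
  | arr a e ihe =>
    intro env ρ d s h
    obtain ⟨t1, s1, a1, a2, a3, a4⟩ := ihe env ρ d s h
    refine ⟨_, _, ?_, .seq a2 (.load ..), a3.trans (State.sameBelow_setReg _ le_rfl), ?_⟩
    · simp [Expr.time]; omega
    · simp [Expr.eval, a4, a3.arr]
  | ite e f g ihe ihf ihg =>
    intro env ρ d s h
    obtain ⟨t1, s1, a1, a2, a3, a4⟩ := ihe env ρ d s h
    have h1 := h.of_sameBelow a3
    by_cases h0 : s1.reg d = 0
    · obtain ⟨t2, s2, b1, b2, b3, b4⟩ := ihg env ρ d s1 h1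
      refine ⟨_, _, ?_, .seq a2 (.iteFalse h0 b2), a3.trans b3, ?_⟩
      · simp [Expr.time]; omega
      · rw [Expr.eval, ← a4, h0, b4, a3.arr]; simp
    · obtain ⟨t2, s2, b1, b2, b3, b4⟩ := ihf env ρ d s1 h1
      refine ⟨_, _, ?_, .seq a2 (.iteTrue h0 b2), a3.trans b3, ?_⟩
      · simp [Expr.time]; omega
      · rw [Expr.eval, ← a4, if_pos h0, b4, a3.arr]
  | sum j b e ih =>
    intro env ρ d s h
    set s0 := (((s.setReg d 0).setReg (d + 1) 0).setReg (d + 2) 0).setReg (d + 2) (β b) with hs0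
    have hs0b : s.SameBelow s0 d := by
      refine ⟨fun r hr => ?_, rfl⟩
      have hr1 : r ≠ d + 1 := by omega
      have hr2 : r ≠ d + 2 := by omega
      simp [hs0, hr.ne, hr1, hr2]
    obtain ⟨t, s', h1, h2, h3, h4, h5⟩ := exec_counting_loop
      (P := .seq (e.compile (Function.update ρ j (d + 1)) (d + 3))
        (.seq (.add d d (d + 3)) (.seq (.const (d + 3) 1)
          (.seq (.add (d + 1) (d + 1) (d + 3)) (.sub (d + 2) (d + 2) (d + 3))))))
      (Inv := fun v s' => s.SameBelow s' d ∧ s'.reg (d + 1) = v ∧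
        s'.reg d = ∑ w ∈ Finset.range v, e.eval β (Function.update env j w) s.arr)
      (rem := d + 2) (τ := e.time.eval B + 4) (by
        rintro v s1 ⟨i1, i2, i3⟩ i4
        obtain ⟨t2, s2, b1, b2, b3, b4⟩ := ih (Function.update env j v) (Function.update ρ j (d + 1))
          (d + 3) s1 ((h.of_sameBelow i1).update i2 (by omega) (by omega))
        refine ⟨_, _, ?_, .seq b2 (.seq (.add ..) (.seq (.const ..) (.seq (.add ..) (.sub ..)))),
          ⟨⟨fun r hr => ?_, ?_⟩, ?_, ?_⟩, ?_⟩
        · omega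
        · have hr1 : r ≠ d + 1 := by omega
          have hr2 : r ≠ d + 2 := by omega
          have hr3 : r ≠ d + 3 := by omega
          simp [b3.reg r (by omega), i1.reg r hr, hr.ne, hr1, hr2, hr3]
        · simpa using b3.arr.trans i1.arr
        · simp [b3.reg (d + 1) (by omega), i2]
        · simp [Finset.sum_range_succ, b3.reg d (by omega), i3, b4, i1.arr]
        · simp [b3.reg (d + 2) (by omega)])
      (β b) 0 s0 ⟨hs0b, by simp [hs0], by simp [hs0]⟩ (by simp [hs0])
    refine ⟨1 + (1 + (1 + (1 + t))), s', ?_, ?_, h3, ?_⟩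
    · have := Nat.mul_le_mul_right (e.time.eval B + 5) (hB b)
      replace h1 : t ≤ β b * (e.time.eval B + 5) + 1 := h1
      simp only [Expr.time, Polynomial.eval_add, Polynomial.eval_mul, Polynomial.eval_X,
        Polynomial.eval_ofNat]
      omega
    · refine .seq (.const ..) (.seq (.const ..) (.seq (.const ..) (.seq ?_ h2)))
      have := Exec.add (d + 2) (d + 2) b (((s.setReg d 0).setReg (d + 1) 0).setReg (d + 2) 0)
      have h3 := h.three_le
      have hb0 : (b : ℕ) ≠ d := by omega
      have hb1 : (b : ℕ) ≠ d + 1 := by omega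
      have hb2 : (b : ℕ) ≠ d + 2 := by omega
      simp only [State.setReg_reg, if_neg hb0, if_neg hb1, if_neg hb2, h.bnd, if_true,
        Nat.zero_add] at this
      exact this
    · rw [h5, Nat.zero_add, Expr.eval]

/-- Statements: array assignments, sequences and counting loops. -/
inductive Stmt where
  | store (a : ℕ) (i e : Expr)
  | seq (P Q : Stmt)
  | iterate (j : ℕ) (b : Fin 3) (P : Stmt)

/-- Write into one cell of an array. -/
def setCell (A : ℕ → ℕ → ℕ) (a k v : ℕ) : ℕ → ℕ → ℕ :=
  Function.update A a (Function.update (A a) k v)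

/-- `iterate k f A` applies `f 0`, …, `f (k - 1)` in turn. -/
def iterateFor {α : Type*} (f : ℕ → α → α) (A : α) : ℕ → α
  | 0 => A
  | k + 1 => f k (iterateFor f A k)

/-- The effect of a statement on the arrays. -/
def Stmt.run (β : Fin 3 → ℕ) : Stmt → (ℕ → ℕ) → (ℕ → ℕ → ℕ) → (ℕ → ℕ → ℕ)
  | .store a i e, env, A => setCell A a (i.eval β env A) (e.eval β env A)
  | .seq P Q, env, A => Q.run β env (P.run β env A)
  | .iterate j b P, env, A => iterateFor (fun v A => P.run β (Function.update env j v) A) A (β b)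

/-- Compilation of statements. -/
def Stmt.compile : Stmt → (ℕ → ℕ) → ℕ → Prog
  | .store a i e, ρ, d => .seq (i.compile ρ d) (.seq (e.compile ρ (d + 1)) (.store a d (d + 1)))
  | .seq P Q, ρ, d => .seq (P.compile ρ d) (Q.compile ρ d)
  | .iterate j b P, ρ, d =>
    .seq (.const d 0) (.seq (.const (d + 1) 0) (.seq (.add (d + 1) (d + 1) b)
      (.loop (d + 1) (.seq (P.compile (Function.update ρ j d) (d + 2)) (.seq (.const (d + 2) 1)
          (.seq (.add d d (d + 2)) (.sub (d + 1) (d + 1) (d + 2))))))))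

/-- A bound for the number of steps of a statement. -/
noncomputable def Stmt.time : Stmt → Polynomial ℕ
  | .store _ i e => i.time + e.time + 1
  | .seq P Q => P.time + Q.time
  | .iterate _ _ P => Polynomial.X * (P.time + 4) + 4

/-- Statements communicate through arrays only, so registers from `d` on are scratch space. A loop
needs two of them, for the counter and for the remaining rounds. -/
theorem Stmt.compile_correct {β : Fin 3 → ℕ} {B : ℕ} (hB : ∀ b, β b ≤ B) (P : Stmt) :
    ∀ (env ρ : ℕ → ℕ) (d : ℕ) (s : State), s.Holds β env ρ d →
      ∃ t s', t ≤ P.time.eval B ∧ Exec (P.compile ρ d) s t s' ∧ (∀ r < d, s'.reg r = s.reg r) ∧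
        s'.arr = P.run β env s.arr := by
  induction P with
  | store a i e =>
    intro env ρ d s h
    obtain ⟨t1, s1, a1, a2, a3, a4⟩ := i.compile_correct hB env ρ d s h
    obtain ⟨t2, s2, b1, b2, b3, b4⟩ := e.compile_correct hB env ρ (d + 1) s1
      ((h.of_sameBelow a3).mono (by omega))
    refine ⟨_, _, ?_, .seq a2 (.seq b2 (.store ..)), ?_, ?_⟩
    · simp [Stmt.time]; omega
    · intro r hr
      simpa [State.setArr] using (b3.reg r (by omega)).trans (a3.reg r hr)
    · simp [State.setArr, Stmt.run, setCell, b3.reg d (by omega), a4, b4, b3.arr, a3.arr]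
  | seq P Q ihP ihQ =>
    intro env ρ d s h
    obtain ⟨t1, s1, a1, a2, a3, a4⟩ := ihP env ρ d s h
    obtain ⟨t2, s2, b1, b2, b3, b4⟩ := ihQ env ρ d s1
      ⟨h.three_le, fun b => (a3 _ (by have := h.three_le; omega)).trans (h.bnd b), h.lt,
        fun j => (a3 _ (h.lt j)).trans (h.var j)⟩
    refine ⟨_, _, ?_, .seq a2 b2, fun r hr => (b3 r hr).trans (a3 r hr), ?_⟩
    · simp [Stmt.time]; omega
    · rw [b4, a4, Stmt.run]
  | iterate j b P ih =>
    intro env ρ d s h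
    have h3d := h.three_le
    set s0 := ((s.setReg d 0).setReg (d + 1) 0).setReg (d + 1) (β b) with hs0
    obtain ⟨t, s', h1, h2, h3, h4, h5⟩ := exec_counting_loop
      (P := .seq (P.compile (Function.update ρ j d) (d + 2)) (.seq (.const (d + 2) 1)
          (.seq (.add d d (d + 2)) (.sub (d + 1) (d + 1) (d + 2)))))
      (Inv := fun v s' => (∀ r < d, s'.reg r = s.reg r) ∧ s'.reg d = v ∧
        s'.arr = iterateFor (fun v A => P.run β (Function.update env j v) A) s.arr v)
      (rem := d + 1) (τ := P.time.eval B + 3) (by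
        rintro v s1 ⟨i1, i2, i3⟩ i4
        have hh : s1.Holds β env ρ d := ⟨h.three_le, fun b => (i1 _ (by omega)).trans (h.bnd b), h.lt,
          fun j => (i1 _ (h.lt j)).trans (h.var j)⟩
        obtain ⟨t2, s2, b1, b2, b3, b4⟩ := ih (Function.update env j v) (Function.update ρ j d)
          (d + 2) s1 (hh.update i2 (by omega) (by omega))
        refine ⟨_, _, ?_, .seq b2 (.seq (.const ..) (.seq (.add ..) (.sub ..))),
          ⟨fun r hr => ?_, ?_, ?_⟩, ?_⟩
        · omega
        · have hr1 : r ≠ d + 1 := by omega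
          have hr2 : r ≠ d + 2 := by omega
          simp [b3 r (by omega), i1 r hr, hr.ne, hr1, hr2]
        · simp [b3 d (by omega), i2]
        · simp [b4, i3, iterateFor]
        · simp [b3 (d + 1) (by omega)])
      (β b) 0 s0 ⟨fun r hr => by
        have hr1 : r ≠ d + 1 := by omega
        simp [hs0, hr.ne, hr1], by simp [hs0], by simp [hs0, iterateFor]⟩
      (by simp [hs0])
    refine ⟨1 + (1 + (1 + t)), s', ?_, ?_, h3, ?_⟩
    · have := Nat.mul_le_mul_right (P.time.eval B + 4) (hB b)
      replace h1 : t ≤ β b * (P.time.eval B + 4) + 1 := h1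
      simp only [Stmt.time, Polynomial.eval_add, Polynomial.eval_mul, Polynomial.eval_X,
        Polynomial.eval_ofNat]
      omega
    · refine .seq (.const ..) (.seq (.const ..) (.seq ?_ h2))
      have := Exec.add (d + 1) (d + 1) b ((s.setReg d 0).setReg (d + 1) 0)
      have hb0 : (b : ℕ) ≠ d := by omega
      have hb1 : (b : ℕ) ≠ d + 1 := by omega
      simp only [State.setReg_reg, if_neg hb0, if_neg hb1, h.bnd, if_true, Nat.zero_add] at this
      exact this
    · rw [h5, Nat.zero_add, Stmt.run]

/-- The loop bounds: `n`, the number of strings, and `n + 2`. -/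
def bounds (n N : ℕ) : Fin 3 → ℕ := ![n, N, n + 2]

/-- The machine program of a statement. -/
def Stmt.program (P : Stmt) : Prog :=
  .seq (.const 3 2) (.seq (.add 2 0 3) (.seq (.const 3 0) (P.compile (fun _ => 3) 4)))

/-- All variables are initially mapped to register 3, which is reset to 0 after it has served to
compute the bound `n + 2`. -/
theorem Stmt.program_correct (P : Stmt) (n : ℕ) {N : ℕ} (y : Fin N → List Bool) :
    ∃ t s, t ≤ (P.time + 3).eval (n + N + 2) ∧ Exec P.program (initState n y) t s ∧
      s.arr = P.run (bounds n N) (fun _ => 0) (initState n y).arr := by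
  set s0 := (((initState n y).setReg 3 2).setReg 2 (n + 2)).setReg 3 0 with hs0
  obtain ⟨t, s, h1, h2, -, h4⟩ := P.compile_correct (β := bounds n N) (B := n + N + 2)
    (by intro b; fin_cases b <;> simp [bounds] <;> omega) (fun _ => 0) (fun _ => 3) 4 s0
    ⟨by norm_num, by intro b; fin_cases b <;> simp [bounds, hs0, initState], by simp, by simp [hs0]⟩
  refine ⟨1 + (1 + (1 + t)), s, ?_, ?_, ?_⟩
  · simp; omega
  · refine .seq (.const ..) (.seq ?_ (.seq (.const ..) h2))
    have := Exec.add 2 0 3 ((initState n y).setReg 3 2)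
    simpa [initState] using this
  · rw [h4, hs0]; rfl

/-! ### Scanning a trace along a coarse picture of the string -/

/-- The least `k < B` with `p k`, or `B`. -/
def leastBelow (B : ℕ) (p : ℕ → Prop) [DecidablePred p] : ℕ :=
  ∑ k ∈ Finset.range B, if ∃ j < k + 1, p j then 0 else 1

section leastBelow

variable {B : ℕ} {p : ℕ → Prop} [DecidablePred p]

theorem leastBelow_succ : leastBelow (B + 1) p =
    leastBelow B p + if ∃ j < B + 1, p j then 0 else 1 :=
  Finset.sum_range_succ _ _

/-- The summands are 1 before the first solution and 0 from there on. The minimum is written as a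
sum because sums are the only loops among expressions. -/
theorem leastBelow_spec : leastBelow B p ≤ B ∧ (∀ j < leastBelow B p, ¬ p j) ∧
    (leastBelow B p < B → p (leastBelow B p)) := by
  induction B with
  | zero => simp [leastBelow]
  | succ B ih =>
    obtain ⟨h1, h2, h3⟩ := ih
    rw [leastBelow_succ]
    split_ifs with h
    · obtain ⟨j, hj, hp⟩ := h
      refine ⟨by omega, h2, fun _ => ?_⟩
      rcases h1.lt_or_eq with h4 | h4
      · exact h3 h4
      · rw [Nat.add_zero, h4]
        have : j = B := by
          by_contra hne
          exact h2 j (by omega) hp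
        rwa [← this]
    · push Not at h
      have : leastBelow B p = B := by
        by_contra hne
        exact h _ (by omega) (h3 (by omega))
      rw [this]
      exact ⟨le_rfl, fun j hj => h j hj, fun h => absurd h (lt_irrefl _)⟩

theorem leastBelow_le : leastBelow B p ≤ B := leastBelow_spec.1

theorem not_of_lt_leastBelow {j : ℕ} (h : j < leastBelow B p) : ¬ p j := leastBelow_spec.2.1 j h

theorem leastBelow_prop (h : leastBelow B p < B) : p (leastBelow B p) := leastBelow_spec.2.2 h

theorem leastBelow_le_of {j : ℕ} (h : p j) : leastBelow B p ≤ j := by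
  by_contra hc
  exact not_of_lt_leastBelow (not_le.1 hc) h

theorem leastBelow_eq {j : ℕ} (hj : j < B) (h : p j) (h' : ∀ i < j, ¬ p i) : leastBelow B p = j := by
  refine le_antisymm (leastBelow_le_of h) ?_
  by_contra hc
  exact h' _ (not_le.1 hc) (leastBelow_prop ((not_le.1 hc).trans hj))

end leastBelow

/-- `x` agrees with `u` up to the relative error `1 / D`. -/
def CloseTo (D x u : ℕ) : Prop := D * ((x - u) + (u - x)) ≤ u

instance (D x u : ℕ) : Decidable (CloseTo D x u) := by unfold CloseTo; infer_instance

theorem CloseTo.abs_le {D x u : ℕ} (h : CloseTo D x u) : (D : ℝ) * |(x : ℝ) - u| ≤ u := by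
  unfold CloseTo at h
  have : |(x : ℝ) - u| = (((x - u) + (u - x) : ℕ) : ℝ) := by
    rcases le_total x u with h | h
    · rw [Nat.sub_eq_zero_of_le h, Nat.zero_add, Nat.cast_sub h, abs_of_nonpos]
      · ring
      · exact sub_nonpos.2 (by exact_mod_cast h)
    · rw [Nat.sub_eq_zero_of_le h, Nat.add_zero, Nat.cast_sub h, abs_of_nonneg]
      exact sub_nonneg.2 (by exact_mod_cast h)
  rw [this]
  exact_mod_cast h

theorem closeTo_of_abs_le {D x u : ℕ} (h : (D : ℝ) * |(x : ℝ) - u| ≤ u) : CloseTo D x u := by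
  unfold CloseTo
  have : |(x : ℝ) - u| = (((x - u) + (u - x) : ℕ) : ℝ) := by
    rcases le_total x u with h | h
    · rw [Nat.sub_eq_zero_of_le h, Nat.zero_add, Nat.cast_sub h, abs_of_nonpos]
      · ring
      · exact sub_nonpos.2 (by exact_mod_cast h)
    · rw [Nat.sub_eq_zero_of_le h, Nat.add_zero, Nat.cast_sub h, abs_of_nonneg]
      exact sub_nonneg.2 (by exact_mod_cast h)
  rw [this] at h
  exact_mod_cast h

/-- `k` is a possible index of the next one after index `F` and a gap of length `u`. -/
def IsCandidate (D : ℕ) (Y : ℕ → ℕ) (F u k : ℕ) : Prop :=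
  F < k ∧ ∃ k' < k, F ≤ k' ∧ CloseTo D (Y k - Y k') u

instance (D : ℕ) (Y : ℕ → ℕ) (F u k : ℕ) : Decidable (IsCandidate D Y F u k) := by
  unfold IsCandidate; infer_instance

/-- The least possible index of the next one. -/
def nextIndex (n D : ℕ) (Y : ℕ → ℕ) (F u : ℕ) : ℕ := leastBelow (n + 2) (IsCandidate D Y F u)

/-- The padded distance of the one at place `t` of a trace from the preceding one at place `L`
(or from the left end if `L = 0`). -/
def padGap (n len L t : ℕ) : ℕ :=
  (t - L) + (if L = 0 then n else 0) + (if t = len + 1 then n else 0)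

/-- Place of the last one and its assigned index, after `t` places. -/
def scan (n D : ℕ) (Y : ℕ → ℕ) (len : ℕ) (bit : ℕ → ℕ) : ℕ → ℕ × ℕ
  | 0 => (0, 0)
  | t + 1 =>
    if bit (t + 1) ≠ 0 then
      (t + 1, nextIndex n D Y (scan n D Y len bit t).2 (padGap n len (scan n D Y len bit t).1 (t + 1)))
    else scan n D Y len bit t

/-- The bit at place `t ≥ 1` of a trace, with a final one appended. -/
def traceBit (y : List Bool) (t : ℕ) : ℕ :=
  if t ≤ y.length then (y.getD (t - 1) false).toNat else if t = y.length + 1 then 1 else 0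

/-- The default value `n + 2` lies above all genuine indices, so assigned indices increase even when
no candidate exists. -/
theorem lt_nextIndex {n D : ℕ} {Y : ℕ → ℕ} {F u : ℕ} (h : F < n + 2) : F < nextIndex n D Y F u := by
  rcases (leastBelow_le (B := n + 2) (p := IsCandidate D Y F u)).lt_or_eq with h' | h'
  · exact (leastBelow_prop h').1
  · rw [nextIndex, h']; exact h

theorem nextIndex_le (n D : ℕ) (Y : ℕ → ℕ) (F u : ℕ) : nextIndex n D Y F u ≤ n + 2 := leastBelow_le

section scan

variable {n D : ℕ} {Y : ℕ → ℕ} {len : ℕ} {bit : ℕ → ℕ}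

theorem scan_snd_le (t : ℕ) : (scan n D Y len bit t).2 ≤ n + 2 := by
  induction t with
  | zero => simp [scan]
  | succ t ih =>
    rw [scan]
    split_ifs
    · exact nextIndex_le n D Y _ _
    · exact ih

theorem scan_snd_le_succ (t : ℕ) : (scan n D Y len bit t).2 ≤ (scan n D Y len bit (t + 1)).2 := by
  conv_rhs => rw [scan]
  split_ifs
  · change _ ≤ nextIndex n D Y _ _
    rcases (scan_snd_le (n := n) (D := D) (Y := Y) (len := len) (bit := bit) t).lt_or_eq with h | h
    · exact (lt_nextIndex h).le
    · rcases (leastBelow_le (B := n + 2) (p := IsCandidate D Y (scan n D Y len bit t).2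
        (padGap n len (scan n D Y len bit t).1 (t + 1)))).lt_or_eq with h' | h'
      · exact (leastBelow_prop h').1.le
      · rw [nextIndex, h', h]
  · exact le_rfl

theorem scan_snd_mono {t t' : ℕ} (h : t ≤ t') :
    (scan n D Y len bit t).2 ≤ (scan n D Y len bit t').2 := by
  induction t', h using Nat.le_induction with
  | base => exact le_rfl
  | succ t' _ ih => exact ih.trans (scan_snd_le_succ t')

theorem scan_snd_lt_succ {t : ℕ} (hb : bit (t + 1) ≠ 0) (h : (scan n D Y len bit t).2 < n + 2) :
    (scan n D Y len bit t).2 < (scan n D Y len bit (t + 1)).2 := by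
  conv_rhs => rw [scan]
  rw [if_pos hb]
  change _ < nextIndex n D Y _ _
  exact lt_nextIndex h

end scan

/-! ### The source behind a trace -/

/-- The string on positions `1, …, n`, continued by ones on both sides. -/
def ext {n : ℕ} (x : Fin n → Bool) (p : ℕ) : Bool :=
  if h : 1 ≤ p ∧ p ≤ n then x ⟨p - 1, by omega⟩ else true

/-- The number of retained positions among `1, …, p`. -/
def cnt {n : ℕ} (keep : Fin n → Bool) : ℕ → ℕ
  | 0 => 0
  | p + 1 => cnt keep p + if ext keep (p + 1) then 1 else 0

section cnt

variable {n : ℕ} {x keep : Fin n → Bool}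

theorem ext_succ {p : ℕ} (hp : p < n) : ext x (p + 1) = x ⟨p, hp⟩ := by
  simp [ext, Nat.succ_le_of_lt hp]

theorem ext_zero : ext x 0 = true := by simp [ext]

theorem ext_of_lt {p : ℕ} (h : n < p) : ext x p = true := by
  rw [ext, dif_neg]; omega

theorem cnt_succ_of (p : ℕ) (h : ext keep (p + 1) = true) : cnt keep (p + 1) = cnt keep p + 1 := by
  simp [cnt, h]

theorem cnt_succ_of_not (p : ℕ) (h : ext keep (p + 1) = false) : cnt keep (p + 1) = cnt keep p := by
  simp [cnt, h]

theorem cnt_mono {p q : ℕ} (h : p ≤ q) : cnt keep p ≤ cnt keep q := by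
  induction q, h using Nat.le_induction with
  | base => exact le_rfl
  | succ q _ ih => rw [cnt]; omega

theorem cnt_lt {p q : ℕ} (h : p < q) (hq : ext keep q = true) : cnt keep p < cnt keep q := by
  obtain ⟨q, rfl⟩ : ∃ q', q = q' + 1 := ⟨q - 1, by omega⟩
  rw [cnt_succ_of q hq]
  have := cnt_mono (keep := keep) (by omega : p ≤ q)
  omega

theorem exists_cnt_eq {t p : ℕ} (h1 : 1 ≤ t) (h2 : t ≤ cnt keep p) :
    ∃ q, q < p ∧ ext keep (q + 1) = true ∧ cnt keep (q + 1) = t := by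
  induction p with
  | zero => simp [cnt] at h2; omega
  | succ p ih =>
    by_cases h : t ≤ cnt keep p
    · obtain ⟨q, h3, h4⟩ := ih h
      exact ⟨q, by omega, h4⟩
    · by_cases hk : ext keep (p + 1) = true
      · refine ⟨p, by omega, hk, ?_⟩
        rw [cnt_succ_of p hk] at h2 ⊢
        omega
      · rw [cnt_succ_of_not p (by simpa using hk)] at h2
        omega

theorem length_filter_take (p : ℕ) (hp : p ≤ n) :
    (((List.finRange n).take p).filter keep).length = cnt keep p := by
  induction p with
  | zero => simp [cnt]
  | succ p ih =>
    have hp' : p < n := hp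
    rw [List.take_add_one, List.filter_append, List.length_append, ih (by omega), cnt,
      ext_succ hp']
    congr 1
    simp only [List.getElem?_eq_getElem (by simpa using hp' : p < (List.finRange n).length),
      Option.toList_some, List.getElem_finRange, Fin.cast_mk]
    by_cases h : keep ⟨p, hp'⟩ <;> simp [h]

theorem length_trace (x keep : Fin n → Bool) : (trace x keep).length = cnt keep n := by
  rw [trace, List.length_map, ← length_filter_take n le_rfl, List.take_of_length_le (by simp)]

theorem trace_getD {p : ℕ} (hp : p < n) (hk : ext keep (p + 1) = true) :
    (trace x keep).getD (cnt keep p) false = ext x (p + 1) := by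
  have h1 : List.finRange n = (List.finRange n).take p ++ ⟨p, hp⟩ :: (List.finRange n).drop (p + 1) := by
    conv_lhs => rw [← List.take_append_drop p (List.finRange n)]
    rw [List.drop_eq_getElem_cons (by simpa using hp)]
    simp
  rw [ext_succ hp] at hk ⊢
  rw [trace, h1, List.filter_append, List.filter_cons_of_pos hk, List.map_append,
    List.getD_append_right]
  · simp [length_filter_take p hp.le]
  · simp [length_filter_take p hp.le]

theorem traceBit_cnt {p : ℕ} (hp : p ≤ n) (hk : ext keep (p + 1) = true) :
    traceBit (trace x keep) (cnt keep (p + 1)) = (ext x (p + 1)).toNat := by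
  rw [cnt_succ_of p hk, traceBit, length_trace]
  rcases hp.lt_or_eq with h | rfl
  · have := cnt_mono (keep := keep) (by omega : p + 1 ≤ n)
    rw [cnt_succ_of p hk] at this
    rw [if_pos this, Nat.add_sub_cancel, trace_getD h hk]
  · rw [if_neg (by omega), if_pos rfl, ext_of_lt (by omega)]
    rfl

theorem traceBit_of_gt {t : ℕ} (h : cnt keep n + 1 < t) : traceBit (trace x keep) t = 0 := by
  rw [traceBit, length_trace, if_neg (by omega), if_neg (by omega)]

end cnt

/-- The scan of a trace, read along the source. -/
def srcScan {n : ℕ} (D : ℕ) (Y : ℕ → ℕ) (x keep : Fin n → Bool) : ℕ → ℕ × ℕ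
  | 0 => (0, 0)
  | p + 1 =>
    if ext keep (p + 1) = true ∧ ext x (p + 1) = true then
      (cnt keep (p + 1), nextIndex n D Y (srcScan D Y x keep p).2
        ((cnt keep (p + 1) - (srcScan D Y x keep p).1) +
          (if (srcScan D Y x keep p).1 = 0 then n else 0) + (if p = n then n else 0)))
    else srcScan D Y x keep p

/-- Walking along the source changes the state only at retained ones, exactly where the scan meets a
nonzero bit. The appended final bit corresponds to the place `n + 1`, which is always retained. -/
theorem scan_cnt {n D : ℕ} {Y : ℕ → ℕ} {x keep : Fin n → Bool} {p : ℕ} (hp : p ≤ n + 1) :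
    scan n D Y (trace x keep).length (traceBit (trace x keep)) (cnt keep p) =
      srcScan D Y x keep p := by
  induction p with
  | zero => simp [cnt, scan, srcScan]
  | succ p ih =>
    have ih := ih (by omega)
    by_cases hk : ext keep (p + 1) = true
    · have hb := traceBit_cnt (x := x) (by omega : p ≤ n) hk
      rw [cnt_succ_of p hk] at hb ⊢
      rw [scan, hb, ih, srcScan, cnt_succ_of p hk]
      by_cases hx : ext x (p + 1) = true
      · simp only [hx, hk, and_self, if_true, padGap, length_trace]
        have : cnt keep p = cnt keep n ↔ p = n := by
          constructor
          · intro h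
            by_contra hne
            have := cnt_lt (keep := keep) (by omega : p < p + 1) hk
            have := cnt_mono (keep := keep) (by omega : p + 1 ≤ n)
            omega
          · rintro rfl; rfl
        simp [this]
      · simp [hx]
    · rw [cnt_succ_of_not p (by simpa using hk), ih, srcScan, if_neg (by simp [hk])]

theorem cnt_congr {n : ℕ} {keep keep' : Fin n → Bool} {p : ℕ}
    (h : ∀ q, 1 ≤ q → q ≤ p → ext keep q = ext keep' q) : cnt keep p = cnt keep' p := by
  induction p with
  | zero => rfl
  | succ p ih => rw [cnt, cnt, ih fun q h1 h2 => h q h1 (by omega), h (p + 1) (by omega) le_rfl]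

theorem srcScan_congr {n D : ℕ} {Y : ℕ → ℕ} {x keep keep' : Fin n → Bool} {p : ℕ}
    (h : ∀ q, 1 ≤ q → q ≤ p → ext keep q = ext keep' q) :
    srcScan D Y x keep p = srcScan D Y x keep' p := by
  induction p with
  | zero => rfl
  | succ p ih =>
    rw [srcScan, srcScan, ih fun q h1 h2 => h q h1 (by omega), h (p + 1) (by omega) le_rfl,
      cnt_congr h]

/-- `P 0 < P 1 < ⋯ < P m` are the places of the ones of `x` on `0, …, n + 1`, the two added ones
included. -/
structure IsOnes {n : ℕ} (x : Fin n → Bool) (m : ℕ) (P : ℕ → ℕ) : Prop where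
  zero : P 0 = 0
  last : P m = n + 1
  mono : StrictMono P
  ext_iff : ∀ p ≤ n + 1, ext x p = true ↔ ∃ i ≤ m, P i = p

/-- Since `ext` is true beyond `n`, there are infinitely many ones, and their enumeration `Nat.nth`
is strictly increasing on all of ℕ, also beyond the index `m`. -/
theorem exists_isOnes {n : ℕ} (x : Fin n → Bool) : ∃ m P, IsOnes x m P := by
  have hinf : {p | ext x p = true}.Infinite := by
    refine Set.infinite_of_not_bddAbove ?_
    rintro ⟨b, hb⟩
    have := hb (show ext x (b + n + 1) = true from ext_of_lt (by omega))
    omega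
  have hlast := Nat.nth_count (p := fun p => ext x p = true) (ext_of_lt (by omega : n < n + 1))
  refine ⟨_, Nat.nth fun p => ext x p = true, Nat.nth_zero_of_zero ext_zero, hlast,
    Nat.nth_strictMono hinf, ?_⟩
  intro p hp
  constructor
  · intro h
    refine ⟨Nat.count (fun p => ext x p = true) p, Nat.count_monotone _ hp, Nat.nth_count h⟩
  · rintro ⟨i, -, rfl⟩
    exact Nat.nth_mem_of_infinite hinf i

/-- The expected padded place of the `i`-th one in a trace. -/
noncomputable def linePos (δ : ℝ) (n m : ℕ) (P : ℕ → ℕ) (i : ℕ) : ℝ :=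
  (1 - δ) * P i + (if i = 0 then 0 else (n : ℝ)) + (if m ≤ i then (n : ℝ) else 0)

/-- `linePos`, continued to all integers. -/
noncomputable def lineX (δ : ℝ) (n m : ℕ) (P : ℕ → ℕ) (i : ℤ) : ℝ :=
  if 0 ≤ i then linePos δ n m P i.toNat else linePos δ n m P 0 + i

theorem lineX_natCast (δ : ℝ) (n m : ℕ) (P : ℕ → ℕ) (i : ℕ) :
    lineX δ n m P i = linePos δ n m P i := by
  simp [lineX]

theorem linePos_strictMono {δ : ℝ} (hδ : δ < 1) {n m : ℕ} {P : ℕ → ℕ} (hP : StrictMono P) :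
    StrictMono (linePos δ n m P) := by
  intro i j hij
  have h1 : (P i : ℝ) < P j := by exact_mod_cast hP hij
  have h2 : (if i = 0 then 0 else (n : ℝ)) ≤ if j = 0 then 0 else (n : ℝ) := by
    split_ifs
    · exact le_rfl
    · positivity
    · omega
    · exact le_rfl
  have h3 : (if m ≤ i then (n : ℝ) else 0) ≤ if m ≤ j then (n : ℝ) else 0 := by
    split_ifs
    · exact le_rfl
    · omega
    · positivity
    · exact le_rfl
  unfold linePos
  nlinarith

theorem lineX_strictMono {δ : ℝ} (hδ : δ < 1) {n m : ℕ} {P : ℕ → ℕ} (hP : StrictMono P) :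
    StrictMono (lineX δ n m P) := by
  intro i j hij
  have hm := linePos_strictMono hδ (n := n) (m := m) hP
  unfold lineX
  split_ifs with h1 h2
  · exact hm (by omega)
  · omega
  · have := hm.monotone (Nat.zero_le j.toNat)
    have : (i : ℝ) < 0 := by exact_mod_cast (by omega : i < 0)
    linarith
  · have : (i : ℝ) < j := by exact_mod_cast hij
    linarith

/-- The padded distance between the `r`-th and the `i`-th one in a trace. -/
def gapLen {n : ℕ} (m : ℕ) (P : ℕ → ℕ) (keep : Fin n → Bool) (r i : ℕ) : ℕ :=
  (cnt keep (P i) - cnt keep (P r)) + (if r = 0 then n else 0) + (if i = m then n else 0)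

/-- All padded distances in the trace are close to their expectations. -/
def GapsClose {n : ℕ} (δ : ℝ) (D m : ℕ) (P : ℕ → ℕ) (keep : Fin n → Bool) : Prop :=
  ∀ r i, r < i → i ≤ m → 0 < gapLen m P keep r i ∧
    (64 * D) * |(gapLen m P keep r i : ℝ) - (linePos δ n m P i - linePos δ n m P r)| ≤
      linePos δ n m P i - linePos δ n m P r

/-- `Y` is an accurate picture of the first ones, up to index `M`. -/
structure IsAccurate (δ : ℝ) (n D m M : ℕ) (P Y : ℕ → ℕ) : Prop where
  close : ∀ s t, s < t → t ≤ M → (4 * D) * |((Y t : ℝ) - Y s) -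
    (linePos δ n m P t - linePos δ n m P s)| ≤ linePos δ n m P t - linePos δ n m P s
  zero : ∀ k, M < k → Y k = 0

/-- The indices of the deleted ones. -/
noncomputable def deleted {n : ℕ} (m : ℕ) (P : ℕ → ℕ) (keep : Fin n → Bool) : Finset ℤ :=
  (Finset.Icc (0 : ℤ) m).filter fun i => ext keep (P i.toNat) = false

/-- The scan may assign too small an index to the `i`-th one. -/
def Lags {n : ℕ} (δ : ℝ) (D m : ℕ) (P : ℕ → ℕ) (keep : Fin n → Bool) (i : ℕ) : Prop :=
  Emb (Matches (2 / D) (lineX δ n m P) (lineX δ n m P)) (deleted m P keep) 0 0 i (i - 1)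

section scan

variable {n D m M : ℕ} {δ : ℝ} {P Y : ℕ → ℕ} {x keep : Fin n → Bool}

theorem IsAccurate.le (hY : IsAccurate δ n D m M P Y) (hδ : δ < 1) (hD : 2 ≤ D)
    (hP : StrictMono P) {s t : ℕ} (hst : s ≤ t) (ht : t ≤ M) : Y s ≤ Y t := by
  rcases hst.eq_or_lt with rfl | hst
  · exact le_rfl
  have h1 := hY.close s t hst ht
  have h2 := linePos_strictMono hδ (n := n) (m := m) hP hst
  have hD' : (2 : ℝ) ≤ D := by exact_mod_cast hD
  have h3 := neg_abs_le (((Y t : ℝ) - Y s) - (linePos δ n m P t - linePos δ n m P s))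
  have h4 := abs_nonneg (((Y t : ℝ) - Y s) - (linePos δ n m P t - linePos δ n m P s))
  have : (Y s : ℝ) ≤ Y t := by nlinarith
  exact_mod_cast this

/-- The true pair of indices passes the test: the errors 1/(4D) of the picture and 1/(64D) of the
trace together stay below the tolerance 1/D. -/
theorem IsAccurate.closeTo (hY : IsAccurate δ n D m M P Y) (hδ : δ < 1) (hD : 2 ≤ D)
    (hP : StrictMono P) (hg : GapsClose δ D m P keep) {r i : ℕ} (hri : r < i) (hi : i ≤ M)
    (hM : M ≤ m) : CloseTo D (Y i - Y r) (gapLen m P keep r i) := by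
  have hle := hY.le hδ hD hP hri.le hi
  have h1 := hY.close r i hri hi
  have h2 := (hg r i hri (hi.trans hM)).2
  have h3 := linePos_strictMono hδ (n := n) (m := m) hP hri
  have hD' : (2 : ℝ) ≤ D := by exact_mod_cast hD
  apply closeTo_of_abs_le
  rw [Nat.cast_sub hle]
  set G := linePos δ n m P i - linePos δ n m P r
  set u : ℝ := ((gapLen m P keep r i : ℕ) : ℝ)
  set a : ℝ := (Y i : ℝ) - Y r
  have h4 : |a - u| ≤ |a - G| + |u - G| := by
    rw [abs_sub_comm u G]; exact abs_sub_le _ _ _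
  have h5 := neg_abs_le (u - G)
  have h6 := abs_nonneg (u - G)
  have h7 : (D : ℝ) * |a - u| ≤ D * |a - G| + D * |u - G| := by nlinarith
  nlinarith

/-- Conversely, an accepted pair spans about the same length as the true pair, with the errors of
picture, trace and test adding up to at most 2/D. Indices beyond `M` are never accepted: there the
picture is 0, and 0 is not close to a positive gap. -/
theorem IsAccurate.matches_of_candidate (hY : IsAccurate δ n D m M P Y) (hδ : δ < 1) (hD : 2 ≤ D)
    (hP : StrictMono P) (hg : GapsClose δ D m P keep) {r i k k' : ℕ} (hri : r < i) (hi : i ≤ m)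
    (hk : k' < k) (h : CloseTo D (Y k - Y k') (gapLen m P keep r i)) :
    Matches (2 / D) (lineX δ n m P) (lineX δ n m P) k' k r i := by
  obtain ⟨hu0, h2⟩ := hg r i hri hi
  have hkM : k ≤ M := by
    by_contra hc
    rw [hY.zero k (by omega)] at h
    unfold CloseTo at h
    simp only [Nat.zero_sub, Nat.sub_zero, Nat.zero_add] at h
    nlinarith
  have hle := hY.le hδ hD hP hk.le hkM
  have h1 := hY.close k' k hk hkM
  have h3 := linePos_strictMono hδ (n := n) (m := m) hP hri
  have h3' := linePos_strictMono hδ (n := n) (m := m) hP hk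
  have hD' : (2 : ℝ) ≤ D := by exact_mod_cast hD
  have h4 := h.abs_le
  rw [Nat.cast_sub hle] at h4
  simp only [Matches, lineX_natCast]
  set G := linePos δ n m P i - linePos δ n m P r
  set b := linePos δ n m P k - linePos δ n m P k'
  set u : ℝ := ((gapLen m P keep r i : ℕ) : ℝ)
  set a : ℝ := (Y k : ℝ) - Y k'
  have hG : 0 < G := sub_pos.2 h3
  have hb : 0 < b := sub_pos.2 h3'
  have a1 := abs_nonneg (u - G)
  have a2 := abs_nonneg (a - u)
  have a3 := abs_nonneg (a - b)
  have b1 := le_abs_self (u - G)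
  have b2 := le_abs_self (a - u)
  have b3 := neg_abs_le (a - b)
  have c1 : |u - G| ≤ G / 128 := by nlinarith
  have c2 : |a - u| ≤ u / 2 := by nlinarith
  have c3 : |a - b| ≤ b / 8 := by nlinarith
  have c4 : b ≤ 2 * G := by linarith
  have c5 : |b - G| ≤ |a - b| + |a - u| + |u - G| := by
    calc |b - G| = |-(a - b) + (a - u) + (u - G)| := by congr 1; ring
      _ ≤ _ := (abs_add_le _ _).trans (by
        gcongr
        exact (abs_add_le _ _).trans (by rw [abs_neg]))
  rw [div_mul_eq_mul_div, le_div_iff₀ (by linarith)]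
  have c6 : (D : ℝ) * |b - G| ≤ D * (|a - b| + |a - u| + |u - G|) := by gcongr
  nlinarith

/-- The state of the scan along the source. -/
theorem srcScan_spec (hx : IsOnes x m P) (hY : IsAccurate δ n D m M P Y) (hδ : δ < 1) (hD : 2 ≤ D)
    (hg : GapsClose δ D m P keep) (hM : M ≤ m) (p : ℕ) :
    p ≤ n + 1 → p < P (M + 1) → ∃ r, r ≤ M ∧ P r ≤ p ∧ ext keep (P r) = true ∧
      (∀ i, r < i → P i ≤ p → ext keep (P i) = false) ∧
      (srcScan D Y x keep p).1 = cnt keep (P r) ∧ (srcScan D Y x keep p).2 ≤ r ∧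
      Emb (Matches (2 / D) (lineX δ n m P) (lineX δ n m P)) (deleted m P keep) 0 0 r
        (srcScan D Y x keep p).2 := by
  have hPm : m ≤ n + 1 := by
    have := hx.mono.id_le m
    rwa [hx.last] at this
  induction p with
  | zero =>
    intro _ _
    refine ⟨0, by omega, by rw [hx.zero], by rw [hx.zero, ext_zero], ?_, ?_, ?_, ?_⟩
    · intro i hi hPi
      have := hx.mono hi
      omega
    · simp [srcScan, hx.zero, cnt]
    · simp [srcScan]
    · simpa [srcScan] using Emb.refl le_rfl
  | succ p ih =>
    intro h1 h2
    obtain ⟨r, r1, r2, r3, r4, r5, r6, r7⟩ := ih (by omega) (by omega)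
    rw [srcScan]
    by_cases hcase : ext keep (p + 1) = true ∧ ext x (p + 1) = true
    · rw [if_pos hcase]
      obtain ⟨i, hi, hPi⟩ := (hx.ext_iff (p + 1) h1).1 hcase.2
      have hri : r < i := by
        by_contra hc
        have := hx.mono.monotone (not_lt.1 hc)
        omega
      have hiM : i ≤ M := by
        by_contra hc
        have := hx.mono.monotone (by omega : M + 1 ≤ i)
        omega
      have hgap : (cnt keep (p + 1) - (srcScan D Y x keep p).1) +
          (if (srcScan D Y x keep p).1 = 0 then n else 0) + (if p = n then n else 0) =
          gapLen m P keep r i := by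
        have e1 : (srcScan D Y x keep p).1 = 0 ↔ r = 0 := by
          rw [r5]
          constructor
          · intro h
            by_contra hr0
            have h3 := hx.mono (Nat.pos_of_ne_zero hr0)
            rw [hx.zero] at h3
            have := cnt_lt (keep := keep) h3 r3
            omega
          · rintro rfl
            rw [hx.zero, cnt]
        have e2 : p = n ↔ i = m := by
          constructor
          · rintro rfl
            rw [← hx.last] at hPi
            exact hx.mono.injective hPi
          · rintro rfl
            rw [hx.last] at hPi
            omega
        simp only [e1, e2]
        rw [gapLen, hPi, r5]
      simp only [hgap]
      set F := (srcScan D Y x keep p).2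
      -- The assigned index of the preceding one is at most its true index `r`, so the true pair is
      -- available and bounds the least candidate by `i`.
      have hcand : IsCandidate D Y F (gapLen m P keep r i) i :=
        ⟨by omega, r, hri, r6, hY.closeTo hδ hD hx.mono hg hri hiM hM⟩
      have hle : nextIndex n D Y F (gapLen m P keep r i) ≤ i := leastBelow_le_of hcand
      have hlt : nextIndex n D Y F (gapLen m P keep r i) < n + 2 := by omega
      obtain ⟨q1, k', q2, q3, q4⟩ := leastBelow_prop hlt
      refine ⟨i, hiM, hPi.le, by rw [hPi]; exact hcase.1, ?_, by rw [hPi], hle, ?_⟩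
      · intro j hj hPj
        have := hx.mono hj
        omega
      · refine .step r7 (by omega) ?_ ?_ ?_ ?_ ?_ (hY.matches_of_candidate hδ hD hx.mono hg hri
          (hiM.trans hM) q2 q4)
        · intro u hu1 hu2
          obtain ⟨w, rfl⟩ := Int.eq_ofNat_of_zero_le (by omega : 0 ≤ u)
          rw [deleted, Finset.mem_filter, Finset.mem_Icc]
          refine ⟨by omega, ?_⟩
          have := hx.mono (by omega : w < i)
          exact r4 w (by omega) (by omega)
        · rw [deleted, Finset.mem_filter]
          rintro ⟨-, h⟩
          simp [hPi, hcase.1] at h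
        · exact_mod_cast q3
        · exact_mod_cast q2
        · exact le_rfl
    · rw [if_neg hcase]
      refine ⟨r, r1, by omega, r3, ?_, r5, r6, r7⟩
      intro i hi hPi
      rcases Nat.lt_or_ge p (P i) with h | h
      · have hPi' : P i = p + 1 := by omega
        have hx1 : ext x (p + 1) = true := (hx.ext_iff (p + 1) h1).2 ⟨i, by
          by_contra hc
          have := hx.mono (not_le.1 hc)
          rw [hx.last] at this
          omega, hPi'⟩
        rw [hPi']
        simpa [hx1] using hcase
      · exact r4 i hi h

/-- A retained one is never assigned too large an index, and the right one unless the scan lags. -/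
theorem srcScan_at (hx : IsOnes x m P) (hY : IsAccurate δ n D m M P Y) (hδ : δ < 1) (hD : 2 ≤ D)
    (hg : GapsClose δ D m P keep) (hM : M ≤ m) {i : ℕ} (hi : i ≤ M)
    (hk : ext keep (P i) = true) :
    (srcScan D Y x keep (P i)).1 = cnt keep (P i) ∧ (srcScan D Y x keep (P i)).2 ≤ i ∧
      (¬ Lags δ D m P keep i → (srcScan D Y x keep (P i)).2 = i) := by
  have hPi : P i ≤ n + 1 := by
    rw [← hx.last]
    exact hx.mono.monotone (hi.trans hM)
  obtain ⟨r, r1, r2, r3, r4, r5, r6, r7⟩ := srcScan_spec hx hY hδ hD hg hM (P i) hPi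
    (hx.mono (by omega))
  have hir : i ≤ r := by
    by_contra hc
    have := r4 i (by omega) le_rfl
    rw [hk] at this
    exact absurd this (by simp)
  obtain rfl : r = i := le_antisymm (hx.mono.le_iff_le.1 r2) hir
  refine ⟨r5, r6, ?_⟩
  intro hlag
  by_contra hne
  exact hlag (r7.mono_right (by omega))

end scan

/-! ### The coarse picture -/

/-- The padded distance from the one with assigned index `i` to the next one in the trace. -/
def coarseSample (n D : ℕ) (Y : ℕ → ℕ) (y : List Bool) (i : ℕ) : ℕ :=
  ∑ t ∈ Finset.range (n + 2),
    if traceBit y (t + 1) ≠ 0 ∧ (scan n D Y y.length (traceBit y) t).2 = i then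
      padGap n y.length (scan n D Y y.length (traceBit y) t).1 (t + 1) else 0

section sample

variable {n D m M : ℕ} {δ : ℝ} {P Y : ℕ → ℕ} {x keep : Fin n → Bool}

theorem cnt_le (p : ℕ) : cnt keep p ≤ p := by
  induction p with
  | zero => simp [cnt]
  | succ p ih => rw [cnt]; split_ifs <;> omega

theorem IsOnes.le_succ (hx : IsOnes x m P) : m ≤ n + 1 := by
  have := hx.mono.id_le m
  rwa [hx.last] at this

theorem IsOnes.ext_eq_true (hx : IsOnes x m P) {i : ℕ} (hi : i ≤ m) : ext x (P i) = true :=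
  (hx.ext_iff _ (by rw [← hx.last]; exact hx.mono.monotone hi)).2 ⟨i, hi, rfl⟩

/-- The state of the scan just before the next retained one. -/
theorem scan_before (hx : IsOnes x m P) (hY : IsAccurate δ n D m M P Y) (hδ : δ < 1) (hD : 2 ≤ D)
    (hg : GapsClose δ D m P keep) (hM : M ≤ m) {i : ℕ} (hi : i ≤ M) (him : i < m)
    (h1 : ext keep (P i) = true) (hF : (srcScan D Y x keep (P i)).2 = i) :
    scan n D Y (trace x keep).length (traceBit (trace x keep)) (cnt keep (P (i + 1) - 1)) =
      (cnt keep (P i), i) := by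
  have hPi1 : P (i + 1) ≤ n + 1 := by
    rw [← hx.last]
    exact hx.mono.monotone him
  have hlt := hx.mono (by omega : i < i + 1)
  have hlt2 := hx.mono.monotone (by omega : i + 1 ≤ M + 1)
  rw [scan_cnt (by omega)]
  obtain ⟨r, r1, r2, r3, r4, r5, r6, r7⟩ := srcScan_spec hx hY hδ hD hg hM (P (i + 1) - 1)
    (by omega) (by omega)
  have hir : i ≤ r := by
    by_contra hc
    have := r4 i (by omega) (by omega)
    rw [h1] at this
    exact absurd this (by simp)
  have hri : r < i + 1 := by
    by_contra hc
    have := hx.mono.monotone (not_lt.1 hc)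
    omega
  obtain rfl : r = i := by omega
  refine Prod.ext r5 (le_antisymm r6 ?_)
  have h2 := scan_snd_mono (n := n) (D := D) (Y := Y) (len := (trace x keep).length)
    (bit := traceBit (trace x keep)) (cnt_mono (keep := keep) (by omega : P r ≤ P (r + 1) - 1))
  rw [scan_cnt (by omega), scan_cnt (by omega), hF] at h2
  exact h2

/-- At most one bit follows the assigned index `i`. -/
theorem eq_of_scan_eq {len : ℕ} {bit : ℕ → ℕ} {t t' i : ℕ} (hi : i ≤ n) (ht : bit (t + 1) ≠ 0)
    (ht' : bit (t' + 1) ≠ 0) (h : (scan n D Y len bit t).2 = i) (h' : (scan n D Y len bit t').2 = i) :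
    t = t' := by
  by_contra hne
  wlog hlt : t < t' generalizing t t'
  · exact this ht' ht h' h (Ne.symm hne) (by omega)
  have h1 := scan_snd_lt_succ (n := n) (D := D) (Y := Y) (len := len) ht (by omega)
  have h2 := scan_snd_mono (n := n) (D := D) (Y := Y) (len := len) (bit := bit) (by omega : t + 1 ≤ t')
  omega

/-- A trace reveals its two artificial end gaps, by the place 0 and the place after the last bit, so
the padding can be computed from the trace. -/
theorem padGap_eq_gapLen (hx : IsOnes x m P) {i : ℕ} (him : i < m) (h1 : ext keep (P i) = true)
    (h2 : ext keep (P (i + 1)) = true) :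
    padGap n (trace x keep).length (cnt keep (P i)) (cnt keep (P (i + 1) - 1) + 1) =
      gapLen m P keep i (i + 1) := by
  have hlt := hx.mono (by omega : i < i + 1)
  have hPi1 : P (i + 1) ≤ n + 1 := by
    rw [← hx.last]
    exact hx.mono.monotone him
  have hc : cnt keep (P (i + 1)) = cnt keep (P (i + 1) - 1) + 1 := by
    rw [← cnt_succ_of _ (by rwa [show P (i + 1) - 1 + 1 = P (i + 1) by omega])]
    congr 1; omega
  have e1 : cnt keep (P i) = 0 ↔ i = 0 := by
    constructor
    · intro h
      by_contra hr0
      have h3 := hx.mono (Nat.pos_of_ne_zero hr0)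
      rw [hx.zero] at h3
      have := cnt_lt (keep := keep) h3 h1
      omega
    · rintro rfl
      rw [hx.zero, cnt]
  have e2 : cnt keep (P (i + 1)) = cnt keep n + 1 ↔ i + 1 = m := by
    constructor
    · intro h
      by_contra hne
      have := hx.mono (by omega : i + 1 < m)
      rw [hx.last] at this
      have := cnt_mono (keep := keep) (by omega : P (i + 1) ≤ n)
      omega
    · rintro h
      rw [h, hx.last, cnt_succ_of _ (ext_of_lt (by omega))]
  rw [padGap, gapLen, ← hc, length_trace]
  simp only [e1, e2]

/-- When the picture reaches the index `i`, a trace that does not lag gives this index to the `i`-th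
one, and by strict monotonicity only one bit follows that assignment. -/
theorem coarseSample_eq (hx : IsOnes x m P) (hY : IsAccurate δ n D m M P Y) (hδ : δ < 1) (hD : 2 ≤ D)
    (hg : GapsClose δ D m P keep) {i : ℕ} (hMi : M = i) (him : i < m)
    (h1 : ext keep (P i) = true) (h2 : ext keep (P (i + 1)) = true)
    (h3 : ¬ Lags δ D m P keep i) :
    coarseSample n D Y (trace x keep) i = gapLen m P keep i (i + 1) := by
  have hlt := hx.mono (by omega : i < i + 1)
  have hm := hx.le_succ
  have hPi1 : P (i + 1) ≤ n + 1 := by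
    rw [← hx.last]
    exact hx.mono.monotone him
  have hs := scan_before hx hY hδ hD hg (by omega) (by omega) him h1
    ((srcScan_at hx hY hδ hD hg (by omega) (by omega) h1).2.2 h3)
  have hb : traceBit (trace x keep) (cnt keep (P (i + 1) - 1) + 1) ≠ 0 := by
    have hk : ext keep (P (i + 1) - 1 + 1) = true := by
      rwa [show P (i + 1) - 1 + 1 = P (i + 1) by omega]
    rw [← cnt_succ_of _ hk, traceBit_cnt (by omega) hk,
      show P (i + 1) - 1 + 1 = P (i + 1) by omega, hx.ext_eq_true him]
    simp
  rw [coarseSample, Finset.sum_eq_single (cnt keep (P (i + 1) - 1))]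
  · rw [if_pos ⟨hb, by rw [hs]⟩, hs]
    exact padGap_eq_gapLen hx him h1 h2
  · intro t _ hne
    rw [if_neg]
    rintro ⟨h4, h5⟩
    exact hne (eq_of_scan_eq (by omega) h4 hb h5 (by rw [hs]))
  · intro h
    have := cnt_le (keep := keep) (P (i + 1) - 1)
    rw [Finset.mem_range] at h
    omega

/-- The final one has an assigned index at most `m` and indices increase strictly, so with a
complete picture no bit follows an index `m` or larger. -/
theorem coarseSample_eq_zero (hx : IsOnes x m P) (hY : IsAccurate δ n D m m P Y) (hδ : δ < 1)
    (hD : 2 ≤ D) (hg : GapsClose δ D m P keep) {i : ℕ} (him : m ≤ i) :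
    coarseSample n D Y (trace x keep) i = 0 := by
  have hm := hx.le_succ
  refine Finset.sum_eq_zero fun t _ => ?_
  rw [if_neg]
  rintro ⟨h1, h2⟩
  have ht : t + 1 ≤ cnt keep (n + 1) := by
    rw [cnt_succ_of _ (ext_of_lt (by omega))]
    by_contra hc
    exact h1 (traceBit_of_gt (by omega))
  have h3 : (srcScan D Y x keep (n + 1)).2 ≤ m := by
    have := (srcScan_at hx hY hδ hD hg le_rfl le_rfl (by rw [hx.last]; exact ext_of_lt (by omega))).2.1
    rwa [hx.last] at this
  rw [← scan_cnt le_rfl] at h3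
  have h4 := scan_snd_mono (n := n) (D := D) (Y := Y) (len := (trace x keep).length)
    (bit := traceBit (trace x keep)) ht
  have h5 := scan_snd_mono (n := n) (D := D) (Y := Y) (len := (trace x keep).length)
    (bit := traceBit (trace x keep)) (by omega : t ≤ t + 1)
  have h6 := scan_snd_lt_succ (n := n) (D := D) (Y := Y) (len := (trace x keep).length) h1
    (by omega)
  omega

end sample

/-- A sample close to most of the samples. -/
def pickSample (n D : ℕ) (U : ℕ → ℕ) : ℕ :=
  let a := leastBelow n fun a =>
    n < 2 * ∑ b ∈ Finset.range n, if CloseTo (16 * D) (U b) (U a) then 1 else 0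
  if a < n then U a else 0

theorem pickSample_zero {n D : ℕ} : pickSample n D (fun _ => 0) = 0 := by
  simp [pickSample]

/-- Good samples are close to each other, so one of them passes the majority test. Whichever sample
passes is close to more than half of all samples, hence to a good one, because two majorities meet.
-/
theorem pickSample_close {n D : ℕ} {U : ℕ → ℕ} {G : ℝ} {S : Finset ℕ} (hD : 2 ≤ D)
    (hS : S ⊆ Finset.range n) (hcard : n < 2 * S.card) (hG : 0 < G)
    (hU : ∀ a ∈ S, (64 * D) * |(U a : ℝ) - G| ≤ G) :
    0 < pickSample n D U ∧ (4 * D) * |(pickSample n D U : ℝ) - G| ≤ G := by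
  have hD' : (2 : ℝ) ≤ D := by exact_mod_cast hD
  have hclose : ∀ a ∈ S, ∀ b ∈ S, CloseTo (16 * D) (U b) (U a) := by
    intro a ha b hb
    apply closeTo_of_abs_le
    have h1 := hU a ha
    have h2 := hU b hb
    have h3 : |(U b : ℝ) - U a| ≤ |(U b : ℝ) - G| + |(U a : ℝ) - G| := by
      rw [abs_sub_comm (U a : ℝ) G]; exact abs_sub_le _ _ _
    have h4 := neg_abs_le ((U a : ℝ) - G)
    have h5 := abs_nonneg ((U a : ℝ) - G)
    push_cast
    have h6 : (16 * D : ℝ) * |(U b : ℝ) - U a| ≤ 16 * D * (|(U b : ℝ) - G| + |(U a : ℝ) - G|) := by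
      gcongr
    nlinarith
  set p : ℕ → Prop := fun a =>
    n < 2 * ∑ b ∈ Finset.range n, if CloseTo (16 * D) (U b) (U a) then 1 else 0 with hp
  have hgood : ∀ a ∈ S, p a := by
    intro a ha
    have : S.card ≤ ∑ b ∈ Finset.range n, if CloseTo (16 * D) (U b) (U a) then 1 else 0 := by
      rw [← Finset.card_filter]
      refine Finset.card_le_card fun b hb => Finset.mem_filter.2 ⟨hS hb, hclose a ha b hb⟩
    simp only [hp]
    omega
  have hSne : S.Nonempty := by
    rw [← Finset.card_pos]; omega
  obtain ⟨a0, ha0⟩ := hSne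
  have hlt : leastBelow n p < n :=
    (leastBelow_le_of (hgood a0 ha0)).trans_lt (Finset.mem_range.1 (hS ha0))
  have hpa := leastBelow_prop hlt
  have heq : pickSample n D U = U (leastBelow n p) := by
    simp only [pickSample]
    exact if_pos hlt
  rw [heq]
  set a := leastBelow n p
  simp only [hp] at hpa
  rw [← Finset.card_filter] at hpa
  obtain ⟨b, hb1, hb2⟩ : ∃ b ∈ S, CloseTo (16 * D) (U b) (U a) := by
    by_contra! hc
    have hdisj : Disjoint S ((Finset.range n).filter fun b => CloseTo (16 * D) (U b) (U a)) := by
      rw [Finset.disjoint_left]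
      intro b h1 h2
      exact hc b h1 (Finset.mem_filter.1 h2).2
    have := Finset.card_le_card (Finset.union_subset hS
      (Finset.filter_subset (fun b => CloseTo (16 * D) (U b) (U a)) (Finset.range n)))
    rw [Finset.card_union_of_disjoint hdisj, Finset.card_range] at this
    omega
  have h1 := hb2.abs_le
  have h2 := hU b hb1
  push_cast at h1
  have h3 := neg_abs_le ((U b : ℝ) - G)
  have h3' := le_abs_self ((U b : ℝ) - G)
  have h4 := abs_nonneg ((U b : ℝ) - G)
  have h5 := neg_abs_le ((U b : ℝ) - U a)
  have h5' := le_abs_self ((U b : ℝ) - U a)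
  have h6 := abs_nonneg ((U b : ℝ) - U a)
  have hUa : (0 : ℝ) ≤ U a := by positivity
  have k1 : |(U b : ℝ) - U a| ≤ U a / 32 := by nlinarith
  have k2 : |(U b : ℝ) - G| ≤ G / 128 := by nlinarith
  have k3 : (U a : ℝ) ≤ 2 * G := by linarith
  have k4 : 0 < (U a : ℝ) := by linarith
  refine ⟨by exact_mod_cast k4, ?_⟩
  have k5 : |(U a : ℝ) - G| ≤ |(U b : ℝ) - U a| + |(U b : ℝ) - G| := by
    rw [abs_sub_comm (U b : ℝ) (U a : ℝ)]; exact abs_sub_le _ _ _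
  have k6 : (4 * D : ℝ) * |(U a : ℝ) - G| ≤ 4 * D * (|(U b : ℝ) - U a| + |(U b : ℝ) - G|) := by
    gcongr
  nlinarith

/-- The coarse picture after `i` stages, computed from the traces `ys a`, `a < n`. -/
def coarseY (n D : ℕ) (ys : ℕ → List Bool) : ℕ → ℕ → ℕ
  | 0 => fun _ => 0
  | i + 1 => fun k =>
    if k = i + 1 then
      (if pickSample n D (fun a => coarseSample n D (coarseY n D ys i) (ys a) i) = 0 then 0
        else coarseY n D ys i i + pickSample n D (fun a => coarseSample n D (coarseY n D ys i) (ys a) i))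
    else coarseY n D ys i k

theorem pickSample_congr {n D : ℕ} {U V : ℕ → ℕ} (h : ∀ a < n, U a = V a) :
    pickSample n D U = pickSample n D V := by
  have h1 : ∀ a < n, (n < 2 * ∑ b ∈ Finset.range n, if CloseTo (16 * D) (U b) (U a) then 1 else 0) ↔
      n < 2 * ∑ b ∈ Finset.range n, if CloseTo (16 * D) (V b) (V a) then 1 else 0 := by
    intro a ha
    rw [Finset.sum_congr rfl fun b hb => by rw [h b (Finset.mem_range.1 hb), h a ha]]
  have h2 : (leastBelow n fun a =>
      n < 2 * ∑ b ∈ Finset.range n, if CloseTo (16 * D) (U b) (U a) then 1 else 0) =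
      leastBelow n fun a =>
      n < 2 * ∑ b ∈ Finset.range n, if CloseTo (16 * D) (V b) (V a) then 1 else 0 := by
    unfold leastBelow
    refine Finset.sum_congr rfl fun k hk => ?_
    rw [Finset.mem_range] at hk
    have : (∃ j < k + 1, n < 2 * ∑ b ∈ Finset.range n, if CloseTo (16 * D) (U b) (U j) then 1 else 0) ↔
        ∃ j < k + 1, n < 2 * ∑ b ∈ Finset.range n, if CloseTo (16 * D) (V b) (V j) then 1 else 0 := by
      constructor
      · rintro ⟨j, hj, h⟩; exact ⟨j, hj, (h1 j (by omega)).1 h⟩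
      · rintro ⟨j, hj, h⟩; exact ⟨j, hj, (h1 j (by omega)).2 h⟩
    simp only [this]
  simp only [pickSample, h2]
  split_ifs with hlt
  · exact h _ hlt
  · rfl

/-- The picture depends on the first `n` traces only and is thus independent of the second batch. -/
theorem coarseY_congr {n D : ℕ} {ys zs : ℕ → List Bool} (h : ∀ a < n, ys a = zs a) (i : ℕ) :
    coarseY n D ys i = coarseY n D zs i := by
  induction i with
  | zero => rfl
  | succ i ih =>
    have : pickSample n D (fun a => coarseSample n D (coarseY n D ys i) (ys a) i) =
        pickSample n D (fun a => coarseSample n D (coarseY n D zs i) (zs a) i) :=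
      pickSample_congr fun a ha => by rw [ih, h a ha]
    funext k
    rw [coarseY, coarseY, this, ih]

open Classical in
/-- The coarse picture is accurate if most traces are good at each stage. -/
theorem coarseY_spec {n D m : ℕ} {δ : ℝ} {P : ℕ → ℕ} {x : Fin n → Bool} {keeps : ℕ → Fin n → Bool}
    (hx : IsOnes x m P) (hδ : δ < 1) (hD : 2 ≤ D)
    (hg : ∀ a < n, GapsClose δ D m P (keeps a))
    (hgood : ∀ i < m, n < 2 * ((Finset.range n).filter fun a => ext (keeps a) (P i) = true ∧
      ext (keeps a) (P (i + 1)) = true ∧ ¬ Lags δ D m P (keeps a) i).card) (i : ℕ) :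
    IsAccurate δ n D m (min i m) P (coarseY n D (fun a => trace x (keeps a)) i) ∧
      coarseY n D (fun a => trace x (keeps a)) i 0 = 0 ∧
      ∀ k, 1 ≤ k → k ≤ min i m → coarseY n D (fun a => trace x (keeps a)) i k ≠ 0 := by
  set Z := coarseY n D fun a => trace x (keeps a) with hZ
  induction i with
  | zero =>
    refine ⟨⟨?_, ?_⟩, by simp [hZ, coarseY], ?_⟩
    · intro s t h1 h2; omega
    · intro k _; simp [hZ, coarseY]
    · intro k h1 h2; omega
  | succ i ih =>
    obtain ⟨ih1, ih2, ih3⟩ := ih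
    rcases lt_or_ge i m with him | him
    · rw [min_eq_left him.le] at ih1 ih3
      rw [min_eq_left him]
      have hGpos := sub_pos.2 (linePos_strictMono hδ (n := n) (m := m) hx.mono (by omega : i < i + 1))
      obtain ⟨hv0, hv⟩ := pickSample_close (n := n) (D := D)
        (U := fun a => coarseSample n D (Z i) (trace x (keeps a)) i)
        (G := linePos δ n m P (i + 1) - linePos δ n m P i) hD (Finset.filter_subset _ _) (hgood i him)
        hGpos (by
          intro a ha
          rw [Finset.mem_filter, Finset.mem_range] at ha
          obtain ⟨ha, h1, h2, h3⟩ := ha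
          rw [coarseSample_eq hx ih1 hδ hD (hg a ha) rfl him h1 h2 h3]
          exact (hg a ha i (i + 1) (by omega) him).2)
      set v := pickSample n D fun a => coarseSample n D (Z i) (trace x (keeps a)) i with hvdef
      have hZs : ∀ k, Z (i + 1) k = if k = i + 1 then Z i i + v else Z i k := by
        intro k
        rw [hZ, coarseY, ← hZ, ← hvdef, if_neg hv0.ne']
      refine ⟨⟨?_, ?_⟩, ?_, ?_⟩
      · intro s t h1 h2
        rw [hZs s, if_neg (by omega), hZs t]
        split_ifs with ht
        · subst ht
          rcases (Nat.lt_succ_iff.1 h1).eq_or_lt with rfl | h3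
          · push_cast
            rw [add_sub_cancel_left]
            exact hv
          · have h4 := ih1.close s i h3 le_rfl
            push_cast
            have h5 : |(Z i i + v : ℝ) - Z i s - (linePos δ n m P (i + 1) - linePos δ n m P s)| ≤
                |(Z i i : ℝ) - Z i s - (linePos δ n m P i - linePos δ n m P s)| +
                |(v : ℝ) - (linePos δ n m P (i + 1) - linePos δ n m P i)| := by
              refine le_trans (le_of_eq ?_) (abs_add_le _ _)
              congr 1; ring
            have h6 : (4 * D : ℝ) *
              |(Z i i + v : ℝ) - Z i s - (linePos δ n m P (i + 1) - linePos δ n m P s)| ≤ 4 * D *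
                (|(Z i i : ℝ) - Z i s - (linePos δ n m P i - linePos δ n m P s)| +
                |(v : ℝ) - (linePos δ n m P (i + 1) - linePos δ n m P i)|) := by gcongr
            linarith
        · exact ih1.close s t h1 (by omega)
      · intro k hk
        rw [hZs k, if_neg (by omega)]
        exact ih1.zero k (by omega)
      · rw [hZs, if_neg (by omega)]
        exact ih2
      · intro k h1 h2
        rw [hZs]
        split_ifs with h
        · omega
        · exact ih3 k h1 (by omega)
    · rw [min_eq_right him] at ih1 ih3
      rw [min_eq_right (by omega)]
      -- After stage `m` nothing changes any more, so a number of stages that does not depend on the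
      -- unknown `m` may be run.
      have hv : pickSample n D (fun a => coarseSample n D (Z i) (trace x (keeps a)) i) = 0 := by
        rw [pickSample_congr (V := fun _ => 0) fun a ha =>
          coarseSample_eq_zero hx ih1 hδ hD (hg a ha) him]
        exact pickSample_zero
      have hZs : Z (i + 1) = Z i := by
        funext k
        rw [hZ, coarseY, ← hZ, hv, if_pos rfl]
        show (if k = i + 1 then 0 else Z i k) = Z i k
        split_ifs with h
        · rw [ih1.zero k (by omega)]
        · rfl
      rw [hZs]
      exact ⟨ih1, ih2, ih3⟩

/-! ### Reversal -/

section reversal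

variable {n : ℕ} {x keep : Fin n → Bool}

theorem ext_rev {p : ℕ} (hp : p ≤ n + 1) : ext (x ∘ Fin.rev) p = ext x (n + 1 - p) := by
  unfold ext
  split_ifs with h1 h2 h2
  · simp only [Function.comp]
    congr 1
    ext
    simp only [Fin.val_rev]
    omega
  · omega
  · omega
  · rfl

theorem cnt_rev {p : ℕ} (hp : p ≤ n) :
    cnt (keep ∘ Fin.rev) p + cnt keep (n - p) = cnt keep n := by
  induction p with
  | zero => simp [cnt]
  | succ p ih =>
    rw [← ih (by omega), cnt, ext_rev (by omega), show n + 1 - (p + 1) = n - p by omega,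
      show n - p = n - (p + 1) + 1 by omega, cnt]
    omega

theorem reverse_trace (x keep : Fin n → Bool) :
    (trace x keep).reverse = trace (x ∘ Fin.rev) (keep ∘ Fin.rev) := by
  rw [trace, trace, ← List.map_reverse, ← List.filter_reverse, List.finRange_reverse,
    List.filter_map, List.map_map]

/-- The places of the ones of the reversed string. -/
def revOnes (n m : ℕ) (P : ℕ → ℕ) (j : ℕ) : ℕ :=
  if j ≤ m then n + 1 - P (m - j) else n + 1 + (j - m)

theorem IsOnes.le_last {m : ℕ} {P : ℕ → ℕ} (hx : IsOnes x m P) {i : ℕ} (hi : i ≤ m) :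
    P i ≤ n + 1 := by
  rw [← hx.last]
  exact hx.mono.monotone hi

theorem IsOnes.rev {m : ℕ} {P : ℕ → ℕ} (hx : IsOnes x m P) :
    IsOnes (x ∘ Fin.rev) m (revOnes n m P) where
  zero := by simp [revOnes, hx.last]
  last := by simp [revOnes, hx.zero]
  mono := by
    intro i j hij
    unfold revOnes
    split_ifs with h1 h2
    · have h3 := hx.mono (by omega : m - j < m - i)
      have h4 := hx.le_last (by omega : m - i ≤ m)
      omega
    · omega
    · omega
    · omega
  ext_iff := by
    intro p hp
    rw [ext_rev hp, hx.ext_iff _ (by omega)]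
    constructor
    · rintro ⟨i, hi, h⟩
      refine ⟨m - i, by omega, ?_⟩
      rw [revOnes, if_pos (by omega), show m - (m - i) = i by omega]
      omega
    · rintro ⟨i, hi, h⟩
      refine ⟨m - i, by omega, ?_⟩
      rw [revOnes, if_pos hi] at h
      have := hx.le_last (by omega : m - i ≤ m)
      omega

theorem IsSeparated.rev {L : ℕ} (h : IsSeparated L x) : IsSeparated L (x ∘ Fin.rev) := by
  intro i j hij hi hj hk
  have := h j.rev i.rev (Fin.rev_lt_rev.2 hij) hj hi (by
    intro k h1 h2
    have := hk k.rev (by rw [← Fin.rev_lt_rev, Fin.rev_rev]; exact h2)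
      (by rw [← Fin.rev_lt_rev, Fin.rev_rev]; exact h1)
    simpa using this)
  simp only [Fin.val_rev] at this
  omega

theorem IsSeparated.le_sub {L m : ℕ} {P : ℕ → ℕ} (h : IsSeparated L x) (hx : IsOnes x m P)
    {r i : ℕ} (hr : 0 < r) (hri : r < i) (hi : i < m) : P r + 1 + L ≤ P i := by
  refine le_trans ?_ (hx.mono.monotone (by omega : r + 1 ≤ i))
  have h0 := hx.mono hr
  have h1 := hx.mono (by omega : r < r + 1)
  have h2 := hx.mono (by omega : r + 1 < m)
  rw [hx.last] at h2
  rw [hx.zero] at h0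
  have key : ∀ p, (hp : 1 ≤ p ∧ p ≤ n) → ext x p = x ⟨p - 1, by omega⟩ := by
    intro p hp
    rw [ext, dif_pos hp]
  have := h ⟨P r - 1, by omega⟩ ⟨P (r + 1) - 1, by omega⟩ (by simp only [Fin.mk_lt_mk]; omega)
    (by rw [← key _ (by omega)]; exact hx.ext_eq_true (by omega))
    (by rw [← key _ (by omega)]; exact hx.ext_eq_true (by omega)) (by
      rintro ⟨k, hk⟩ h3 h4
      simp only [Fin.mk_lt_mk] at h3 h4
      by_contra h5
      rw [Bool.not_eq_false, ← ext_succ (x := x) hk] at h5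
      obtain ⟨j, _, hj⟩ := (hx.ext_iff _ (by omega)).1 h5
      have h6 := hx.mono.lt_iff_lt.1 (by omega : P r < P j)
      have h7 := hx.mono.lt_iff_lt.1 (by omega : P j < P (r + 1))
      omega)
  simp only at this
  omega

/-- The number of retained positions in each long interval is close to its expectation. -/
def Concentrated (δ : ℝ) (D l : ℕ) (keep : Fin n → Bool) : Prop :=
  ∀ a b, a ≤ b → b ≤ n → (128 * D) * |((cnt keep b : ℝ) - cnt keep a) - (1 - δ) * ((b : ℝ) - a)| ≤
    max ((b : ℝ) - a) l

theorem Concentrated.rev {δ : ℝ} {D l : ℕ} (h : Concentrated δ D l keep) :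
    Concentrated δ D l (keep ∘ Fin.rev) := by
  intro a b hab hb
  have h1 := h (n - b) (n - a) (by omega) (by omega)
  have h2 : ((n - a : ℕ) : ℝ) - ((n - b : ℕ) : ℝ) = b - a := by
    rw [Nat.cast_sub (by omega), Nat.cast_sub hb]; ring
  have h3 : (cnt (keep ∘ Fin.rev) b : ℝ) - cnt (keep ∘ Fin.rev) a =
      cnt keep (n - a) - cnt keep (n - b) := by
    have e1 : (cnt (keep ∘ Fin.rev) a : ℝ) + cnt keep (n - a) = cnt keep n := by
      exact_mod_cast cnt_rev (keep := keep) (by omega : a ≤ n)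
    have e2 : (cnt (keep ∘ Fin.rev) b : ℝ) + cnt keep (n - b) = cnt keep n := by
      exact_mod_cast cnt_rev (keep := keep) hb
    linarith
  rw [h3, ← h2]
  exact h1

/-- Between two proper ones separation makes the interval longer than `l`, so the deviation is
relative to its length. Gaps touching an artificial one may be short, and there the padding `n`
dominates every deviation. -/
theorem Concentrated.gapsClose {δ : ℝ} {D L l m : ℕ} {P : ℕ → ℕ} (h : Concentrated δ D l keep)
    (hx : IsOnes x m P) (hsep : IsSeparated L x) (hδ0 : 0 ≤ δ) (hδ : δ ≤ 1 / 2) (hD : 2 ≤ D)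
    (hl : l ≤ L) (hln : l ≤ n) (hDn : 128 * D ≤ n) : GapsClose δ D m P keep := by
  intro r i hri hi
  have hD' : (2 : ℝ) ≤ D := by exact_mod_cast hD
  have hDn' : (128 * D : ℝ) ≤ n := by exact_mod_cast hDn
  have hln' : (l : ℝ) ≤ n := by exact_mod_cast hln
  have hpos := sub_pos.2 (linePos_strictMono (by linarith : δ < 1) (n := n) (m := m) hx.mono hri)
  have hP := hx.mono hri
  have hcm : cnt keep (P r) ≤ cnt keep (P i) := cnt_mono hP.le
  have key : (64 * D) * |(gapLen m P keep r i : ℝ) - (linePos δ n m P i - linePos δ n m P r)| ≤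
      linePos δ n m P i - linePos δ n m P r := by
    have e : (gapLen m P keep r i : ℝ) - (linePos δ n m P i - linePos δ n m P r) =
        ((cnt keep (P i) : ℝ) - cnt keep (P r)) - (1 - δ) * ((P i : ℝ) - P r) := by
      rw [gapLen, linePos, linePos, if_neg (by omega : i ≠ 0), if_neg (by omega : ¬ m ≤ r)]
      push_cast [Nat.cast_sub hcm]
      simp only [show i = m ↔ m ≤ i by omega]
      split_ifs <;> ring
    rw [e]
    have hPr : (P r : ℝ) ≤ P i := by exact_mod_cast hP.le
    have hG : linePos δ n m P i - linePos δ n m P r =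
        (1 - δ) * ((P i : ℝ) - P r) + (if r = 0 then (n : ℝ) else 0) + (if m ≤ i then (n : ℝ) else 0) := by
      rw [linePos, linePos, if_neg (by omega : i ≠ 0), if_neg (by omega : ¬ m ≤ r)]
      split_ifs <;> ring
    have hprod : ((P i : ℝ) - P r) / 2 ≤ (1 - δ) * ((P i : ℝ) - P r) := by nlinarith
    rcases hi.lt_or_eq with him | rfl
    · have hPin : P i ≤ n := by
        have := hx.mono him
        rw [hx.last] at this
        omega
      have h1 := h (P r) (P i) hP.le hPin
      have hPin' : (P i : ℝ) ≤ n := by exact_mod_cast hPin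
      have hPr0 : (0 : ℝ) ≤ P r := by positivity
      rw [hG, if_neg (by omega : ¬ m ≤ i)]
      rcases Nat.eq_zero_or_pos r with rfl | hr
      · rw [if_pos rfl]
        have : max ((P i : ℝ) - P 0) l ≤ n := max_le (by linarith) hln'
        nlinarith
      · rw [if_neg (by omega)]
        have h2 : (P r : ℝ) + 1 + L ≤ P i := by exact_mod_cast hsep.le_sub hx hr hri him
        have h3 : (l : ℝ) ≤ L := by exact_mod_cast hl
        rw [max_eq_left (by linarith)] at h1
        nlinarith
    · rw [hG, if_pos le_rfl, hx.last]
      have hPr1 : P r ≤ n := by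
        rw [hx.last] at hP; omega
      have h1 := h (P r) n hPr1 le_rfl
      have hPr1' : (P r : ℝ) ≤ n := by exact_mod_cast hPr1
      have hPr0 : (0 : ℝ) ≤ P r := by positivity
      have h2 : max ((n : ℝ) - P r) l ≤ n := max_le (by linarith) hln'
      -- The appended one is always retained, whereas `linePos` counts it with weight 1 - δ. The
      -- discrepancy of at most 1 is absorbed by `128 * D ≤ n`.
      rw [cnt_succ_of _ (ext_of_lt (by omega))]
      set a := ((cnt keep n : ℝ) - cnt keep (P r)) - (1 - δ) * ((n : ℝ) - P r)
      have h3 : |((cnt keep n + 1 : ℕ) : ℝ) - cnt keep (P r) - (1 - δ) * (((n + 1 : ℕ) : ℝ) - P r)| ≤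
          |a| + 1 := by
        have : ((cnt keep n + 1 : ℕ) : ℝ) - cnt keep (P r) - (1 - δ) * (((n + 1 : ℕ) : ℝ) - P r) =
            a + δ := by
          simp only [a]; push_cast; ring
        rw [this]
        refine (abs_add_le _ _).trans ?_
        rw [abs_of_nonneg hδ0]
        linarith
      have h4 : (0 : ℝ) ≤ if r = 0 then (n : ℝ) else 0 := by split_ifs <;> positivity
      have h5 : (0 : ℝ) ≤ (1 - δ) * (((n + 1 : ℕ) : ℝ) - P r) := by
        push_cast
        apply mul_nonneg <;> linarith
      nlinarith
  refine ⟨?_, key⟩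
  set G := linePos δ n m P i - linePos δ n m P r
  have h1 := neg_abs_le ((gapLen m P keep r i : ℝ) - G)
  have h2 := abs_nonneg ((gapLen m P keep r i : ℝ) - G)
  have : (0 : ℝ) < gapLen m P keep r i := by nlinarith
  exact_mod_cast this

end reversal

/-! ### Exact recovery of a gap -/

/-- The ones of a trace at places `≤ t` and `t + 1` are recognized as the `i`-th and the `i + 1`-st
one. -/
def IsRecognized (n D m : ℕ) (Y Y' : ℕ → ℕ) (y : List Bool) (i t : ℕ) : Prop :=
  traceBit y (t + 1) ≠ 0 ∧ (scan n D Y y.length (traceBit y) t).2 = i ∧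
    (scan n D Y' y.length (traceBit y.reverse) (y.length - t)).2 + (i + 1) = m

instance (n D m : ℕ) (Y Y' : ℕ → ℕ) (y : List Bool) (i t : ℕ) :
    Decidable (IsRecognized n D m Y Y' y i t) := by unfold IsRecognized; infer_instance

/-- The number of times that the `i`-th gap is recognized. -/
def gapCount (n D m : ℕ) (Y Y' : ℕ → ℕ) (y : List Bool) (i : ℕ) : ℕ :=
  ∑ t ∈ Finset.range (n + 2), if IsRecognized n D m Y Y' y i t then 1 else 0

/-- The number of zeros in the recognized `i`-th gap. -/
def gapZeros (n D m : ℕ) (Y Y' : ℕ → ℕ) (y : List Bool) (i : ℕ) : ℕ :=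
  ∑ t ∈ Finset.range (n + 2), if IsRecognized n D m Y Y' y i t then
    t - (scan n D Y y.length (traceBit y) t).1 else 0

/-- The `i`-th gap will be recognized; this does not depend on what is retained in the gap. -/
def GapVisible {n : ℕ} (D m : ℕ) (P Y Y' : ℕ → ℕ) (x keep : Fin n → Bool) (i : ℕ) : Prop :=
  ext keep (P i) = true ∧ ext keep (P (i + 1)) = true ∧ (srcScan D Y x keep (P i)).2 = i ∧
    (srcScan D Y' (x ∘ Fin.rev) (keep ∘ Fin.rev) (n + 1 - P (i + 1))).2 + (i + 1) = m

instance {n : ℕ} (D m : ℕ) (P Y Y' : ℕ → ℕ) (x keep : Fin n → Bool) (i : ℕ) :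
    Decidable (GapVisible D m P Y Y' x keep i) := by unfold GapVisible; infer_instance

/-- The scan from the left reads nothing beyond `P i`, and the reversed scan nothing before `P (i +
1)`. -/
theorem GapVisible.congr {n D m : ℕ} {P Y Y' : ℕ → ℕ} {x keep keep' : Fin n → Bool} {i : ℕ}
    (hP : P (i + 1) ≤ n + 1)
    (h : ∀ q, q ≤ P i ∨ P (i + 1) ≤ q → ext keep q = ext keep' q) :
    GapVisible D m P Y Y' x keep i ↔ GapVisible D m P Y Y' x keep' i := by
  unfold GapVisible
  rw [h _ (Or.inl le_rfl), h _ (Or.inr le_rfl), srcScan_congr fun q _ hq => h q (Or.inl hq),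
    srcScan_congr (keep := keep ∘ Fin.rev) (keep' := keep' ∘ Fin.rev)]
  intro q _ hq
  rw [ext_rev (by omega), ext_rev (by omega)]
  exact h _ (Or.inr (by omega))

theorem srcScan_eq_of_forall {n D : ℕ} {Y : ℕ → ℕ} {x keep : Fin n → Bool} {p q : ℕ} (hpq : p ≤ q)
    (h : ∀ s, p < s → s ≤ q → ext x s = false) : srcScan D Y x keep q = srcScan D Y x keep p := by
  induction q, hpq using Nat.le_induction with
  | base => rfl
  | succ q hq ih =>
    rw [srcScan, if_neg, ih fun s h1 h2 => h s h1 (by omega)]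
    rw [h (q + 1) (by omega) le_rfl]
    simp

section recognized

variable {n D m : ℕ} {δ : ℝ} {P Y Y' : ℕ → ℕ} {x keep : Fin n → Bool}

theorem IsOnes.ext_eq_false (hx : IsOnes x m P) {i s : ℕ} (him : i < m) (h1 : P i < s)
    (h2 : s < P (i + 1)) : ext x s = false := by
  by_contra h
  rw [Bool.not_eq_false] at h
  have := hx.le_last (by omega : i + 1 ≤ m)
  obtain ⟨j, _, hj⟩ := (hx.ext_iff _ (by omega)).1 h
  have h6 := hx.mono.lt_iff_lt.1 (by omega : P i < P j)
  have h7 := hx.mono.lt_iff_lt.1 (by omega : P j < P (i + 1))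
  omega

/-- Neither scan overestimates. If the bit is the `j`-th one and the preceding retained one is the
`r`-th, then `i ≤ r < j` from the left and `j ≤ i + 1` from the right. So `r = i` and `j = i + 1`,
and recognition is never wrong. -/
theorem isRecognized_iff (hx : IsOnes x m P) (hY : IsAccurate δ n D m m P Y)
    (hY' : IsAccurate δ n D m m (revOnes n m P) Y') (hδ : δ < 1) (hD : 2 ≤ D)
    (hg : GapsClose δ D m P keep) (hg' : GapsClose δ D m (revOnes n m P) (keep ∘ Fin.rev))
    {i t : ℕ} (him : i + 1 < m) :
    IsRecognized n D m Y Y' (trace x keep) i t ↔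
      GapVisible D m P Y Y' x keep i ∧ t = cnt keep (P (i + 1) - 1) := by
  have hm := hx.le_succ
  have hscan : srcScan D Y x keep (P (i + 1) - 1) = srcScan D Y x keep (P i) := by
    have := hx.mono (by omega : i < i + 1)
    exact srcScan_eq_of_forall (by omega) fun s h1 h2 => hx.ext_eq_false (by omega) h1 (by omega)
  have hlen' : (trace (x ∘ Fin.rev) (keep ∘ Fin.rev)).length = (trace x keep).length := by
    rw [← reverse_trace, List.length_reverse]
  have hrev : ∀ q ≤ n, (trace x keep).length - cnt keep q = cnt (keep ∘ Fin.rev) (n - q) := by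
    intro q hq
    have := cnt_rev (keep := keep) (by omega : n - q ≤ n)
    rw [show n - (n - q) = q by omega] at this
    rw [length_trace]
    omega
  have hscan' : ∀ q ≤ n, scan n D Y' (trace x keep).length (traceBit (trace x keep).reverse)
      ((trace x keep).length - cnt keep q) = srcScan D Y' (x ∘ Fin.rev) (keep ∘ Fin.rev) (n - q) := by
    intro q hq
    rw [hrev q hq, reverse_trace, ← hlen', scan_cnt (by omega)]
  constructor
  · rintro ⟨h1, h2, h3⟩
    have ht : t + 1 ≤ cnt keep (n + 1) := by
      rw [cnt_succ_of _ (ext_of_lt (by omega))]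
      by_contra hc
      exact h1 (traceBit_of_gt (by omega))
    obtain ⟨q, hq, hq1, hq2⟩ := exists_cnt_eq (by omega) ht
    have hq3 : cnt keep q = t := by rw [cnt_succ_of _ hq1] at hq2; omega
    rw [← hq2, traceBit_cnt (by omega) hq1] at h1
    have hxq : ext x (q + 1) = true := by
      by_contra hc
      rw [Bool.not_eq_true] at hc
      simp [hc] at h1
    obtain ⟨j, hj, hPj⟩ := (hx.ext_iff _ (by omega)).1 hxq
    rw [← hq3, scan_cnt (by omega)] at h2
    rw [← hq3, hscan' q (by omega)] at h3
    have hmm := hx.mono (by omega : m < m + 1)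
    obtain ⟨r, r1, r2, r3, r4, r5, r6, r7⟩ := srcScan_spec hx hY hδ hD hg le_rfl q (by omega)
      (by rw [hx.last] at hmm; omega)
    have hrj : r < j := hx.mono.lt_iff_lt.1 (by omega)
    have hrevj : revOnes n m P (m - j) = n - q := by
      rw [revOnes, if_pos (by omega), show m - (m - j) = j by omega]
      omega
    have h4 := (srcScan_at hx.rev hY' hδ hD hg' le_rfl (by omega : m - j ≤ m) (by
      rw [hrevj, ext_rev (by omega), show n + 1 - (n - q) = q + 1 by omega, hq1])).2.1
    rw [hrevj] at h4
    obtain rfl : j = i + 1 := by omega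
    obtain rfl : r = i := by omega
    have hq4 : q = P (r + 1) - 1 := by omega
    rw [hq4, hscan] at h2
    refine ⟨⟨r3, by rwa [hPj], h2, ?_⟩, by rw [← hq4, hq3]⟩
    rwa [hPj, show n + 1 - (q + 1) = n - q by omega]
  · rintro ⟨⟨h1, h2, h3, h4⟩, rfl⟩
    have hlt := hx.mono (by omega : i < i + 1)
    have hle := hx.le_last (by omega : i + 1 ≤ m)
    have hk : ext keep (P (i + 1) - 1 + 1) = true := by
      rwa [show P (i + 1) - 1 + 1 = P (i + 1) by omega]
    refine ⟨?_, ?_, ?_⟩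
    · rw [← cnt_succ_of _ hk, traceBit_cnt (by omega) hk,
        show P (i + 1) - 1 + 1 = P (i + 1) by omega, hx.ext_eq_true him.le]
      simp
    · rw [scan_cnt (by omega), hscan, h3]
    · rw [hscan' _ (by omega), show n - (P (i + 1) - 1) = n + 1 - P (i + 1) by omega]
      exact h4

theorem gap_eq (hx : IsOnes x m P) (hY : IsAccurate δ n D m m P Y)
    (hY' : IsAccurate δ n D m m (revOnes n m P) Y') (hδ : δ < 1) (hD : 2 ≤ D)
    (hg : GapsClose δ D m P keep) (hg' : GapsClose δ D m (revOnes n m P) (keep ∘ Fin.rev))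
    {i : ℕ} (him : i + 1 < m) :
    gapCount n D m Y Y' (trace x keep) i = (if GapVisible D m P Y Y' x keep i then 1 else 0) ∧
    gapZeros n D m Y Y' (trace x keep) i = (if GapVisible D m P Y Y' x keep i then
      cnt keep (P (i + 1) - 1) - cnt keep (P i) else 0) := by
  have hle := hx.le_last (by omega : i + 1 ≤ m)
  have hlt := hx.mono (by omega : i < i + 1)
  have hmem : cnt keep (P (i + 1) - 1) ∈ Finset.range (n + 2) := by
    have := cnt_le (keep := keep) (P (i + 1) - 1)
    rw [Finset.mem_range]
    omega
  unfold gapCount gapZeros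
  simp only [isRecognized_iff hx hY hY' hδ hD hg hg' him]
  by_cases h : GapVisible D m P Y Y' x keep i
  · simp only [h, true_and, if_true]
    rw [Finset.sum_ite_eq' , Finset.sum_ite_eq', if_pos hmem, if_pos hmem, scan_cnt (by omega),
      srcScan_eq_of_forall (p := P i) (by omega) fun s h1 h2 =>
        hx.ext_eq_false (by omega) h1 (by omega), (srcScan_at hx hY hδ hD hg le_rfl (by omega) h.1).1]
    exact ⟨rfl, rfl⟩
  · simp [h]

theorem gapVisible_of (hx : IsOnes x m P) (hY : IsAccurate δ n D m m P Y)
    (hY' : IsAccurate δ n D m m (revOnes n m P) Y') (hδ : δ < 1) (hD : 2 ≤ D)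
    (hg : GapsClose δ D m P keep) (hg' : GapsClose δ D m (revOnes n m P) (keep ∘ Fin.rev))
    {i : ℕ} (him : i + 1 < m) (h1 : ext keep (P i) = true) (h2 : ext keep (P (i + 1)) = true)
    (h3 : ¬ Lags δ D m P keep i)
    (h4 : ¬ Lags δ D m (revOnes n m P) (keep ∘ Fin.rev) (m - (i + 1))) :
    GapVisible D m P Y Y' x keep i := by
  have hle := hx.le_last (by omega : i + 1 ≤ m)
  have hr : revOnes n m P (m - (i + 1)) = n + 1 - P (i + 1) := by
    rw [revOnes, if_pos (by omega), show m - (m - (i + 1)) = i + 1 by omega]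
  refine ⟨h1, h2, (srcScan_at hx hY hδ hD hg le_rfl (by omega) h1).2.2 h3, ?_⟩
  have := (srcScan_at hx.rev hY' hδ hD hg' le_rfl (by omega : m - (i + 1) ≤ m) (by
    rw [hr, ext_rev (by omega), show n + 1 - (n + 1 - P (i + 1)) = P (i + 1) by omega, h2])).2.2 h4
  rw [hr] at this
  omega

end recognized

/-! ### The reconstructed string -/

/-- The ratio `S / M`, times `n T / W`, rounded to the nearest integer. -/
def roundRatio (n S M W T : ℕ) : ℕ :=
  leastBelow (n + 2) fun z => 2 * (S * (T * n)) ≤ (2 * z + 1) * (M * W)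

/-- The unknown factor 1 - δ cancels between `S / M` and `W / (n T)`. The error of `S T n - z M W`
is at most n T² / 5, while `M W` is at least 0.712 n T²; the quotient is thus within 1/2 of `z`. -/
theorem roundRatio_eq {n S M W T z : ℕ} {δ : ℝ} (hn : 1 ≤ n) (hz : z ≤ n) (hT : 1 ≤ T)
    (hδ : δ ≤ 1 / 100) (hM : 4 / 5 * (T : ℝ) ≤ M) (hMT : M ≤ T)
    (hS : |(S : ℝ) - (1 - δ) * z * M| ≤ T / 10) (hW : |(W : ℝ) - (1 - δ) * n * T| ≤ T / 10) :
    roundRatio n S M W T = z := by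
  have hn' : (1 : ℝ) ≤ n := by exact_mod_cast hn
  have hz' : (z : ℝ) ≤ n := by exact_mod_cast hz
  have hT' : (1 : ℝ) ≤ T := by exact_mod_cast hT
  have hMT' : (M : ℝ) ≤ T := by exact_mod_cast hMT
  have hM0 : (0 : ℝ) ≤ M := by positivity
  obtain ⟨s1, s2⟩ := abs_le.1 hS
  obtain ⟨w1, w2⟩ := abs_le.1 hW
  have hnT : (0 : ℝ) < n * T := by positivity
  have hTn : (T : ℝ) ≤ n * T := by nlinarith
  have hWlow : 89 / 100 * (n * T : ℝ) ≤ W := by nlinarith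
  have hMW : 712 / 1000 * (n * T * T : ℝ) ≤ M * W := by
    calc 712 / 1000 * (n * T * T : ℝ) = 4 / 5 * (T : ℝ) * (89 / 100 * (n * T : ℝ)) := by ring
      _ ≤ M * W := by gcongr
  have hzM : (z : ℝ) * M ≤ n * T := by gcongr
  have hzM0 : (0 : ℝ) ≤ z * M := by positivity
  have hid : (S : ℝ) * (T * n) - z * (M * W) =
      n * T * ((S : ℝ) - (1 - δ) * z * M) - z * M * ((W : ℝ) - (1 - δ) * n * T) := by ring
  have hup : (S : ℝ) * (T * n) - z * (M * W) ≤ 1 / 5 * (n * T * T) := by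
    rw [hid]
    have a1 : (n * T : ℝ) * ((S : ℝ) - (1 - δ) * z * M) ≤ n * T * (T / 10) := by gcongr
    have a2 : z * M * (-(T / 10) : ℝ) ≤ z * M * ((W : ℝ) - (1 - δ) * n * T) := by gcongr
    have a3 : z * M * (T / 10 : ℝ) ≤ n * T * (T / 10) := by gcongr
    nlinarith
  have hlow : -(1 / 5 * (n * T * T)) ≤ (S : ℝ) * (T * n) - z * (M * W) := by
    rw [hid]
    have a1 : (n * T : ℝ) * (-(T / 10)) ≤ n * T * ((S : ℝ) - (1 - δ) * z * M) := by gcongr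
    have a2 : z * M * ((W : ℝ) - (1 - δ) * n * T) ≤ z * M * (T / 10 : ℝ) := by gcongr
    have a3 : z * M * (T / 10 : ℝ) ≤ n * T * (T / 10) := by gcongr
    nlinarith
  have hpos : (0 : ℝ) < n * T * T := by positivity
  refine leastBelow_eq (by omega) ?_ ?_
  · have : (2 * ((S : ℝ) * (T * n))) ≤ (2 * z + 1) * (M * W) := by linarith
    exact_mod_cast this
  · intro i hi hc
    have hc' : (2 * ((S : ℝ) * (T * n))) ≤ (2 * i + 1) * (M * W) := by exact_mod_cast hc
    have hi' : (i : ℝ) + 1 ≤ z := by exact_mod_cast hi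
    have hMW0 : (0 : ℝ) ≤ M * W := by positivity
    nlinarith

/-- The scale of the relative errors. -/
def errScale (n N : ℕ) : ℕ :=
  (∑ j ∈ Finset.range N, if (j + 1) * n ≤ N then 1 else 0) * ∑ j ∈ Finset.range N, if (j + 1) * n ≤ N then 1 else 0

/-- Counting the multiples of `n` up to `N` replaces division, which the language does not have. -/
theorem errScale_eq {n : ℕ} (hn : 1 ≤ n) (N : ℕ) : errScale n N = (N / n) * (N / n) := by
  have : ∑ j ∈ Finset.range N, (if (j + 1) * n ≤ N then 1 else 0) = N / n := by
    rw [← Finset.card_filter]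
    have : (Finset.range N).filter (fun j => (j + 1) * n ≤ N) = Finset.range (N / n) := by
      ext j
      simp only [Finset.mem_filter, Finset.mem_range, ← Nat.le_div_iff_mul_le hn]
      have := Nat.div_le_self N n
      omega
    rw [this, Finset.card_range]
  rw [errScale, this]

/-- The number of added and proper ones, the first excluded. -/
def numOnes (n : ℕ) (Y : ℕ → ℕ) : ℕ := ∑ k ∈ Finset.range (n + 2), if Y k = 0 then 0 else 1

/-- The estimated number of zeros before the `i + 1`-st one. -/
def gapEstimate (n N : ℕ) (Y Y' : ℕ → ℕ) (ys : ℕ → List Bool) (i : ℕ) : ℕ :=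
  roundRatio n
    (∑ a ∈ Finset.range N, if n ≤ a then gapZeros n (errScale n N) (numOnes n Y) Y Y' (ys a) i else 0)
    (∑ a ∈ Finset.range N, if n ≤ a then gapCount n (errScale n N) (numOnes n Y) Y Y' (ys a) i else 0)
    (∑ a ∈ Finset.range N, if n ≤ a then (ys a).length else 0) (N - n)

/-- The estimated place of the `i`-th one. -/
def placeEstimate (n N : ℕ) (Y Y' : ℕ → ℕ) (ys : ℕ → List Bool) : ℕ → ℕ
  | 0 => 0
  | i + 1 => placeEstimate n N Y Y' ys i + gapEstimate n N Y Y' ys i + 1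

/-- The reconstructed bits. -/
def reconstruct (n N : ℕ) (ys : ℕ → List Bool) (t : ℕ) : ℕ :=
  if ∃ i < numOnes n (coarseY n (errScale n N) ys (n + 2)), i ≠ 0 ∧
    placeEstimate n N (coarseY n (errScale n N) ys (n + 2))
      (coarseY n (errScale n N) (fun a => (ys a).reverse) (n + 2)) ys i = t + 1 then 1 else 0

section reconstruct

variable {n N m : ℕ} {δ : ℝ} {P Y Y' : ℕ → ℕ} {x : Fin n → Bool} {keeps : ℕ → Fin n → Bool}

theorem numOnes_eq {n m : ℕ} {Y : ℕ → ℕ} (hm : m ≤ n + 1) (h0 : Y 0 = 0)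
    (h1 : ∀ k, 1 ≤ k → k ≤ m → Y k ≠ 0) (h2 : ∀ k, m < k → Y k = 0) : numOnes n Y = m := by
  have : numOnes n Y = ((Finset.range (n + 2)).filter fun k => Y k ≠ 0).card := by
    rw [Finset.card_filter]
    refine Finset.sum_congr rfl fun k _ => ?_
    by_cases h : Y k = 0 <;> simp [h]
  rw [this]
  have : (Finset.range (n + 2)).filter (fun k => Y k ≠ 0) = Finset.Icc 1 m := by
    ext k
    simp only [Finset.mem_filter, Finset.mem_range, Finset.mem_Icc]
    constructor
    · rintro ⟨_, h⟩
      constructor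
      · by_contra hc
        rw [show k = 0 by omega] at h
        exact h h0
      · by_contra hc
        exact h (h2 k (by omega))
    · rintro ⟨h3, h4⟩
      exact ⟨by omega, h1 k h3 h4⟩
  rw [this, Nat.card_Icc]
  omega

/-- The number of visible `i`-th gaps. -/
def visibleCount (n N D m : ℕ) (P Y Y' : ℕ → ℕ) (x : Fin n → Bool) (keeps : ℕ → Fin n → Bool)
    (i : ℕ) : ℕ :=
  ((Finset.Ico n N).filter fun a => GapVisible D m P Y Y' x (keeps a) i).card

theorem sum_range_if_le {M : Type*} [AddCommMonoid M] (n N : ℕ) (f : ℕ → M) :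
    ∑ a ∈ Finset.range N, (if n ≤ a then f a else 0) = ∑ a ∈ Finset.Ico n N, f a := by
  rw [← Finset.sum_filter]
  congr 1
  ext a
  simp only [Finset.mem_filter, Finset.mem_range, Finset.mem_Ico]
  omega

theorem gapEstimate_eq (hx : IsOnes x m P) (hnum : numOnes n Y = m) (hn : 1 ≤ n) (hN : n < N)
    (hY : IsAccurate δ n (errScale n N) m m P Y)
    (hY' : IsAccurate δ n (errScale n N) m m (revOnes n m P) Y') (hδ : δ ≤ 1 / 100)
    (hD : 2 ≤ errScale n N) (hg : ∀ a < N, GapsClose δ (errScale n N) m P (keeps a))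
    (hg' : ∀ a < N, GapsClose δ (errScale n N) m (revOnes n m P) (keeps a ∘ Fin.rev))
    {i : ℕ} (him : i + 1 < m)
    (hvis : 4 / 5 * ((N - n : ℕ) : ℝ) ≤ visibleCount n N (errScale n N) m P Y Y' x keeps i)
    (hzeros : |∑ a ∈ Finset.Ico n N, (if GapVisible (errScale n N) m P Y Y' x (keeps a) i then
      ((cnt (keeps a) (P (i + 1) - 1) : ℝ) - cnt (keeps a) (P i)) -
        (1 - δ) * ((P (i + 1) - 1 - P i : ℕ) : ℝ) else 0)| ≤ ((N - n : ℕ) : ℝ) / 10)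
    (hlen : |∑ a ∈ Finset.Ico n N, ((cnt (keeps a) n : ℝ) - (1 - δ) * n)| ≤ ((N - n : ℕ) : ℝ) / 10) :
    gapEstimate n N Y Y' (fun a => trace x (keeps a)) i = P (i + 1) - 1 - P i := by
  have hle := hx.le_last (by omega : i + 1 ≤ m)
  have hlt := hx.mono (by omega : i < i + 1)
  rw [gapEstimate, hnum, sum_range_if_le, sum_range_if_le, sum_range_if_le]
  set D := errScale n N
  have hcount : ∑ a ∈ Finset.Ico n N, gapCount n D m Y Y' (trace x (keeps a)) i =
      visibleCount n N D m P Y Y' x keeps i := by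
    rw [visibleCount, Finset.card_filter]
    refine Finset.sum_congr rfl fun a ha => ?_
    rw [Finset.mem_Ico] at ha
    exact (gap_eq hx hY hY' (by linarith) hD (hg a ha.2) (hg' a ha.2) him).1
  have hS : ((∑ a ∈ Finset.Ico n N, gapZeros n D m Y Y' (trace x (keeps a)) i : ℕ) : ℝ) =
      ∑ a ∈ Finset.Ico n N, if GapVisible D m P Y Y' x (keeps a) i then
        (cnt (keeps a) (P (i + 1) - 1) : ℝ) - cnt (keeps a) (P i) else 0 := by
    push_cast
    refine Finset.sum_congr rfl fun a ha => ?_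
    rw [Finset.mem_Ico] at ha
    rw [(gap_eq hx hY hY' (by linarith) hD (hg a ha.2) (hg' a ha.2) him).2]
    split_ifs
    · rw [Nat.cast_sub (cnt_mono (by omega))]
    · simp
  rw [hcount]
  refine roundRatio_eq (δ := δ) hn (by omega) (by omega) hδ hvis ?_ ?_ ?_
  · refine (Finset.card_filter_le _ _).trans (by simp)
  · rw [hS]
    convert hzeros using 2
    rw [visibleCount, Finset.card_filter]
    push_cast
    rw [Finset.mul_sum, ← Finset.sum_sub_distrib]
    refine Finset.sum_congr rfl fun a _ => ?_
    split_ifs <;> ring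
  · convert hlen using 2
    rw [Finset.sum_sub_distrib, Finset.sum_const, Nat.card_Ico]
    simp only [length_trace, nsmul_eq_mul]
    push_cast
    ring

theorem reconstruct_eq (hx : IsOnes x m P)
    (hnum : numOnes n (coarseY n (errScale n N) (fun a => trace x (keeps a)) (n + 2)) = m)
    (hgap : ∀ i, i + 1 < m → gapEstimate n N
      (coarseY n (errScale n N) (fun a => trace x (keeps a)) (n + 2))
      (coarseY n (errScale n N) (fun a => (trace x (keeps a)).reverse) (n + 2))
      (fun a => trace x (keeps a)) i = P (i + 1) - 1 - P i) (t : Fin n) :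
    reconstruct n N (fun a => trace x (keeps a)) t = (x t).toNat := by
  -- Only proper ones are placed; the gap before the appended final one is never estimated.
  have hplace : ∀ i < m, placeEstimate n N
      (coarseY n (errScale n N) (fun a => trace x (keeps a)) (n + 2))
      (coarseY n (errScale n N) (fun a => (trace x (keeps a)).reverse) (n + 2))
      (fun a => trace x (keeps a)) i = P i := by
    intro i
    induction i with
    | zero => intro _; rw [placeEstimate, hx.zero]
    | succ i ih =>
      intro hi
      have := hx.mono (by omega : i < i + 1)
      rw [placeEstimate, ih (by omega), hgap i hi]
      omega
  have key : (∃ i < m, i ≠ 0 ∧ P i = t + 1) ↔ x t = true := by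
    rw [← ext_succ (x := x) t.2, hx.ext_iff _ (by omega)]
    constructor
    · rintro ⟨i, hi, -, h⟩
      exact ⟨i, hi.le, h⟩
    · rintro ⟨i, hi, h⟩
      refine ⟨i, ?_, ?_, h⟩
      · refine lt_of_le_of_ne hi ?_
        rintro rfl
        rw [hx.last] at h
        omega
      · rintro rfl
        rw [hx.zero] at h
        omega
  have key' : (∃ i < numOnes n (coarseY n (errScale n N) (fun a => trace x (keeps a)) (n + 2)), i ≠ 0 ∧
    placeEstimate n N (coarseY n (errScale n N) (fun a => trace x (keeps a)) (n + 2))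
      (coarseY n (errScale n N) (fun a => (trace x (keeps a)).reverse) (n + 2))
        (fun a => trace x (keeps a)) i = t + 1) ↔ x t = true := by
    rw [← key, hnum]
    constructor
    · rintro ⟨i, hi, h0, h⟩
      exact ⟨i, hi, h0, by rwa [hplace i hi] at h⟩
    · rintro ⟨i, hi, h0, h⟩
      exact ⟨i, hi, h0, by rwa [hplace i hi]⟩
  simp only [reconstruct, key']
  cases x t <;> rfl

end reconstruct

/-! ### Derived expressions -/

section derived

variable {β : Fin 3 → ℕ} {env : ℕ → ℕ} {A : ℕ → ℕ → ℕ}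

/-- `e ≤ f` -/
def Expr.le (e f : Expr) : Expr := .sub (.const 1) (.sub e f)

/-- `e < f` -/
def Expr.lt (e f : Expr) : Expr := .sub f e

/-- `e = f` -/
def Expr.eq (e f : Expr) : Expr := .sub (.const 1) (.add (.sub e f) (.sub f e))

/-- conjunction -/
def Expr.and (e f : Expr) : Expr := .ite e f (.const 0)

/-- the least value below the bound at which `e` is true; `j` must not occur in `e` -/
def Expr.least (k j : ℕ) (b : Fin 3) (e : Expr) : Expr :=
  .sum j b (.ite (.sum k b (.and (.lt (.var k) (.add (.var j) (.const 1))) e)) (.const 0) (.const 1))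

/-- the product of two expressions, the second of which is at most the bound; `j` must not occur
in them -/
def Expr.mul (j : ℕ) (b : Fin 3) (e f : Expr) : Expr := .sum j b (.ite (.lt (.var j) f) e (.const 0))

theorem Expr.eval_le (e f : Expr) : (e.le f).eval β env A ≠ 0 ↔ e.eval β env A ≤ f.eval β env A := by
  simp only [Expr.le, Expr.eval]; omega

theorem Expr.eval_lt (e f : Expr) : (e.lt f).eval β env A ≠ 0 ↔ e.eval β env A < f.eval β env A := by
  simp only [Expr.lt, Expr.eval]; omega

theorem Expr.eval_eq (e f : Expr) : (e.eq f).eval β env A ≠ 0 ↔ e.eval β env A = f.eval β env A := by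
  simp only [Expr.eq, Expr.eval]; omega

theorem Expr.eval_and (e f : Expr) :
    (e.and f).eval β env A ≠ 0 ↔ e.eval β env A ≠ 0 ∧ f.eval β env A ≠ 0 := by
  simp only [Expr.and, Expr.eval]; split_ifs <;> simp_all

theorem Expr.eval_sum_ne (j : ℕ) (b : Fin 3) (e : Expr) : (Expr.sum j b e).eval β env A ≠ 0 ↔
    ∃ v < β b, e.eval β (Function.update env j v) A ≠ 0 := by
  simp only [Expr.eval, ne_eq, Finset.sum_eq_zero_iff, Finset.mem_range]
  push Not
  rfl

theorem Expr.eval_least {k j : ℕ} (hkj : k ≠ j) {b : Fin 3} {e : Expr} {p : ℕ → Prop} [DecidablePred p]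
    (h : ∀ v w, v < β b → (e.eval β (Function.update (Function.update env j w) k v) A ≠ 0 ↔ p v)) :
    (Expr.least k j b e).eval β env A = leastBelow (β b) p := by
  rw [Expr.least, Expr.eval, leastBelow]
  refine Finset.sum_congr rfl fun w hw => ?_
  rw [Finset.mem_range] at hw
  have : ((Expr.sum k b (.and (.lt (.var k) (.add (.var j) (.const 1))) e)).eval β
      (Function.update env j w) A ≠ 0) ↔ ∃ i < w + 1, p i := by
    rw [Expr.eval_sum_ne]
    simp only [Expr.eval_and, Expr.eval_lt]
    simp only [Expr.eval, Function.update_self, Function.update_of_ne hkj.symm]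
    constructor
    · rintro ⟨v, h1, h2, h3⟩
      exact ⟨v, h2, (h v w h1).1 h3⟩
    · rintro ⟨v, h1, h2⟩
      exact ⟨v, by omega, h1, (h v w (by omega)).2 h2⟩
  rw [Expr.eval]
  simp only [this]
  simp [Expr.eval]

/-- Repeated addition inside a bounded sum; the second factor must not exceed the loop bound, or the
product would be cut off. -/
theorem Expr.eval_mul {j : ℕ} {b : Fin 3} {e f : Expr} {u v : ℕ} (hv : v ≤ β b)
    (he : ∀ w, e.eval β (Function.update env j w) A = u)
    (hf : ∀ w, f.eval β (Function.update env j w) A = v) :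
    (Expr.mul j b e f).eval β env A = u * v := by
  rw [Expr.mul, Expr.eval]
  have : ∀ w, (Expr.ite (.lt (.var j) f) e (.const 0)).eval β (Function.update env j w) A =
      if w < v then u else 0 := by
    intro w
    rw [Expr.eval]
    simp only [Expr.eval_lt, he, hf]
    simp [Expr.eval]
  simp only [this]
  rw [← Finset.sum_filter]
  have : (Finset.range (β b)).filter (fun w => w < v) = Finset.range v := by
    ext w; simp; omega
  rw [this, Finset.sum_const, Finset.card_range, smul_eq_mul, mul_comm]

theorem Expr.eval_ite_of {c e f : Expr} {p : Prop} [Decidable p] (h : c.eval β env A ≠ 0 ↔ p) :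
    (Expr.ite c e f).eval β env A = if p then e.eval β env A else f.eval β env A := by
  rw [Expr.eval]
  simp only [h]

end derived

/-! ### Invariants of statements -/

theorem iterateFor_induct {α : Type*} {f : ℕ → α → α} {A : α} {k : ℕ} (Inv : ℕ → α → Prop)
    (h0 : Inv 0 A) (hs : ∀ v < k, ∀ B, Inv v B → Inv (v + 1) (f v B)) : Inv k (iterateFor f A k) := by
  induction k with
  | zero => exact h0
  | succ k ih => exact hs k (by omega) _ (ih fun v hv => hs v (by omega))

/-- The arrays that a statement may change. -/
def Stmt.writes : Stmt → List ℕ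
  | .store a _ _ => [a]
  | .seq P Q => P.writes ++ Q.writes
  | .iterate _ _ P => P.writes

theorem Stmt.run_of_notMem {β : Fin 3 → ℕ} {P : Stmt} {a : ℕ} (h : a ∉ P.writes) (env : ℕ → ℕ)
    (A : ℕ → ℕ → ℕ) : P.run β env A a = A a := by
  induction P generalizing env A with
  | store a' i e =>
    simp only [Stmt.writes, List.mem_singleton] at h
    simp [Stmt.run, setCell, h]
  | seq P Q ihP ihQ =>
    simp only [Stmt.writes, List.mem_append, not_or] at h
    rw [Stmt.run, ihQ h.2, ihP h.1]
  | iterate j b P ih =>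
    rw [Stmt.run]
    exact iterateFor_induct (fun _ B => B a = A a) rfl fun v _ B hB => (ih h _ B).trans hB

theorem setCell_apply (A : ℕ → ℕ → ℕ) (a k v a' k' : ℕ) :
    setCell A a k v a' k' = if a' = a ∧ k' = k then v else A a' k' := by
  unfold setCell
  by_cases h : a' = a
  · subst h
    by_cases h' : k' = k <;> simp [h']
  · simp [h]

theorem setCell_self (A : ℕ → ℕ → ℕ) (a k v k' : ℕ) :
    setCell A a k v a k' = if k' = k then v else A a k' := by
  simp [setCell_apply]

theorem setCell_ne {a a' : ℕ} (h : a' ≠ a) (A : ℕ → ℕ → ℕ) (k v : ℕ) : setCell A a k v a' = A a' := by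
  simp [setCell, h]

/-! ### The program

Arrays `0` and `1` hold the input and array `2` the output. The loop variables `0`, `1`, `2` are the
stage, the trace and the place. -/

/-- The arrays hold the traces `ys`. -/
structure IsInput (n N : ℕ) (ys : ℕ → List Bool) (A : ℕ → ℕ → ℕ) : Prop where
  len : ∀ a < N, A 0 a = (ys a).length
  bit : ∀ a < N, ∀ j < n, A 1 (n * a + j) = ((ys a).getD j false).toNat
  le : ∀ a < N, (ys a).length ≤ n

theorem IsInput.congr {n N : ℕ} {ys : ℕ → List Bool} {A B : ℕ → ℕ → ℕ} (h : IsInput n N ys A)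
    (h0 : B 0 = A 0) (h1 : B 1 = A 1) : IsInput n N ys B :=
  ⟨fun a ha => by rw [h0, h.len a ha], fun a ha j hj => by rw [h1, h.bit a ha j hj], h.le⟩

/-- Copy the trace, with the final one appended, into array `w`. -/
def loadTrace (w : ℕ) : Stmt :=
  .iterate 2 2 (.store w (.add (.var 2) (.const 1)) (.ite (.lt (.var 2) (.arr 0 (.var 1)))
    (.arr 1 (.add (.sum 3 0 (.var 1)) (.var 2))) (.eq (.var 2) (.arr 0 (.var 1)))))

/-- The same for the reversed trace. -/
def loadReverse (w : ℕ) : Stmt :=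
  .iterate 2 2 (.store w (.add (.var 2) (.const 1)) (.ite (.lt (.var 2) (.arr 0 (.var 1)))
    (.arr 1 (.add (.sum 3 0 (.var 1)) (.sub (.sub (.arr 0 (.var 1)) (.const 1)) (.var 2))))
    (.eq (.var 2) (.arr 0 (.var 1)))))

section load

variable {n N : ℕ} {ys : ℕ → List Bool} {A : ℕ → ℕ → ℕ} {env : ℕ → ℕ}

theorem bounds_zero : bounds n N 0 = n := rfl

theorem bounds_one : bounds n N 1 = N := rfl

theorem bounds_two : bounds n N 2 = n + 2 := rfl

theorem eval_eq_value {β : Fin 3 → ℕ} (e f : Expr) :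
    (e.eq f).eval β env A = if e.eval β env A = f.eval β env A then 1 else 0 := by
  simp only [Expr.eq, Expr.eval]
  split_ifs <;> omega

theorem loadTrace_run {w : ℕ} (hw : 2 ≤ w) (hA : IsInput n N ys A) (ha : env 1 < N) :
    ∀ t, 1 ≤ t → t ≤ n + 2 →
      (loadTrace w).run (bounds n N) env A w t = traceBit (ys (env 1)) t := by
  rw [loadTrace, Stmt.run, bounds_two]
  have hle := hA.le _ ha
  refine (iterateFor_induct (fun v (B : ℕ → ℕ → ℕ) => B 0 = A 0 ∧ B 1 = A 1 ∧
    ∀ t, 1 ≤ t → t ≤ v → B w t = traceBit (ys (env 1)) t) ⟨rfl, rfl, fun t _ _ => by omega⟩ ?_).2.2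
  rintro v hv B ⟨h0, h1, h2⟩
  have hB := hA.congr h0 h1
  refine ⟨?_, ?_, ?_⟩
  · rw [Stmt.run, setCell_ne (by omega), h0]
  · rw [Stmt.run, setCell_ne (by omega), h1]
  intro t ht1 ht2
  rw [Stmt.run, setCell_self]
  split_ifs with h
  · rw [Expr.eval_ite_of (Expr.eval_lt _ _), eval_eq_value]
    simp only [Expr.eval, Function.update_self, Function.update_of_ne (by decide : (1 : ℕ) ≠ 2),
      Function.update_of_ne (by decide : (1 : ℕ) ≠ 3)] at h ⊢
    subst h
    rw [hB.len _ ha, Finset.sum_const, bounds_zero, Finset.card_range, smul_eq_mul, traceBit]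
    by_cases h : v < (ys (env 1)).length
    · rw [if_pos h, hB.bit _ ha _ (by omega), if_pos (by omega), Nat.add_sub_cancel]
    · rw [if_neg h, if_neg (by omega : ¬ v + 1 ≤ _)]
      simp
  · simp only [Expr.eval, Function.update_self] at h
    exact h2 t ht1 (by omega)

theorem loadReverse_run {w : ℕ} (hw : 2 ≤ w) (hA : IsInput n N ys A) (ha : env 1 < N) :
    ∀ t, 1 ≤ t → t ≤ n + 2 →
      (loadReverse w).run (bounds n N) env A w t = traceBit (ys (env 1)).reverse t := by
  rw [loadReverse, Stmt.run, bounds_two]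
  have hle := hA.le _ ha
  refine (iterateFor_induct (fun v (B : ℕ → ℕ → ℕ) => B 0 = A 0 ∧ B 1 = A 1 ∧
    ∀ t, 1 ≤ t → t ≤ v → B w t = traceBit (ys (env 1)).reverse t) ⟨rfl, rfl, fun t _ _ => by omega⟩ ?_).2.2
  rintro v hv B ⟨h0, h1, h2⟩
  have hB := hA.congr h0 h1
  refine ⟨?_, ?_, ?_⟩
  · rw [Stmt.run, setCell_ne (by omega), h0]
  · rw [Stmt.run, setCell_ne (by omega), h1]
  intro t ht1 ht2
  rw [Stmt.run, setCell_self]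
  split_ifs with h
  · rw [Expr.eval_ite_of (Expr.eval_lt _ _), eval_eq_value]
    simp only [Expr.eval, Function.update_self, Function.update_of_ne (by decide : (1 : ℕ) ≠ 2),
      Function.update_of_ne (by decide : (1 : ℕ) ≠ 3)] at h ⊢
    subst h
    rw [hB.len _ ha, Finset.sum_const, bounds_zero, Finset.card_range, smul_eq_mul, traceBit,
      List.length_reverse]
    by_cases h : v < (ys (env 1)).length
    · rw [if_pos h, hB.bit _ ha _ (by omega), if_pos (by omega), Nat.add_sub_cancel,
        List.getD_eq_getElem _ _ (by omega), List.getD_eq_getElem _ _ (by simpa using h),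
        List.getElem_reverse]
    · rw [if_neg h, if_neg (by omega : ¬ v + 1 ≤ _)]
      simp
  · simp only [Expr.eval, Function.update_self] at h
    exact h2 t ht1 (by omega)

end load

/-- `c D |x - u| ≤ u`, where `D` is the square of the only cell of array `3` and `c` is `1` or `16`;
the variables `6` and `7` must not occur in `x` and `u`. -/
def Expr.dist (x u : Expr) : Expr :=
  .mul 7 1 (.mul 6 1 (.add (.sub x u) (.sub u x)) (.arr 3 (.const 0))) (.arr 3 (.const 0))

/-- twice -/
def Expr.double (e : Expr) : Expr := .add e e

theorem Expr.eval_double {β : Fin 3 → ℕ} {env : ℕ → ℕ} {A : ℕ → ℕ → ℕ} (e : Expr) :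
    e.double.eval β env A = 2 * e.eval β env A := by
  rw [Expr.double, Expr.eval]; omega

/-- The scale D = d² need not be below any loop bound, whereas `d` is at most `N`. Hence two
successive multiplications by `d`. -/
theorem Expr.eval_dist {n N d : ℕ} {env : ℕ → ℕ} {A : ℕ → ℕ → ℕ} {x u : Expr} {x' u' : ℕ}
    (hA : A 3 0 = d) (hd : d ≤ N)
    (hx : ∀ v w, x.eval (bounds n N) (Function.update (Function.update env 7 v) 6 w) A = x')
    (hu : ∀ v w, u.eval (bounds n N) (Function.update (Function.update env 7 v) 6 w) A = u') :
    (Expr.dist x u).eval (bounds n N) env A = d * d * ((x' - u') + (u' - x')) := by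
  rw [Expr.dist, Expr.eval_mul (u := ((x' - u') + (u' - x')) * d) (v := d) (by exact hd)]
  · ring
  · intro v
    refine Expr.eval_mul (by exact hd) ?_ ?_
    · intro w; simp only [Expr.eval, hx, hu]
    · intro w; simp only [Expr.eval, hA]
  · intro v; simp only [Expr.eval, hA]

/-- The next assigned index; cell `0` of array `7` holds the padded gap. -/
def nextE (F q : ℕ) : Expr :=
  .least 3 4 2 (.and (.lt (.arr F (.var 2)) (.var 3))
    (.sum 5 2 (.and (.lt (.var 5) (.var 3)) (.and (.le (.arr F (.var 2)) (.var 5))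
      (.le (.dist (.sub (.arr q (.var 3)) (.arr q (.var 5))) (.arr 7 (.const 0))) (.arr 7 (.const 0)))))))

theorem eval_nextE {n N d F q : ℕ} {env : ℕ → ℕ} {A : ℕ → ℕ → ℕ} (hA : A 3 0 = d) (hd : d ≤ N) :
    (nextE F q).eval (bounds n N) env A = nextIndex n (d * d) (A q) (A F (env 2)) (A 7 0) := by
  rw [nextE, nextIndex]
  refine (Expr.eval_least (by decide) ?_).trans rfl
  intro v w hv
  rw [Expr.eval_and, Expr.eval_lt, Expr.eval_sum_ne]
  simp only [Expr.eval_and, Expr.eval_lt, Expr.eval_le]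
  have key : ∀ k, (Expr.dist (.sub (.arr q (.var 3)) (.arr q (.var 5))) (.arr 7 (.const 0))).eval
      (bounds n N) (Function.update (Function.update (Function.update env 4 w) 3 v) 5 k) A =
      d * d * ((A q v - A q k - A 7 0) + (A 7 0 - (A q v - A q k))) := by
    intro k
    refine Expr.eval_dist hA hd ?_ ?_ <;> intro _ _ <;> simp [Expr.eval]
  simp only [key]
  simp only [Expr.eval, Function.update_apply, bounds_two] at hv ⊢
  simp only [IsCandidate, CloseTo]
  simp only [Nat.reduceEqDiff, if_true, if_false]
  constructor
  · rintro ⟨h1, k, h2, h3, h4, h5⟩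
    exact ⟨h1, k, h3, h4, h5⟩
  · rintro ⟨h1, k, h3, h4, h5⟩
    exact ⟨h1, k, by omega, h3, h4, h5⟩

/-- The padded gap before place `t + 1`. -/
def padGapE (l : ℕ) : Expr :=
  .add (.add (.sub (.add (.var 2) (.const 1)) (.arr l (.var 2)))
    (.ite (.arr l (.var 2)) (.const 0) (.bnd 0))) (.ite (.eq (.var 2) (.arr 0 (.var 1))) (.bnd 0) (.const 0))

theorem eval_padGapE {n N l : ℕ} {env : ℕ → ℕ} {A : ℕ → ℕ → ℕ} :
    (padGapE l).eval (bounds n N) env A = padGap n (A 0 (env 1)) (A l (env 2)) (env 2 + 1) := by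
  rw [padGapE, padGap, Expr.eval, Expr.eval, Expr.eval_ite_of (Expr.eval_eq _ _)]
  simp only [Expr.eval, bounds_zero, Nat.add_right_cancel_iff]
  by_cases h : A l (env 2) = 0 <;> simp [h] <;> congr

/-- Scan the trace in array `w` along array `q`; the indices are written to `F`, the last places
to `l`. -/
def scanS (w F l q : ℕ) : Stmt :=
  .seq (.store F (.const 0) (.const 0)) (.seq (.store l (.const 0) (.const 0))
    (.iterate 2 2 (.seq (.store 7 (.const 0) (padGapE l))
      (.seq (.store F (.add (.var 2) (.const 1))
          (.ite (.arr w (.add (.var 2) (.const 1))) (nextE F q) (.arr F (.var 2))))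
        (.store l (.add (.var 2) (.const 1))
          (.ite (.arr w (.add (.var 2) (.const 1))) (.add (.var 2) (.const 1)) (.arr l (.var 2))))))))

/-- The non-membership hypotheses keep the arrays that are written apart from those that are read,
so the invariant can carry the input and the picture along unchanged. -/
theorem scanS_run {n N d w F l q : ℕ} {env : ℕ → ℕ} {A : ℕ → ℕ → ℕ} (hA : A 3 0 = d) (hd : d ≤ N)
    {bit : ℕ → ℕ} (hw : ∀ t, 1 ≤ t → t ≤ n + 2 → A w t = bit t)
    (hF : F ∉ [0, 3, 7, l, w, q]) (hl : l ∉ [0, 3, 7, w, q]) (hwq : 7 ∉ [w, q]) :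
    ∀ t ≤ n + 2, (scanS w F l q).run (bounds n N) env A F t =
        (scan n (d * d) (A q) (A 0 (env 1)) bit t).2 ∧
      (scanS w F l q).run (bounds n N) env A l t = (scan n (d * d) (A q) (A 0 (env 1)) bit t).1 := by
  simp only [List.mem_cons, List.not_mem_nil, or_false, not_or] at hF hl hwq
  obtain ⟨f1, f2, f3, f4, f5, f6⟩ := hF
  obtain ⟨l1, l2, l3, l4, l5⟩ := hl
  obtain ⟨w1, w2⟩ := hwq
  simp only [scanS, Stmt.run.eq_2, Stmt.run.eq_3, bounds_two]
  refine (iterateFor_induct (fun v (B : ℕ → ℕ → ℕ) => B 0 = A 0 ∧ B 3 = A 3 ∧ B w = A w ∧ B q = A q ∧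
    ∀ t ≤ v, B F t = (scan n (d * d) (A q) (A 0 (env 1)) bit t).2 ∧
      B l t = (scan n (d * d) (A q) (A 0 (env 1)) bit t).1) ⟨?_, ?_, ?_, ?_, ?_⟩ ?_).2.2.2.2
  · rw [Stmt.run, Stmt.run, setCell_ne (Ne.symm l1), setCell_ne (Ne.symm f1)]
  · rw [Stmt.run, Stmt.run, setCell_ne (Ne.symm l2), setCell_ne (Ne.symm f2)]
  · rw [Stmt.run, Stmt.run, setCell_ne (Ne.symm l4), setCell_ne (Ne.symm f5)]
  · rw [Stmt.run, Stmt.run, setCell_ne (Ne.symm l5), setCell_ne (Ne.symm f6)]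
  · intro t ht
    obtain rfl : t = 0 := by omega
    rw [Stmt.run, Stmt.run, setCell_ne f4, setCell_self, setCell_self]
    simp [Expr.eval, scan]
  rintro v hv B ⟨b0, b3, bw, bq, bt⟩
  obtain ⟨bF, bl⟩ := bt v le_rfl
  simp only [Stmt.run]
  refine ⟨?_, ?_, ?_, ?_, ?_⟩
  · rw [setCell_ne (Ne.symm l1), setCell_ne (Ne.symm f1), setCell_ne (by decide), b0]
  · rw [setCell_ne (Ne.symm l2), setCell_ne (Ne.symm f2), setCell_ne (by decide), b3]
  · rw [setCell_ne (Ne.symm l4), setCell_ne (Ne.symm f5), setCell_ne (Ne.symm w1), bw]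
  · rw [setCell_ne (Ne.symm l5), setCell_ne (Ne.symm f6), setCell_ne (Ne.symm w2), bq]
  set env' := Function.update env 2 v with henv'
  have e1 : env' 1 = env 1 := by simp [henv']
  have e2 : env' 2 = v := by simp [henv']
  set B1 := setCell B 7 ((Expr.const 0).eval (bounds n N) env' B) ((padGapE l).eval (bounds n N) env' B)
    with hB1
  have c7 : B1 7 0 = padGap n (A 0 (env 1)) (scan n (d * d) (A q) (A 0 (env 1)) bit v).1 (v + 1) := by
    rw [hB1, setCell_self, Expr.eval, if_pos rfl, eval_padGapE, e1, e2, b0, bl]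
  have cw : B1 w = A w := by rw [hB1, setCell_ne (Ne.symm w1), bw]
  have cq : B1 q = A q := by rw [hB1, setCell_ne (Ne.symm w2), bq]
  have c3 : B1 3 = A 3 := by rw [hB1, setCell_ne (by decide), b3]
  have cF : B1 F = B F := by rw [hB1, setCell_ne f3]
  have cl : B1 l = B l := by rw [hB1, setCell_ne l3]
  set B2 := setCell B1 F ((Expr.add (.var 2) (.const 1)).eval (bounds n N) env' B1)
    ((Expr.ite (.arr w (.add (.var 2) (.const 1))) (nextE F q) (.arr F (.var 2))).eval (bounds n N) env' B1)
    with hB2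
  have hidx : ∀ B, (Expr.add (.var 2) (.const 1)).eval (bounds n N) env' B = v + 1 := by
    intro B; simp [Expr.eval, e2]
  have dw : B2 w = A w := by rw [hB2, setCell_ne (Ne.symm f5), cw]
  have dl : B2 l = B l := by rw [hB2, setCell_ne (Ne.symm f4), cl]
  have dF : ∀ t, B2 F t = if t = v + 1 then (if bit (v + 1) ≠ 0 then
      nextIndex n (d * d) (A q) (B F v) (B1 7 0) else B F v) else B F t := by
    intro t
    rw [hB2, setCell_self, hidx, cF, Expr.eval, Expr.eval, hidx, cw, hw _ (by omega) (by omega),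
      eval_nextE (by rw [c3, hA]) hd, cq, e2, cF]
    simp [Expr.eval, e2, cF]
  have dv : (Expr.ite (.arr w (.add (.var 2) (.const 1))) (.add (.var 2) (.const 1))
      (.arr l (.var 2))).eval (bounds n N) env' B2 = if bit (v + 1) ≠ 0 then v + 1 else B l v := by
    simp only [Expr.eval, e2, dw, dl, hw (v + 1) (by omega) (by omega)]
  intro t ht
  rw [setCell_ne f4, setCell_self, hidx, dF, dv, dl]
  split_ifs with h1 h2
  · subst h1
    rw [scan, if_pos h2, c7, bF]
    exact ⟨rfl, rfl⟩
  · subst h1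
    rw [scan, if_neg h2]
    exact ⟨bF, bl⟩
  · exact bt t (by omega)

/-- A statement that copies string `env 1` into array `w`. -/
structure Loads (n N w : ℕ) (ys zs : ℕ → List Bool) (P : Stmt) : Prop where
  writes : P.writes = [w]
  length : ∀ a < N, (zs a).length = (ys a).length
  run : ∀ env A, IsInput n N ys A → env 1 < N → ∀ t, 1 ≤ t → t ≤ n + 2 →
    P.run (bounds n N) env A w t = traceBit (zs (env 1)) t

theorem loads_loadTrace {n N w : ℕ} (hw : 2 ≤ w) (ys : ℕ → List Bool) :
    Loads n N w ys ys (loadTrace w) :=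
  ⟨rfl, fun _ _ => rfl, fun _ _ hA ha => loadTrace_run hw hA ha⟩

theorem loads_loadReverse {n N w : ℕ} (hw : 2 ≤ w) (ys : ℕ → List Bool) :
    Loads n N w ys (fun a => (ys a).reverse) (loadReverse w) :=
  ⟨rfl, fun _ _ => by simp, fun _ _ hA ha => loadReverse_run hw hA ha⟩

/-- The coarse sample of a scanned trace. -/
def sampleE (w F l : ℕ) : Expr :=
  .sum 2 2 (.ite (.and (.arr w (.add (.var 2) (.const 1))) (.eq (.arr F (.var 2)) (.var 0)))
    (padGapE l) (.const 0))

/-- Compute the coarse sample of one trace. -/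
def sampleS (ld : Stmt) (q : ℕ) : Stmt :=
  .seq ld (.seq (scanS 6 4 5 q) (.store 8 (.var 1) (sampleE 6 4 5)))

theorem sampleS_run {n N d q : ℕ} {ys zs : ℕ → List Bool} {ld : Stmt} {env : ℕ → ℕ}
    {A : ℕ → ℕ → ℕ} (hld : Loads n N 6 ys zs ld) (hA : IsInput n N ys A) (h3 : A 3 0 = d)
    (hd : d ≤ N) (ha : env 1 < N) (hq : 16 ≤ q) (k : ℕ) :
    (sampleS ld q).run (bounds n N) env A 8 k =
      if k = env 1 then coarseSample n (d * d) (A q) (zs (env 1)) (env 0) else A 8 k := by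
  rw [sampleS, Stmt.run, Stmt.run, Stmt.run, setCell_self]
  set B := ld.run (bounds n N) env A with hB
  have hne : ∀ a, a ≠ 6 → B a = A a := fun a h => Stmt.run_of_notMem (by simp [hld.writes, h]) _ _
  set C := (scanS 6 4 5 q).run (bounds n N) env B with hC
  have hneC : ∀ a, a ∉ [4, 5, 7] → C a = B a := by
    intro a h
    refine Stmt.run_of_notMem ?_ _ _
    simp only [List.mem_cons, List.not_mem_nil, or_false, not_or] at h
    simp [scanS, Stmt.writes, h]
  have hscan := scanS_run (n := n) (N := N) (w := 6) (F := 4) (l := 5) (q := q) (env := env) (A := B)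
    (by rw [hne 3 (by decide)]; exact h3) hd
    (hld.run env A hA ha) (by simp; omega) (by simp; omega) (by simp; omega)
  rw [hne 0 (by decide), hne q (by omega), hA.len _ ha, ← hC, ← hld.length _ ha] at hscan
  have e1 : (Expr.var 1).eval (bounds n N) env C = env 1 := rfl
  rw [e1, hneC 8 (by decide), hne 8 (by decide)]
  congr 1
  rw [sampleE, Expr.eval, coarseSample, bounds_two]
  refine Finset.sum_congr rfl fun t ht => ?_
  rw [Finset.mem_range] at ht
  obtain ⟨s1, s2⟩ := hscan t (by omega)
  have hw : C 6 (t + 1) = traceBit (zs (env 1)) (t + 1) := by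
    rw [hneC 6 (by decide)]
    exact hld.run env A hA ha _ (by omega) (by omega)
  rw [Expr.eval_ite_of (p := traceBit (zs (env 1)) (t + 1) ≠ 0 ∧
    (scan n (d * d) (A q) (zs (env 1)).length (traceBit (zs (env 1))) t).2 = env 0)]
  · rw [eval_padGapE]
    simp [Expr.eval, s2, hneC 0 (by decide), hne 0 (by decide), hA.len _ ha, hld.length _ ha]
  · rw [Expr.eval_and, Expr.eval_eq]
    simp [Expr.eval, s1, hw]

/-- Pick a sample that is close to most of the samples in array `8`. -/
def pickS : Stmt :=
  .seq (.iterate 1 0 (.store 9 (.var 1) (.sum 8 0 (.ite (.le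
    (Expr.dist (.arr 8 (.var 8)) (.arr 8 (.var 1))).double.double.double.double (.arr 8 (.var 1)))
      (.const 1) (.const 0)))))
  (.seq (.store 7 (.const 1) (.least 3 4 0 (.lt (.bnd 0) (.double (.arr 9 (.var 3))))))
    (.store 7 (.const 2) (.ite (.lt (.arr 7 (.const 1)) (.bnd 0)) (.arr 8 (.arr 7 (.const 1))) (.const 0))))

theorem leastBelow_congr {B : ℕ} {p q : ℕ → Prop} [DecidablePred p] [DecidablePred q]
    (h : ∀ j < B, (p j ↔ q j)) : leastBelow B p = leastBelow B q := by
  unfold leastBelow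
  refine Finset.sum_congr rfl fun k hk => ?_
  rw [Finset.mem_range] at hk
  have : (∃ j < k + 1, p j) ↔ ∃ j < k + 1, q j := by
    constructor
    · rintro ⟨j, hj, h'⟩; exact ⟨j, hj, (h j (by omega)).1 h'⟩
    · rintro ⟨j, hj, h'⟩; exact ⟨j, hj, (h j (by omega)).2 h'⟩
  simp only [this]

theorem pickS_run {n N d : ℕ} {env : ℕ → ℕ} {A : ℕ → ℕ → ℕ} (h3 : A 3 0 = d) (hd : d ≤ N) :
    pickS.run (bounds n N) env A 7 2 = pickSample n (d * d) (A 8) := by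
  rw [pickS, Stmt.run]
  set B := (Stmt.iterate 1 0 (.store 9 (.var 1) (.sum 8 0 (.ite (.le
    (Expr.dist (.arr 8 (.var 8)) (.arr 8 (.var 1))).double.double.double.double (.arr 8 (.var 1)))
      (.const 1) (.const 0))))).run (bounds n N) env A with hB
  have hB9 : B 8 = A 8 ∧ B 3 = A 3 ∧ ∀ a < n, B 9 a = ∑ b ∈ Finset.range n,
      if CloseTo (16 * (d * d)) (A 8 b) (A 8 a) then 1 else 0 := by
    rw [hB, Stmt.run, bounds_zero]
    refine iterateFor_induct (fun v (B : ℕ → ℕ → ℕ) => B 8 = A 8 ∧ B 3 = A 3 ∧ ∀ a < v, B 9 a =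
      ∑ b ∈ Finset.range n, if CloseTo (16 * (d * d)) (A 8 b) (A 8 a) then 1 else 0)
      ⟨rfl, rfl, fun a h => by omega⟩ ?_
    rintro v hv B ⟨b8, b3, b9⟩
    rw [Stmt.run]
    refine ⟨by rw [setCell_ne (by decide), b8], by rw [setCell_ne (by decide), b3], ?_⟩
    intro a ha
    rw [setCell_self]
    have e1 : (Expr.var 1).eval (bounds n N) (Function.update env 1 v) B = v := by simp [Expr.eval]
    rw [e1]
    split_ifs with h
    · subst h
      rw [Expr.eval, bounds_zero]
      refine Finset.sum_congr rfl fun b _ => ?_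
      rw [Expr.eval_ite_of (p := CloseTo (16 * (d * d)) (A 8 b) (A 8 a))]
      · rfl
      · rw [Expr.eval_le, Expr.eval_double, Expr.eval_double, Expr.eval_double, Expr.eval_double,
          Expr.eval_dist (x' := A 8 b) (u' := A 8 a) (by rw [b3, h3]) hd]
        · simp only [CloseTo, Expr.eval, b8]
          rw [show 16 * (d * d) * (A 8 b - A 8 a + (A 8 a - A 8 b)) =
            2 * (2 * (2 * (2 * (d * d * (A 8 b - A 8 a + (A 8 a - A 8 b)))))) by ring]
          simp
        · intro _ _; simp [Expr.eval, b8]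
        · intro _ _; simp [Expr.eval, b8]
    · exact b9 a (by omega)
  obtain ⟨b8, b3, b9⟩ := hB9
  rw [Stmt.run, Stmt.run, Stmt.run, setCell_self]
  have hleast : (Expr.least 3 4 0 (.lt (.bnd 0) (.double (.arr 9 (.var 3))))).eval (bounds n N) env B =
      leastBelow n fun a =>
        n < 2 * ∑ b ∈ Finset.range n, if CloseTo (16 * (d * d)) (A 8 b) (A 8 a) then 1 else 0 := by
    rw [Expr.eval_least (by decide) (p := fun a => n < 2 * B 9 a)]
    · rw [bounds_zero]
      exact leastBelow_congr fun a ha => by rw [b9 a ha]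
    · intro v w _
      rw [Expr.eval_lt, Expr.eval_double]
      simp [Expr.eval, bounds_zero]
  rw [hleast]
  simp only [pickSample]
  set L := leastBelow n fun a =>
        n < 2 * ∑ b ∈ Finset.range n, if CloseTo (16 * (d * d)) (A 8 b) (A 8 a) then 1 else 0
  rw [Expr.eval_ite_of (p := L < n)]
  · simp [Expr.eval, setCell_apply, b8]
  · rw [Expr.eval_lt]
    simp [Expr.eval, setCell_apply, bounds_zero]

/-- One stage of the coarse picture. -/
def stageS (ld : Stmt) (q : ℕ) : Stmt :=
  .seq (.iterate 1 0 (sampleS ld q)) (.seq pickS (.store q (.add (.var 0) (.const 1))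
    (.ite (.arr 7 (.const 2)) (.add (.arr q (.var 0)) (.arr 7 (.const 2))) (.const 0))))

theorem stageS_run {n N d q : ℕ} {ys zs : ℕ → List Bool} {ld : Stmt} {env : ℕ → ℕ}
    {A : ℕ → ℕ → ℕ} (hld : Loads n N 6 ys zs ld) (hA : IsInput n N ys A) (h3 : A 3 0 = d)
    (hd : d ≤ N) (hn : n ≤ N) (hq : 16 ≤ q) (hY : A q = coarseY n (d * d) zs (env 0)) :
    (stageS ld q).run (bounds n N) env A q = coarseY n (d * d) zs (env 0 + 1) := by
  rw [stageS, Stmt.run, Stmt.run, Stmt.run]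
  set B := (Stmt.iterate 1 0 (sampleS ld q)).run (bounds n N) env A with hB
  have hw : (sampleS ld q).writes = [6, 4, 5, 7, 4, 5, 8] := by
    simp [sampleS, scanS, Stmt.writes, hld.writes]
  have hB8 : B 0 = A 0 ∧ B 1 = A 1 ∧ B 3 = A 3 ∧ B q = A q ∧ ∀ a < n, B 8 a =
      coarseSample n (d * d) (coarseY n (d * d) zs (env 0)) (zs a) (env 0) := by
    rw [hB, Stmt.run, bounds_zero]
    refine iterateFor_induct (fun v (B : ℕ → ℕ → ℕ) => B 0 = A 0 ∧ B 1 = A 1 ∧ B 3 = A 3 ∧ B q = A q ∧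
      ∀ a < v, B 8 a = coarseSample n (d * d) (coarseY n (d * d) zs (env 0)) (zs a) (env 0))
      ⟨rfl, rfl, rfl, rfl, fun a h => by omega⟩ ?_
    rintro v hv B ⟨b0, b1, b3, bq, b8⟩
    refine ⟨?_, ?_, ?_, ?_, ?_⟩
    · rw [Stmt.run_of_notMem (by rw [hw]; decide), b0]
    · rw [Stmt.run_of_notMem (by rw [hw]; decide), b1]
    · rw [Stmt.run_of_notMem (by rw [hw]; decide), b3]
    · rw [Stmt.run_of_notMem (by rw [hw]; simp; omega), bq]
    · intro a ha
      rw [sampleS_run hld (hA.congr b0 b1) (by rw [b3, h3]) hd (by simp; omega) hq, bq, hY]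
      rw [Function.update_self, Function.update_of_ne (by decide)]
      split_ifs with h
      · rw [h]
      · exact b8 a (by omega)
  obtain ⟨b0, b1, b3, bq, b8⟩ := hB8
  have hp := pickS_run (n := n) (env := env) (A := B) (by rw [b3, h3]) hd
  rw [pickSample_congr b8] at hp
  set C := pickS.run (bounds n N) env B with hC
  have cq : C q = A q := by
    rw [hC, Stmt.run_of_notMem _, bq]
    simp [pickS, Stmt.writes]
    omega
  funext k
  rw [setCell_self, coarseY]
  simp only [Expr.eval, hp, cq, hY]
  simp only [ne_eq, ite_not]

/-- The coarse picture. -/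
def coarseS (ld : Stmt) (q : ℕ) : Stmt := .iterate 0 2 (stageS ld q)

theorem coarseS_run {n N d q : ℕ} {ys zs : ℕ → List Bool} {ld : Stmt} {env : ℕ → ℕ}
    {A : ℕ → ℕ → ℕ} (hld : Loads n N 6 ys zs ld) (hA : IsInput n N ys A) (h3 : A 3 0 = d)
    (hd : d ≤ N) (hn : n ≤ N) (hq : 16 ≤ q) (hY : ∀ k, A q k = 0) :
    (coarseS ld q).run (bounds n N) env A q = coarseY n (d * d) zs (n + 2) := by
  have hw : ∀ a, a ∈ (stageS ld q).writes → a = q ∨ a ∈ [4, 5, 6, 7, 8, 9] := by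
    intro a h
    simp only [stageS, sampleS, scanS, pickS, Stmt.writes, hld.writes, List.mem_append,
      List.mem_cons, List.not_mem_nil, or_false] at h ⊢
    omega
  have hnw : ∀ a, a < 4 → a ∉ (stageS ld q).writes := by
    intro a ha h
    rcases hw a h with h | h
    · omega
    · simp only [List.mem_cons, List.not_mem_nil, or_false] at h
      omega
  rw [coarseS, Stmt.run, bounds_two]
  refine (iterateFor_induct (fun v (B : ℕ → ℕ → ℕ) => B 0 = A 0 ∧ B 1 = A 1 ∧ B 3 = A 3 ∧
    B q = coarseY n (d * d) zs v) ⟨rfl, rfl, rfl, ?_⟩ ?_).2.2.2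
  · funext k
    rw [hY, coarseY]
  rintro v hv B ⟨b0, b1, b3, bq⟩
  refine ⟨?_, ?_, ?_, ?_⟩
  · rw [Stmt.run_of_notMem (hnw _ (by decide)), b0]
  · rw [Stmt.run_of_notMem (hnw _ (by decide)), b1]
  · rw [Stmt.run_of_notMem (hnw _ (by decide)), b3]
  · have := stageS_run (env := Function.update env 0 v) hld (hA.congr b0 b1) (by rw [b3, h3]) hd hn hq
      (by rw [bq]; simp)
    simpa using this

/-- `IsRecognized` at place `t` for a trace scanned from both sides. -/
def recognizedE : Expr :=
  .and (.arr 6 (.add (.var 2) (.const 1))) (.and (.eq (.arr 4 (.var 2)) (.var 0))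
    (.eq (.add (.arr 14 (.sub (.arr 0 (.var 1)) (.var 2))) (.add (.var 0) (.const 1)))
      (.arr 10 (.const 0))))

/-- Scan a trace from both sides. -/
def bothS : Stmt :=
  .seq (loadTrace 6) (.seq (loadReverse 13) (.seq (scanS 6 4 5 16) (scanS 13 14 15 17)))

/-- Add the zeros and the count of one trace to cell `env 0` of arrays `11` and `12`. -/
def tallyS : Stmt :=
  .seq bothS (.seq
    (.store 11 (.var 0) (.add (.arr 11 (.var 0)) (.ite (.le (.bnd 0) (.var 1))
      (.sum 2 2 (.ite recognizedE (.sub (.var 2) (.arr 5 (.var 2))) (.const 0))) (.const 0))))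
    (.store 12 (.var 0) (.add (.arr 12 (.var 0)) (.ite (.le (.bnd 0) (.var 1))
      (.sum 2 2 (.ite recognizedE (.const 1) (.const 0))) (.const 0)))))

/-! ### Tallies of recognized gaps -/

section tally

variable {n N d m : ℕ} {ys : ℕ → List Bool} {env : ℕ → ℕ} {A : ℕ → ℕ → ℕ}

theorem bothS_run (hA : IsInput n N ys A) (h3 : A 3 0 = d) (hd : d ≤ N) (ha : env 1 < N) :
    (∀ a, a ∉ [4, 5, 6, 7, 13, 14, 15] → bothS.run (bounds n N) env A a = A a) ∧
    (∀ t, 1 ≤ t → t ≤ n + 2 → bothS.run (bounds n N) env A 6 t = traceBit (ys (env 1)) t) ∧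
    (∀ t ≤ n + 2, bothS.run (bounds n N) env A 4 t =
      (scan n (d * d) (A 16) (ys (env 1)).length (traceBit (ys (env 1))) t).2) ∧
    (∀ t ≤ n + 2, bothS.run (bounds n N) env A 5 t =
      (scan n (d * d) (A 16) (ys (env 1)).length (traceBit (ys (env 1))) t).1) ∧
    (∀ t ≤ n + 2, bothS.run (bounds n N) env A 14 t =
      (scan n (d * d) (A 17) (ys (env 1)).length (traceBit (ys (env 1)).reverse) t).2) := by
  have h0 : ∀ a, a ∉ [4, 5, 6, 7, 13, 14, 15] → bothS.run (bounds n N) env A a = A a := by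
    intro a h
    refine Stmt.run_of_notMem ?_ _ _
    simp only [List.mem_cons, List.not_mem_nil, or_false, not_or] at h
    simp [bothS, loadTrace, loadReverse, scanS, Stmt.writes, h]
  refine ⟨h0, ?_⟩
  simp only [bothS, Stmt.run.eq_2]
  set B := (loadTrace 6).run (bounds n N) env A with hB
  have hBne : ∀ a, a ≠ 6 → B a = A a := fun a h => Stmt.run_of_notMem (by simp [loadTrace, Stmt.writes, h]) _ _
  have hB6 := (loads_loadTrace (n := n) (N := N) (w := 6) (by decide) ys).run env A hA ha
  have hBin := hA.congr (hBne 0 (by decide)) (hBne 1 (by decide))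
  set C := (loadReverse 13).run (bounds n N) env B with hC
  have hCne : ∀ a, a ≠ 13 → C a = B a := fun a h => Stmt.run_of_notMem (by simp [loadReverse, Stmt.writes, h]) _ _
  have hC13 := (loads_loadReverse (n := n) (N := N) (w := 13) (by decide) ys).run env B hBin ha
  set E := (scanS 6 4 5 16).run (bounds n N) env C with hE
  have hEne : ∀ a, a ∉ [4, 5, 7] → E a = C a := by
    intro a h
    refine Stmt.run_of_notMem ?_ _ _
    simp only [List.mem_cons, List.not_mem_nil, or_false, not_or] at h
    simp [scanS, Stmt.writes, h]
  have hFne : ∀ a, a ∉ [14, 15, 7] → (scanS 13 14 15 17).run (bounds n N) env E a = E a := by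
    intro a h
    refine Stmt.run_of_notMem ?_ _ _
    simp only [List.mem_cons, List.not_mem_nil, or_false, not_or] at h
    simp [scanS, Stmt.writes, h]
  have c3 : C 3 0 = d := by rw [hCne 3 (by decide), hBne 3 (by decide), h3]
  have c0 : C 0 (env 1) = (ys (env 1)).length := by
    rw [hCne 0 (by decide), hBne 0 (by decide), hA.len _ ha]
  have s1 := scanS_run (n := n) (N := N) (w := 6) (F := 4) (l := 5) (q := 16) (env := env) c3 hd
    (fun t h1 h2 => (congrFun (hCne 6 (by decide)) t).trans (hB6 t h1 h2)) (by decide) (by decide) (by decide)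
  have s2 := scanS_run (n := n) (N := N) (w := 13) (F := 14) (l := 15) (q := 17) (env := env)
    (by rw [hEne 3 (by decide), c3]) hd
    (fun t h1 h2 => (congrFun (hEne 13 (by decide)) t).trans (hC13 t h1 h2)) (by decide) (by decide) (by decide)
  rw [← hE, c0, hCne 16 (by decide), hBne 16 (by decide)] at s1
  rw [hEne 0 (by decide), c0, hEne 17 (by decide), hCne 17 (by decide), hBne 17 (by decide)] at s2
  refine ⟨?_, ?_, ?_, ?_⟩
  · intro t h1 h2
    rw [hFne 6 (by decide), hEne 6 (by decide), hCne 6 (by decide)]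
    exact hB6 t h1 h2
  · intro t ht
    rw [hFne 4 (by decide)]
    exact (s1 t ht).1
  · intro t ht
    rw [hFne 5 (by decide)]
    exact (s1 t ht).2
  · exact fun t ht => (s2 t ht).1

theorem tallyS_run (hA : IsInput n N ys A) (h3 : A 3 0 = d) (hd : d ≤ N) (ha : env 1 < N)
    (h10 : A 10 0 = m) (k : ℕ) :
    (tallyS.run (bounds n N) env A 11 k = if k = env 0 then A 11 k + (if n ≤ env 1 then
      gapZeros n (d * d) m (A 16) (A 17) (ys (env 1)) (env 0) else 0) else A 11 k) ∧
    (tallyS.run (bounds n N) env A 12 k = if k = env 0 then A 12 k + (if n ≤ env 1 then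
      gapCount n (d * d) m (A 16) (A 17) (ys (env 1)) (env 0) else 0) else A 12 k) := by
  obtain ⟨b0, b1, b2, b3, b4⟩ := bothS_run (env := env) hA h3 hd ha
  have hle := hA.le _ ha
  simp only [tallyS, Stmt.run.eq_2]
  set B := bothS.run (bounds n N) env A
  have hrec : ∀ (C : ℕ → ℕ → ℕ) (t : ℕ), t < n + 2 → (∀ a, a ≠ 11 → C a = B a) →
      (recognizedE.eval (bounds n N) (Function.update env 2 t) C ≠ 0 ↔
        IsRecognized n (d * d) m (A 16) (A 17) (ys (env 1)) (env 0) t) := by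
    intro C t ht hC
    rw [recognizedE, Expr.eval_and, Expr.eval_and, Expr.eval_eq, Expr.eval_eq]
    simp only [Expr.eval, Function.update_self, Function.update_of_ne (by decide : (1 : ℕ) ≠ 2),
      Function.update_of_ne (by decide : (0 : ℕ) ≠ 2)]
    rw [hC 6 (by decide), hC 4 (by decide), hC 14 (by decide), hC 0 (by decide), hC 10 (by decide),
      b1 _ (by omega) (by omega), b2 _ (by omega), b0 0 (by decide), hA.len _ ha, b4 _ (by omega),
      b0 10 (by decide), h10]
    rfl
  have hz : (Expr.sum 2 2 (.ite recognizedE (.sub (.var 2) (.arr 5 (.var 2))) (.const 0))).eval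
      (bounds n N) env B = gapZeros n (d * d) m (A 16) (A 17) (ys (env 1)) (env 0) := by
    rw [Expr.eval, gapZeros, bounds_two]
    refine Finset.sum_congr rfl fun t ht => ?_
    rw [Finset.mem_range] at ht
    rw [Expr.eval_ite_of (hrec B t ht fun _ _ => rfl)]
    simp [Expr.eval, b3 t (by omega)]
  set C := (Stmt.store 11 (.var 0) (.add (.arr 11 (.var 0)) (.ite (.le (.bnd 0) (.var 1))
      (.sum 2 2 (.ite recognizedE (.sub (.var 2) (.arr 5 (.var 2))) (.const 0))) (.const 0)))).run
      (bounds n N) env B with hC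
  have hCne : ∀ a, a ≠ 11 → C a = B a := fun a h => setCell_ne h _ _ _
  have hc : (Expr.sum 2 2 (.ite recognizedE (.const 1) (.const 0))).eval
      (bounds n N) env C = gapCount n (d * d) m (A 16) (A 17) (ys (env 1)) (env 0) := by
    rw [Expr.eval, gapCount, bounds_two]
    refine Finset.sum_congr rfl fun t ht => ?_
    rw [Finset.mem_range] at ht
    rw [Expr.eval_ite_of (hrec C t ht hCne)]
    simp [Expr.eval]
  have hcond : ∀ C, (Expr.le (.bnd 0) (.var 1)).eval (bounds n N) env C ≠ 0 ↔ n ≤ env 1 := by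
    intro C
    rw [Expr.eval_le]
    simp [Expr.eval, bounds_zero]
  constructor
  · rw [Stmt.run, setCell_ne (by decide), hC, Stmt.run, setCell_self, Expr.eval.eq_4, Expr.eval_ite_of (hcond B), hz,
      ← b0 11 (by decide)]
    by_cases h : k = env 0
    · subst h; simp [Expr.eval]
    · simp [Expr.eval, h]
  · rw [Stmt.run, setCell_self, Expr.eval.eq_4, Expr.eval_ite_of (hcond C), hc, hCne 12 (by decide), ← b0 12 (by decide)]
    by_cases h : k = env 0
    · subst h; simp [Expr.eval, hCne 12 (by decide)]
    · simp [Expr.eval, h]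

end tally

/-- Estimate one gap and the place after it. -/
def gapS : Stmt :=
  .seq (.iterate 1 1 tallyS) (.seq
    (.store 18 (.const 0) (.sum 1 1 (.ite (.le (.bnd 0) (.var 1))
      (.mul 6 0 (.arr 12 (.var 0)) (.arr 0 (.var 1))) (.const 0)))) (.seq
    (.store 19 (.const 0) (.sum 3 0 (.mul 6 1 (.arr 11 (.var 0)) (.sub (.bnd 1) (.bnd 0)))))
    (.store 20 (.add (.var 0) (.const 1)) (.add (.add (.arr 20 (.var 0))
      (.least 3 4 2 (.le (.double (.arr 19 (.const 0)))
        (.add (.double (.mul 6 2 (.arr 18 (.const 0)) (.var 3))) (.arr 18 (.const 0)))))) (.const 1)))))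

/-! ### Estimating one gap by the program -/

section gap

variable {n N d m : ℕ} {ys : ℕ → List Bool} {env : ℕ → ℕ} {A : ℕ → ℕ → ℕ}

/-- Each stage accumulates in its own cell of arrays 11 and 12, so the invariant must carry that the
later cells are still zero. -/
theorem gapS_run (hA : IsInput n N ys A) (h3 : A 3 0 = d) (hd : d ≤ N) (hdN : d * d = errScale n N)
    (h10 : A 10 0 = numOnes n (A 16)) (h11 : ∀ k, env 0 ≤ k → A 11 k = 0)
    (h12 : ∀ k, env 0 ≤ k → A 12 k = 0)
    (h20 : A 20 (env 0) = placeEstimate n N (A 16) (A 17) ys (env 0)) :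
    (∀ k, env 0 + 1 ≤ k → gapS.run (bounds n N) env A 11 k = 0 ∧ gapS.run (bounds n N) env A 12 k = 0) ∧
    ∀ k, gapS.run (bounds n N) env A 20 k = if k = env 0 + 1 then
      placeEstimate n N (A 16) (A 17) ys (env 0 + 1) else A 20 k := by
  simp only [gapS, Stmt.run.eq_2]
  set B := (Stmt.iterate 1 1 tallyS).run (bounds n N) env A with hB
  have hBne : ∀ a, a ∉ [4, 5, 6, 7, 13, 14, 15, 11, 12] → B a = A a := by
    intro a h
    refine Stmt.run_of_notMem ?_ _ _
    simp only [List.mem_cons, List.not_mem_nil, or_false, not_or] at h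
    simp [tallyS, bothS, loadTrace, loadReverse, scanS, Stmt.writes, h]
  have hB11 : (∀ k, env 0 + 1 ≤ k → B 11 k = 0 ∧ B 12 k = 0) ∧
      B 11 (env 0) = (∑ a ∈ Finset.range N, if n ≤ a then
        gapZeros n (d * d) (numOnes n (A 16)) (A 16) (A 17) (ys a) (env 0) else 0) ∧
      B 12 (env 0) = (∑ a ∈ Finset.range N, if n ≤ a then
        gapCount n (d * d) (numOnes n (A 16)) (A 16) (A 17) (ys a) (env 0) else 0) := by
    rw [hB, Stmt.run, bounds_one]
    refine (iterateFor_induct (fun v (B : ℕ → ℕ → ℕ) =>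
      (∀ a, a ∉ [4, 5, 6, 7, 13, 14, 15, 11, 12] → B a = A a) ∧
      (∀ k, env 0 + 1 ≤ k → B 11 k = 0 ∧ B 12 k = 0) ∧
      B 11 (env 0) = (∑ a ∈ Finset.range v, if n ≤ a then
        gapZeros n (d * d) (numOnes n (A 16)) (A 16) (A 17) (ys a) (env 0) else 0) ∧
      B 12 (env 0) = (∑ a ∈ Finset.range v, if n ≤ a then
        gapCount n (d * d) (numOnes n (A 16)) (A 16) (A 17) (ys a) (env 0) else 0))
      ⟨fun _ _ => rfl, fun k hk => ⟨h11 k (by omega), h12 k (by omega)⟩,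
        by simp [h11 _ le_rfl], by simp [h12 _ le_rfl]⟩ ?_).2
    rintro v hv B ⟨bne, bk, b11, b12⟩
    have ht := tallyS_run (env := Function.update env 1 v) (A := B) (d := d)
      (m := numOnes n (A 16)) (hA.congr (bne 0 (by decide)) (bne 1 (by decide)))
      (by rw [bne 3 (by decide), h3]) hd (by simpa using hv) (by rw [bne 10 (by decide), h10])
    simp only [Function.update_self, Function.update_of_ne (by decide : (0 : ℕ) ≠ 1),
      bne 16 (by decide), bne 17 (by decide)] at ht
    refine ⟨?_, ?_, ?_, ?_⟩
    · intro a h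
      rw [Stmt.run_of_notMem, bne a h]
      simp only [List.mem_cons, List.not_mem_nil, or_false, not_or] at h
      simp [tallyS, bothS, loadTrace, loadReverse, scanS, Stmt.writes, h]
    · intro k hk
      rw [(ht k).1, (ht k).2, if_neg (by omega), if_neg (by omega)]
      exact bk k hk
    · rw [(ht _).1, if_pos rfl, Finset.sum_range_succ, b11]
    · rw [(ht _).2, if_pos rfl, Finset.sum_range_succ, b12]
  obtain ⟨bk, b11, b12⟩ := hB11
  set S := ∑ a ∈ Finset.range N, if n ≤ a then
        gapZeros n (d * d) (numOnes n (A 16)) (A 16) (A 17) (ys a) (env 0) else 0 with hS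
  set M := ∑ a ∈ Finset.range N, if n ≤ a then
        gapCount n (d * d) (numOnes n (A 16)) (A 16) (A 17) (ys a) (env 0) else 0 with hM
  have b0 := hBne 0 (by decide)
  have hMW : (Expr.sum 1 1 (.ite (.le (.bnd 0) (.var 1))
      (.mul 6 0 (.arr 12 (.var 0)) (.arr 0 (.var 1))) (.const 0))).eval (bounds n N) env B =
      M * ∑ a ∈ Finset.range N, if n ≤ a then (ys a).length else 0 := by
    rw [Expr.eval, bounds_one, Finset.mul_sum]
    refine Finset.sum_congr rfl fun a ha => ?_
    rw [Finset.mem_range] at ha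
    rw [Expr.eval_ite_of (p := n ≤ a) (by rw [Expr.eval_le]; simp [Expr.eval, bounds_zero]),
      Expr.eval_mul (u := M) (v := (ys a).length) (hA.le a ha)]
    · rw [mul_ite, mul_zero]; rfl
    · intro w; simp [Expr.eval, b12]
    · intro w; simp [Expr.eval, b0, hA.len a ha]
  set C := (Stmt.store 18 (.const 0) (.sum 1 1 (.ite (.le (.bnd 0) (.var 1))
      (.mul 6 0 (.arr 12 (.var 0)) (.arr 0 (.var 1))) (.const 0)))).run (bounds n N) env B with hC
  have hCne : ∀ a, a ≠ 18 → C a = B a := fun a h => setCell_ne h _ _ _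
  have hC18 : C 18 0 = M * ∑ a ∈ Finset.range N, if n ≤ a then (ys a).length else 0 := by
    rw [hC, Stmt.run, setCell_self, hMW]
    exact if_pos rfl
  have hST : (Expr.sum 3 0 (.mul 6 1 (.arr 11 (.var 0)) (.sub (.bnd 1) (.bnd 0)))).eval
      (bounds n N) env C = S * ((N - n) * n) := by
    rw [Expr.eval, bounds_zero]
    have : ∀ v, (Expr.mul 6 1 (.arr 11 (.var 0)) (.sub (.bnd 1) (.bnd 0))).eval (bounds n N)
        (Function.update env 3 v) C = S * (N - n) := by
      intro v
      refine Expr.eval_mul (by rw [bounds_one]; omega) ?_ ?_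
      · intro w; simp [Expr.eval, hCne 11 (by decide), b11]
      · intro w; simp [Expr.eval, bounds_zero, bounds_one]
    simp only [this]
    rw [Finset.sum_const, Finset.card_range, smul_eq_mul]
    ring
  set G := (Stmt.store 19 (.const 0) (.sum 3 0 (.mul 6 1 (.arr 11 (.var 0)) (.sub (.bnd 1) (.bnd 0))))).run
    (bounds n N) env C with hG
  have hGne : ∀ a, a ≠ 19 → G a = C a := fun a h => setCell_ne h _ _ _
  have hG19 : G 19 0 = S * ((N - n) * n) := by
    rw [hG, Stmt.run, setCell_self, hST]
    exact if_pos rfl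
  have hz : (Expr.least 3 4 2 (.le (.double (.arr 19 (.const 0)))
        (.add (.double (.mul 6 2 (.arr 18 (.const 0)) (.var 3))) (.arr 18 (.const 0))))).eval
      (bounds n N) env G = gapEstimate n N (A 16) (A 17) ys (env 0) := by
    rw [gapEstimate, ← hdN, ← hS, ← hM]
    refine (Expr.eval_least (by decide) ?_).trans rfl
    intro v w hv
    rw [Expr.eval_le, Expr.eval_double, Expr.eval, Expr.eval_double,
      Expr.eval_mul (u := G 18 0) (v := v) hv.le]
    · simp only [Expr.eval, hG19, hGne 18 (by decide), hC18]
      rw [add_mul, one_mul, mul_assoc 2 v, mul_comm v]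
    · intro w; simp [Expr.eval]
    · intro w; simp [Expr.eval]
  have hne : ∀ a, a ≠ 18 → a ≠ 19 → a ≠ 20 → (Stmt.store 20 (.add (.var 0) (.const 1)) (.add (.add (.arr 20 (.var 0))
      (.least 3 4 2 (.le (.double (.arr 19 (.const 0)))
        (.add (.double (.mul 6 2 (.arr 18 (.const 0)) (.var 3))) (.arr 18 (.const 0)))))) (.const 1))).run
        (bounds n N) env G a = B a := by
    intro a h1 h2 h3
    rw [Stmt.run, setCell_ne h3, hGne a h2, hCne a h1]
  refine ⟨fun k hk => ?_, fun k => ?_⟩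
  · rw [hne 11 (by decide) (by decide) (by decide), hne 12 (by decide) (by decide) (by decide)]
    exact bk k hk
  · have hG20 : G 20 = A 20 := by
      rw [hGne 20 (by decide), hCne 20 (by decide), hBne 20 (by decide)]
    rw [Stmt.run, setCell_self, Expr.eval, Expr.eval.eq_4, Expr.eval.eq_4, hz, hG20]
    simp only [Expr.eval, hG20, h20, placeEstimate]

end gap

/-- The whole algorithm. -/
def reconstructS : Stmt :=
  .seq (.store 3 (.const 0) (.sum 2 1 (.ite (.le (.sum 3 0 (.add (.var 2) (.const 1))) (.bnd 1))
    (.const 1) (.const 0)))) (.seq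
  (coarseS (loadTrace 6) 16) (.seq
  (coarseS (loadReverse 6) 17) (.seq
  (.store 10 (.const 0) (.sum 2 2 (.ite (.arr 16 (.var 2)) (.const 1) (.const 0)))) (.seq
  (.iterate 0 2 gapS)
  (.iterate 2 0 (.store 2 (.var 2) (.ite (.sum 0 2 (.and (.lt (.var 0) (.arr 10 (.const 0)))
    (.and (.var 0) (.eq (.arr 20 (.var 0)) (.add (.var 2) (.const 1)))))) (.const 1) (.const 0))))))))

theorem reconstructS_run {n N : ℕ} {ys : ℕ → List Bool} {env : ℕ → ℕ} {A : ℕ → ℕ → ℕ}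
    (hA : IsInput n N ys A) (hn : n ≤ N) (h0 : ∀ a k, 3 ≤ a → A a k = 0) (t : ℕ) (ht : t < n) :
    reconstructS.run (bounds n N) env A 2 t = reconstruct n N ys t := by
  simp only [reconstructS, Stmt.run.eq_2]
  set d := ∑ j ∈ Finset.range N, if (j + 1) * n ≤ N then 1 else 0 with hd
  have hdN : d ≤ N := by
    refine (Finset.sum_le_card_nsmul _ _ 1 fun j _ => ?_).trans (by simp)
    split_ifs <;> simp
  have hdd : d * d = errScale n N := rfl
  set B := (Stmt.store 3 (.const 0) (.sum 2 1 (.ite (.le (.sum 3 0 (.add (.var 2) (.const 1))) (.bnd 1))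
    (.const 1) (.const 0)))).run (bounds n N) env A with hB
  have hBne : ∀ a, a ≠ 3 → B a = A a := fun a h => setCell_ne h _ _ _
  have hB3 : B 3 0 = d := by
    rw [hB, Stmt.run, setCell_self, Expr.eval, if_pos rfl, Expr.eval, bounds_one, hd]
    refine Finset.sum_congr rfl fun j _ => ?_
    rw [Expr.eval_ite_of (p := (j + 1) * n ≤ N)]
    · rfl
    · rw [Expr.eval_le]
      simp [Expr.eval, bounds_zero, bounds_one, mul_comm n]
  have hw : ∀ ld q, ld = loadTrace 6 ∨ ld = loadReverse 6 → ∀ a, a ≠ q → a ∉ [4, 5, 6, 7, 8, 9] →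
      a ∉ (coarseS ld q).writes := by
    rintro ld q hld a ha h
    simp only [List.mem_cons, List.not_mem_nil, or_false, not_or] at h
    rcases hld with rfl | rfl <;>
      simp [coarseS, stageS, sampleS, loadTrace, loadReverse, scanS, pickS, Stmt.writes, ha, h]
  have hBin : IsInput n N ys B := hA.congr (hBne 0 (by decide)) (hBne 1 (by decide))
  set C := (coarseS (loadTrace 6) 16).run (bounds n N) env B with hC
  have hCne : ∀ a, a ≠ 16 → a ∉ [4, 5, 6, 7, 8, 9] → C a = B a := fun a h h' =>
    Stmt.run_of_notMem (hw _ _ (Or.inl rfl) a h h') _ _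
  have hC16 : C 16 = coarseY n (d * d) ys (n + 2) := coarseS_run (loads_loadTrace (by decide) ys) hBin hB3
    hdN hn le_rfl fun k => by rw [hBne 16 (by decide), h0 _ _ (by decide)]
  have hCin : IsInput n N ys C := hBin.congr (hCne 0 (by decide) (by decide)) (hCne 1 (by decide) (by decide))
  set E := (coarseS (loadReverse 6) 17).run (bounds n N) env C with hE
  have hEne : ∀ a, a ≠ 17 → a ∉ [4, 5, 6, 7, 8, 9] → E a = C a := fun a h h' =>
    Stmt.run_of_notMem (hw _ _ (Or.inr rfl) a h h') _ _
  have hE17 : E 17 = coarseY n (d * d) (fun a => (ys a).reverse) (n + 2) :=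
    coarseS_run (loads_loadReverse (by decide) ys) hCin (by rw [hCne 3 (by decide) (by decide), hB3])
    hdN hn (by decide) fun k => by
      rw [hCne 17 (by decide) (by decide), hBne 17 (by decide), h0 _ _ (by decide)]
  have hE16 : E 16 = coarseY n (d * d) ys (n + 2) := by rw [hEne 16 (by decide) (by decide), hC16]
  set G := (Stmt.store 10 (.const 0) (.sum 2 2 (.ite (.arr 16 (.var 2)) (.const 1) (.const 0)))).run
    (bounds n N) env E with hG
  have hGne : ∀ a, a ≠ 10 → G a = E a := fun a h => setCell_ne h _ _ _
  have hGA : ∀ a, a ∉ [3, 16, 17, 10, 4, 5, 6, 7, 8, 9] → G a = A a := by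
    intro a h
    simp only [List.mem_cons, List.not_mem_nil, or_false, not_or] at h
    rw [hGne a (by omega), hEne a (by omega) (by simp; omega), hCne a (by omega) (by simp; omega),
      hBne a (by omega)]
  have hG10 : G 10 0 = numOnes n (G 16) := by
    rw [hGne 16 (by decide), hG, Stmt.run, setCell_self, Expr.eval, if_pos rfl, Expr.eval, bounds_two,
      numOnes]
    refine Finset.sum_congr rfl fun k _ => ?_
    simp only [Expr.eval, Function.update_self, ne_eq, ite_not]
  have hG3 : G 3 0 = d := by
    rw [hGne 3 (by decide), hEne 3 (by decide) (by decide), hCne 3 (by decide) (by decide), hB3]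
  have hGin : IsInput n N ys G := hA.congr (hGA 0 (by decide)) (hGA 1 (by decide))
  set H := (Stmt.iterate 0 2 gapS).run (bounds n N) env G with hH
  have hwg : ∀ a, a ∉ [4, 5, 6, 7, 13, 14, 15, 11, 12, 18, 19, 20] → a ∉ gapS.writes := by
    intro a h
    simp only [List.mem_cons, List.not_mem_nil, or_false, not_or] at h
    simp [gapS, tallyS, bothS, loadTrace, loadReverse, scanS, Stmt.writes, h]
  have hHne : ∀ a, a ∉ [4, 5, 6, 7, 13, 14, 15, 11, 12, 18, 19, 20] → H a = G a := fun a h =>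
    Stmt.run_of_notMem (P := .iterate 0 2 gapS) (hwg a h) _ _
  have hH20 : ∀ i ≤ n + 2, H 20 i = placeEstimate n N (G 16) (G 17) ys i := by
    rw [hH, Stmt.run, bounds_two]
    refine (iterateFor_induct (fun v (B : ℕ → ℕ → ℕ) =>
      (∀ a, a ∉ [4, 5, 6, 7, 13, 14, 15, 11, 12, 18, 19, 20] → B a = G a) ∧
      (∀ k, v ≤ k → B 11 k = 0 ∧ B 12 k = 0) ∧
      (∀ i ≤ v, B 20 i = placeEstimate n N (G 16) (G 17) ys i)) ⟨fun _ _ => rfl, ?_, ?_⟩ ?_).2.2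
    · intro k _
      rw [hGA 11 (by decide), hGA 12 (by decide)]
      exact ⟨h0 _ _ (by decide), h0 _ _ (by decide)⟩
    · intro i hi
      obtain rfl : i = 0 := by omega
      rw [hGA 20 (by decide), h0 _ _ (by decide), placeEstimate]
    · rintro v hv B ⟨bne, bk, b20⟩
      have hg := gapS_run (env := Function.update env 0 v) (A := B)
        (hGin.congr (bne 0 (by decide)) (bne 1 (by decide))) (by rw [bne 3 (by decide), hG3]) hdN hdd
        (by rw [bne 10 (by decide), bne 16 (by decide), hG10])
        (fun k hk => (bk k (by simpa using hk)).1) (fun k hk => (bk k (by simpa using hk)).2)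
        (by rw [Function.update_self, bne 16 (by decide), bne 17 (by decide)]; exact b20 v le_rfl)
      rw [bne 16 (by decide), bne 17 (by decide), Function.update_self] at hg
      refine ⟨fun a h => ?_, hg.1, fun i hi => ?_⟩
      · rw [Stmt.run_of_notMem (hwg a h), bne a h]
      · rw [hg.2]
        split_ifs with h
        · rw [h]
        · exact b20 i (by omega)
  rw [Stmt.run, bounds_zero]
  refine (iterateFor_induct (fun v (B : ℕ → ℕ → ℕ) => B 10 = H 10 ∧ B 20 = H 20 ∧
    ∀ t < v, B 2 t = reconstruct n N ys t) ⟨rfl, rfl, fun t ht => by omega⟩ ?_).2.2 t ht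
  rintro v hv I ⟨i10, i20, i2⟩
  rw [Stmt.run]
  refine ⟨by rw [setCell_ne (by decide), i10], by rw [setCell_ne (by decide), i20], fun t ht => ?_⟩
  have e2 : (Expr.var 2).eval (bounds n N) (Function.update env 2 v) I = v := by simp [Expr.eval]
  rw [setCell_self, e2]
  split_ifs with h
  · subst h
    have h16 : G 16 = coarseY n (errScale n N) ys (n + 2) := by rw [hGne 16 (by decide), hE16, hdd]
    have h17 : G 17 = coarseY n (errScale n N) (fun a => (ys a).reverse) (n + 2) := by
      rw [hGne 17 (by decide), hE17, hdd]
    have hm : I 10 0 = numOnes n (G 16) := by rw [i10, hHne 10 (by decide), hG10]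
    have hmle : numOnes n (G 16) ≤ n + 2 := by
      refine (Finset.sum_le_card_nsmul _ _ 1 fun j _ => ?_).trans (by simp)
      split_ifs <;> simp
    rw [reconstruct, Expr.eval_ite_of (p := ∃ i < numOnes n (G 16), i ≠ 0 ∧
      placeEstimate n N (G 16) (G 17) ys i = t + 1)]
    · simp only [h16, h17, Expr.eval]
    · rw [Expr.eval_sum_ne]
      simp only [Expr.eval_and, Expr.eval_lt, Expr.eval_eq]
      simp only [Expr.eval, Function.update_self, Function.update_of_ne (by decide : (2 : ℕ) ≠ 0), hm,
        i20, bounds_two]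
      constructor
      · rintro ⟨i, h1, h2, h3, h4⟩
        exact ⟨i, h2, h3, by rw [← hH20 i h1.le, h4]⟩
      · rintro ⟨i, h2, h3, h4⟩
        exact ⟨i, by omega, h2, h3, by rw [hH20 i (by omega), h4]⟩
  · exact i2 t (by omega)

theorem isInput_initState {n N : ℕ} (y : Fin N → List Bool) (h : ∀ i, (y i).length ≤ n) :
    IsInput n N (fun a => if h : a < N then y ⟨a, h⟩ else []) (initState n y).arr where
  len a ha := by simp [initState, ha]
  bit a ha j hj := by
    have h1 : (n * a + j) / n = a := by
      rw [Nat.mul_add_div (by omega), Nat.div_eq_of_lt hj, Nat.add_zero]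
    have h2 : (n * a + j) % n = j := by
      rw [Nat.mul_add_mod, Nat.mod_eq_of_lt hj]
    simp only [initState, h1, h2, ha, dif_pos]
    simp
  le a ha := by simpa [ha] using h ⟨a, ha⟩

/-- The program halts on all inputs within a polynomial time bound, and if there are at least `n`
strings it outputs the bits `reconstruct`. -/
theorem exists_exec (n : ℕ) {N : ℕ} (y : Fin N → List Bool) :
    ∃ t s, t ≤ (reconstructS.time + 3).eval (n + N + 2) ∧
      Exec reconstructS.program (initState n y) t s ∧
      (n ≤ N → (∀ i, (y i).length ≤ n) → ∀ k < n, s.arr 2 k =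
        reconstruct n N (fun a => if h : a < N then y ⟨a, h⟩ else []) k) := by
  obtain ⟨t, s, h1, h2, h3⟩ := reconstructS.program_correct n y
  refine ⟨t, s, h1, h2, fun hn hy k hk => ?_⟩
  rw [h3]
  refine reconstructS_run (isInput_initState y hy) hn ?_ k hk
  intro a k ha
  have h0 : a ≠ 0 := by omega
  have h1 : a ≠ 1 := by omega
  simp [initState, h0, h1]

/-! ### Probability -/

instance (n : ℕ) (δ : unitInterval) : IsProbabilityMeasure (keepLaw n δ) := by
  unfold keepLaw; infer_instance

instance (N n : ℕ) (δ : unitInterval) : IsProbabilityMeasure (keepLaws N n δ) := by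
  unfold keepLaws; infer_instance

open Classical in
/-- If `F` depends through its first argument only on the coordinates in `p`, and through its second
argument only on the others, then the two arguments can be integrated separately. -/
theorem lintegral_diag_le {ι Ω : Type*} [Fintype ι] [Finite Ω] [MeasurableSpace Ω]
    [MeasurableSingletonClass Ω] (ν : ι → Measure Ω) [∀ i, IsProbabilityMeasure (ν i)] (p : ι → Prop)
    (F : (ι → Ω) → (ι → Ω) → ENNReal) (c : ENNReal)
    (h1 : ∀ ω ω' η, (∀ i, p i → ω i = ω' i) → F ω η = F ω' η)
    (h2 : ∀ ω η η', (∀ i, ¬ p i → η i = η' i) → F ω η = F ω η')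
    (hF : ∀ ω, ∫⁻ η, F ω η ∂(Measure.pi ν) ≤ c) : ∫⁻ ω, F ω ω ∂(Measure.pi ν) ≤ c := by
  have hmp := measurePreserving_piEquivPiSubtypeProd ν p
  set e := MeasurableEquiv.piEquivPiSubtypeProd (fun _ : ι => Ω) p with he
  have hprob : IsProbabilityMeasure (Measure.pi ν) := inferInstance
  have hne : Nonempty (ι → Ω) := by
    by_contra hc
    rw [not_nonempty_iff] at hc
    have := hprob.measure_univ
    rw [Set.univ_eq_empty_iff.2 hc, measure_empty] at this
    exact zero_ne_one this
  obtain ⟨ω0⟩ := hne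
  have e1 : ∀ u v i, p i → e.symm (u, v) i = e.symm (u, fun j => ω0 j) i := by
    intro u v i hi
    simp [he, MeasurableEquiv.piEquivPiSubtypeProd, Equiv.piEquivPiSubtypeProd, hi]
  have e2 : ∀ u u' v i, ¬ p i → e.symm (u, v) i = e.symm (u', v) i := by
    intro u u' v i hi
    simp [he, MeasurableEquiv.piEquivPiSubtypeProd, Equiv.piEquivPiSubtypeProd, hi]
  have key : ∀ G : (ι → Ω) → ENNReal, ∫⁻ ω, G ω ∂(Measure.pi ν) =
      ∫⁻ u, ∫⁻ v, G (e.symm (u, v)) ∂(Measure.pi fun i : {i // ¬ p i} => ν i)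
        ∂(Measure.pi fun i : Subtype p => ν i) := by
    intro G
    rw [← lintegral_prod (f := fun z => G (e.symm z)) Measurable.of_discrete.aemeasurable, ← hmp.map_eq,
      lintegral_map_equiv]
    simp
  rw [key]
  calc ∫⁻ u, ∫⁻ v, F (e.symm (u, v)) (e.symm (u, v)) ∂(Measure.pi fun i : {i // ¬ p i} => ν i)
        ∂(Measure.pi fun i : Subtype p => ν i)
      ≤ ∫⁻ _, c ∂(Measure.pi fun i : Subtype p => ν i) := by
        refine lintegral_mono fun u => ?_
        have hu := hF (e.symm (u, fun j => ω0 j))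
        rw [key] at hu
        have : ∀ u', ∫⁻ v, F (e.symm (u, fun j => ω0 j)) (e.symm (u', v))
            ∂(Measure.pi fun i : {i // ¬ p i} => ν i) =
            ∫⁻ v, F (e.symm (u, v)) (e.symm (u, v)) ∂(Measure.pi fun i : {i // ¬ p i} => ν i) := by
          intro u'
          refine lintegral_congr fun v => ?_
          rw [h1 (e.symm (u, v)) (e.symm (u, fun j => ω0 j)) _ (e1 u v)]
          exact h2 _ _ _ (e2 u' u v)
        simp only [this] at hu
        simpa using hu
    _ = c := by simp

open Classical in
theorem measureReal_diag_le {ι Ω : Type*} [Fintype ι] [Finite Ω] [MeasurableSpace Ω]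
    [MeasurableSingletonClass Ω] (ν : ι → Measure Ω) [∀ i, IsProbabilityMeasure (ν i)] (p : ι → Prop)
    (R : (ι → Ω) → (ι → Ω) → Prop) {c : ℝ} (hc : 0 ≤ c)
    (h1 : ∀ ω ω' η, (∀ i, p i → ω i = ω' i) → (R ω η ↔ R ω' η))
    (h2 : ∀ ω η η', (∀ i, ¬ p i → η i = η' i) → (R ω η ↔ R ω η'))
    (hR : ∀ ω, (Measure.pi ν).real {η | R ω η} ≤ c) : (Measure.pi ν).real {ω | R ω ω} ≤ c := by
  have hm : ∀ Q : (ι → Ω) → Prop, ∫⁻ ω, (if Q ω then 1 else 0) ∂(Measure.pi ν) = Measure.pi ν {ω | Q ω} := by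
    intro Q
    rw [← lintegral_indicator_one (Set.toFinite _).measurableSet]
    refine lintegral_congr fun ω => ?_
    simp [Set.indicator_apply]
  have := lintegral_diag_le ν p (fun ω η => if R ω η then 1 else 0) (ENNReal.ofReal c)
    (fun ω ω' η h => by simp only [h1 ω ω' η h]) (fun ω η η' h => by simp only [h2 ω η η' h])
    (fun ω => by
      rw [hm]
      exact (ENNReal.le_ofReal_iff_toReal_le (measure_ne_top _ _) hc).2 (hR ω))
  rw [hm] at this
  exact ENNReal.toReal_le_of_le_ofReal hc this

/-! ### Sub-Gaussian bounds for retention patterns -/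

section keepLaw

variable {n : ℕ} {δ : unitInterval}

theorem bernoulli_real_false : (bernoulliMeasure false true δ).real {false} = δ := by
  rw [bernoulliMeasure_real_apply_of_mem_of_notMem] <;> simp

theorem keepLaw_real_forall_eq_false (S : Finset (Fin n)) :
    (keepLaw n δ).real {k | ∀ p ∈ S, k p = false} = (δ : ℝ) ^ S.card := by
  have : {k : Fin n → Bool | ∀ p ∈ S, k p = false} =
      Set.univ.pi fun p => if p ∈ S then {false} else Set.univ := by
    ext k
    simp only [Set.mem_ofPred_eq, Set.mem_univ_pi]
    refine forall_congr' fun p => ?_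
    by_cases h : p ∈ S <;> simp [h]
  rw [this, keepLaw, measureReal_def, Measure.pi_pi, ENNReal.toReal_prod]
  have : ∀ p : Fin n, (bernoulliMeasure false true δ (if p ∈ S then {false} else Set.univ)).toReal =
      if p ∈ S then (δ : ℝ) else 1 := by
    intro p
    split_ifs
    · exact bernoulli_real_false
    · simp
  simp only [this]
  rw [Finset.prod_ite_mem]
  simp

theorem measureReal_eval_keepLaws {N : ℕ} (a : Fin N) (B : Set (Fin n → Bool)) :
    (keepLaws N n δ).real {ω | ω a ∈ B} = (keepLaw n δ).real B := by
  have := measurePreserving_eval (fun _ : Fin N => keepLaw n δ) a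
  rw [keepLaws, measureReal_def, measureReal_def, ← this.measure_preimage
    (Set.toFinite B).measurableSet.nullMeasurableSet]
  rfl

/-- Hoeffding's lemma for a variable with values in [0, 1]. -/
theorem hasSubgaussianMGF_bit (p : Fin n) :
    HasSubgaussianMGF (fun k : Fin n → Bool => (if k p = true then 1 else 0) - (1 - (δ : ℝ))) (1 / 4)
      (keepLaw n δ) := by
  have h := hasSubgaussianMGF_of_mem_Icc (μ := keepLaw n δ) (a := 0) (b := 1)
    (X := fun k : Fin n → Bool => if k p = true then 1 else 0) Measurable.of_discrete.aemeasurable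
    (ae_of_all _ fun k => by split_ifs <;> simp)
  have hmean : ∫ k, (if k p = true then (1 : ℝ) else 0) ∂(keepLaw n δ) = 1 - δ := by
    have e : (fun k : Fin n → Bool => if k p = true then (1 : ℝ) else 0) =
        Set.indicator {k | ∀ q ∈ ({p} : Finset (Fin n)), k q = false}ᶜ fun _ => (1 : ℝ) := by
      funext k
      by_cases h : k p = true <;> simp [h]
    rw [e, integral_indicator_const _ (Set.toFinite _).measurableSet,
      probReal_compl_eq_one_sub (Set.toFinite _).measurableSet, keepLaw_real_forall_eq_false]
    simp
  rw [hmean] at h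
  convert h using 1
  ext
  norm_num

theorem iIndepFun_eval {ι Ω : Type*} [Fintype ι] [MeasurableSpace Ω] (ν : ι → Measure Ω)
    [∀ i, IsProbabilityMeasure (ν i)] {f : ι → Ω → ℝ} (hf : ∀ i, Measurable (f i)) :
    iIndepFun (fun i (ω : ι → Ω) => f i (ω i)) (Measure.pi ν) :=
  iIndepFun_pi fun i => (hf i).aemeasurable

theorem cnt_sub_eq_sum (keep : Fin n → Bool) {a b : ℕ} (hab : a ≤ b) (hb : b ≤ n) :
    (cnt keep b : ℝ) - cnt keep a =
      ∑ p ∈ Finset.univ.filter (fun p : Fin n => a ≤ p.val ∧ p.val < b), if keep p = true then 1 else 0 := by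
  induction b, hab using Nat.le_induction with
  | base =>
    rw [sub_self, Finset.sum_eq_zero]
    intro p hp
    rw [Finset.mem_filter] at hp
    omega
  | succ b hab ih =>
    have : Finset.univ.filter (fun p : Fin n => a ≤ p.val ∧ p.val < b + 1) =
        insert ⟨b, hb⟩ (Finset.univ.filter (fun p : Fin n => a ≤ p.val ∧ p.val < b)) := by
      ext p
      simp only [Finset.mem_filter, Finset.mem_univ, true_and, Finset.mem_insert, Fin.ext_iff]
      omega
    rw [this, Finset.sum_insert (by simp), ← ih (by omega), cnt, ext_succ hb]
    push_cast
    ring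

theorem card_filter_between {a b : ℕ} (hab : a ≤ b) (hb : b ≤ n) :
    (Finset.univ.filter (fun p : Fin n => a ≤ p.val ∧ p.val < b)).card = b - a := by
  have h := cnt_sub_eq_sum (n := n) (fun _ => true) hab hb
  have hc : ∀ p, cnt (fun _ : Fin n => true) p = p := by
    intro p
    induction p with
    | zero => rfl
    | succ p ih =>
      rw [cnt_succ_of, ih]
      unfold ext
      split_ifs <;> rfl
  rw [hc, hc] at h
  simp only [if_true, Finset.sum_const, nsmul_eq_mul, mul_one] at h
  have : ((Finset.univ.filter (fun p : Fin n => a ≤ p.val ∧ p.val < b)).card : ℝ) = ((b - a : ℕ) : ℝ) := by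
    rw [Nat.cast_sub hab, h]
  exact_mod_cast this

theorem hasSubgaussianMGF_cnt {a b : ℕ} (hab : a ≤ b) (hb : b ≤ n) :
    HasSubgaussianMGF (fun k : Fin n → Bool => ((cnt k b : ℝ) - cnt k a) - (1 - (δ : ℝ)) * ((b : ℝ) - a))
      (((b - a : ℕ) : NNReal) / 4) (keepLaw n δ) := by
  have h := HasSubgaussianMGF.sum_of_iIndepFun (μ := keepLaw n δ)
    (X := fun (p : Fin n) (k : Fin n → Bool) => (if k p = true then 1 else 0) - (1 - (δ : ℝ)))
    (c := fun _ => 1 / 4)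
    (s := Finset.univ.filter (fun p : Fin n => a ≤ p.val ∧ p.val < b))
    (iIndepFun_eval (fun _ : Fin n => bernoulliMeasure false true δ)
      (f := fun _ c => (if c = true then 1 else 0) - (1 - (δ : ℝ))) fun _ => Measurable.of_discrete)
    (fun p _ => hasSubgaussianMGF_bit p)
  convert h using 1
  · funext k
    rw [Finset.sum_sub_distrib, Finset.sum_const, card_filter_between hab hb, cnt_sub_eq_sum k hab hb,
      nsmul_eq_mul, Nat.cast_sub hab]
    ring
  · rw [Finset.sum_const, card_filter_between hab hb, nsmul_eq_mul]
    ring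

theorem measureReal_abs_ge_le {Ω : Type*} [MeasurableSpace Ω] {μ : Measure Ω} {X : Ω → ℝ} {c : NNReal}
    [IsFiniteMeasure μ]
    (h : HasSubgaussianMGF X c μ) {ε : ℝ} (hε : 0 ≤ ε) :
    μ.real {ω | ε ≤ |X ω|} ≤ 2 * Real.exp (-ε ^ 2 / (2 * c)) := by
  have h1 := h.measure_ge_le hε
  have h2 := h.neg.measure_ge_le hε
  calc μ.real {ω | ε ≤ |X ω|} ≤ μ.real ({ω | ε ≤ X ω} ∪ {ω | ε ≤ (-X) ω}) := by
        refine measureReal_mono ?_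
        intro ω hω
        rcases le_abs.1 (show ε ≤ |X ω| from hω) with h | h
        · exact Or.inl h
        · exact Or.inr h
    _ ≤ _ := (measureReal_union_le _ _).trans (by linarith)

/-- A union bound over all intervals, with Hoeffding's inequality for each. -/
theorem measureReal_not_concentrated_le {D l : ℕ} (hD : 1 ≤ D) (hl : 1 ≤ l) :
    (keepLaw n δ).real {k | ¬ Concentrated (δ : ℝ) D l k} ≤
      (n + 1) ^ 2 * (2 * Real.exp (-(2 * l / (128 * D) ^ 2))) := by
  have hsub : {k : Fin n → Bool | ¬ Concentrated (δ : ℝ) D l k} ⊆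
      ⋃ z ∈ ((Finset.range (n + 1)) ×ˢ (Finset.range (n + 1))).filter (fun z : ℕ × ℕ => z.1 ≤ z.2),
        {k | max ((z.2 : ℝ) - z.1) l / (128 * D) ≤
          |((cnt k z.2 : ℝ) - cnt k z.1) - (1 - (δ : ℝ)) * ((z.2 : ℝ) - z.1)|} := by
    intro k hk
    simp only [Set.mem_ofPred_eq, Concentrated] at hk
    push Not at hk
    obtain ⟨a, b, hab, hb, h⟩ := hk
    simp only [Set.mem_iUnion]
    refine ⟨(a, b), by simp; omega, ?_⟩
    have hD' : (0 : ℝ) < 128 * D := by positivity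
    simp only [Set.mem_ofPred_eq]
    rw [div_le_iff₀ hD', mul_comm]
    exact h.le
  refine (measureReal_mono hsub (measure_ne_top _ _)).trans ((measureReal_biUnion_finset_le _ _).trans ?_)
  have hterm : ∀ z ∈ ((Finset.range (n + 1)) ×ˢ (Finset.range (n + 1))).filter
      (fun z : ℕ × ℕ => z.1 ≤ z.2), (keepLaw n δ).real {k | max ((z.2 : ℝ) - z.1) l / (128 * D) ≤
          |((cnt k z.2 : ℝ) - cnt k z.1) - (1 - (δ : ℝ)) * ((z.2 : ℝ) - z.1)|} ≤
      2 * Real.exp (-(2 * l / (128 * D) ^ 2)) := by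
    rintro ⟨a, b⟩ hz
    simp only [Finset.mem_filter, Finset.mem_product, Finset.mem_range] at hz
    obtain ⟨⟨-, hb⟩, hab⟩ := hz
    have hl' : (1 : ℝ) ≤ l := by exact_mod_cast hl
    have hmax : (0 : ℝ) ≤ max ((b : ℝ) - a) l := le_trans (by linarith) (le_max_right _ _)
    rcases hab.eq_or_lt with rfl | hlt
    · have : {k : Fin n → Bool | max ((a : ℝ) - a) l / (128 * D) ≤
          |((cnt k a : ℝ) - cnt k a) - (1 - (δ : ℝ)) * ((a : ℝ) - a)|} = ∅ := by
        ext k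
        simp only [sub_self, mul_zero, abs_zero, Set.mem_ofPred_eq, Set.mem_empty_iff_false, iff_false,
          not_le]
        rw [max_eq_right (by linarith)]
        positivity
      simp only [this, measureReal_empty]
      positivity
    · refine (measureReal_abs_ge_le (hasSubgaussianMGF_cnt hab (by omega)) (by positivity)).trans ?_
      have hba : (1 : ℝ) ≤ (b : ℝ) - a := by
        have : (a : ℝ) + 1 ≤ b := by exact_mod_cast hlt
        linarith
      have e : ((((b - a : ℕ) : NNReal) / 4 : NNReal) : ℝ) = ((b : ℝ) - a) / 4 := by
        rw [NNReal.coe_div, NNReal.coe_natCast, Nat.cast_sub hab]; norm_num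
      rw [e]
      have h1 := le_max_left ((b : ℝ) - a) l
      have h2 := le_max_right ((b : ℝ) - a) l
      generalize (b : ℝ) - a = y at *
      generalize max y (l : ℝ) = M at *
      have hy : 0 < y := by linarith
      -- The deviation is measured by `M = max y l`, so the exponent is proportional to `M² / y`,
      -- which is at least `l` uniformly in the length `y`.
      have h3 : (l : ℝ) * y ≤ M ^ 2 := by
        rw [sq]; gcongr
      gcongr
      rw [neg_div, neg_le_neg_iff, div_pow, div_div, div_le_div_iff₀ (by positivity) (by positivity)]
      have h4 : (0 : ℝ) < (128 * D) ^ 2 := by positivity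
      nlinarith
  refine (Finset.sum_le_card_nsmul _ _ _ hterm).trans ?_
  rw [nsmul_eq_mul]
  gcongr
  calc ((((Finset.range (n + 1)) ×ˢ (Finset.range (n + 1))).filter
      (fun z : ℕ × ℕ => z.1 ≤ z.2)).card : ℝ) ≤ (((Finset.range (n + 1)) ×ˢ (Finset.range (n + 1))).card : ℝ) := by
        exact_mod_cast Finset.card_filter_le _ _
    _ = (n + 1) ^ 2 := by
        rw [Finset.card_product, Finset.card_range]; push_cast; ring

open Classical in
/-- The number of traces in a bad set is not much larger than expected. -/
theorem measureReal_card_ge_le {N : ℕ} (S : Finset (Fin N)) (B : Set (Fin n → Bool)) {p ε : ℝ}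
    (hp : (keepLaw n δ).real B ≤ p) (hε : 0 ≤ ε) :
    (keepLaws N n δ).real {ω | (p + ε) * S.card ≤ ((S.filter fun a => ω a ∈ B).card : ℝ)} ≤
      Real.exp (-(2 * ε ^ 2 * S.card)) := by
  set q := (keepLaw n δ).real B
  have hbit : HasSubgaussianMGF (fun k : Fin n → Bool => (if k ∈ B then 1 else 0) - q) (1 / 4) (keepLaw n δ) := by
    have h := hasSubgaussianMGF_of_mem_Icc (μ := keepLaw n δ) (a := 0) (b := 1)
      (X := fun k : Fin n → Bool => if k ∈ B then 1 else 0) Measurable.of_discrete.aemeasurable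
      (ae_of_all _ fun k => by split_ifs <;> simp)
    have hmean : ∫ k, (if k ∈ B then (1 : ℝ) else 0) ∂(keepLaw n δ) = q := by
      have e : (fun k : Fin n → Bool => if k ∈ B then (1 : ℝ) else 0) = Set.indicator B fun _ => (1 : ℝ) := by
        funext k
        simp [Set.indicator_apply]
      rw [e, integral_indicator_const _ (Set.toFinite _).measurableSet]
      simp [q]
    rw [hmean] at h
    convert h using 1
    ext
    norm_num
  have hsum := HasSubgaussianMGF.measure_sum_ge_le_of_iIndepFun (μ := keepLaws N n δ)
    (X := fun (a : Fin N) (ω : Fin N → Fin n → Bool) => (if ω a ∈ B then 1 else 0) - q) (c := fun _ => 1 / 4)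
    (s := S) (ε := ε * S.card)
    (iIndepFun_eval (fun _ : Fin N => keepLaw n δ) (f := fun _ c => (if c ∈ B then 1 else 0) - q)
      fun _ => Measurable.of_discrete)
    (fun a _ => by
      have hmp := measurePreserving_eval (fun _ : Fin N => keepLaw n δ) a
      refine HasSubgaussianMGF.of_map (Y := Function.eval a)
        (X := fun k : Fin n → Bool => (if k ∈ B then 1 else 0) - q) hmp.measurable.aemeasurable ?_
      rw [keepLaws, hmp.map_eq]
      exact hbit)
    (by positivity)
  calc _ ≤ (keepLaws N n δ).real {ω | ε * S.card ≤ ∑ a ∈ S, ((if ω a ∈ B then (1 : ℝ) else 0) - q)} := by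
        refine measureReal_mono ?_
        intro ω hω
        simp only [Set.mem_ofPred_eq] at hω ⊢
        rw [Finset.sum_sub_distrib, Finset.sum_const, nsmul_eq_mul, Finset.sum_boole]
        have : (0 : ℝ) ≤ S.card := by positivity
        nlinarith
    _ ≤ _ := hsum
    _ = _ := by
        congr 1
        simp only [Finset.sum_const, nsmul_eq_mul]
        rcases Nat.eq_zero_or_pos S.card with h | h
        · simp [h]
        · have : (0 : ℝ) < S.card := by exact_mod_cast h
          push_cast
          field_simp
          ring

end keepLaw

/-! ### Events for a single trace -/

section single

variable {n D m : ℕ} {δ : unitInterval} {P : ℕ → ℕ}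

theorem measureReal_ext_eq_false_le (σ : Equiv.Perm (Fin n)) (p : ℕ) :
    (keepLaw n δ).real {k | ext (k ∘ σ) p = false} ≤ δ := by
  by_cases h : 1 ≤ p ∧ p ≤ n
  · have : {k : Fin n → Bool | ext (k ∘ σ) p = false} =
        {k | ∀ q ∈ ({σ ⟨p - 1, by omega⟩} : Finset (Fin n)), k q = false} := by
      ext k
      simp [ext, h]
    rw [this, keepLaw_real_forall_eq_false]
    simp
  · have : {k : Fin n → Bool | ext (k ∘ σ) p = false} = ∅ := by
      ext k
      simp [ext, h]
    rw [this, measureReal_empty]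
    exact δ.2.1

/-- Indices strictly between 0 and `i` belong to distinct proper positions, which are deleted
independently. The permutation `σ` is there to cover the reversed pattern as well. -/
theorem measureReal_subset_deleted_le (hP : StrictMono P) (h0 : P 0 = 0) (hm : P m = n + 1)
    (σ : Equiv.Perm (Fin n)) {i : ℕ} (hi : i ≤ m) {E : Finset ℤ} (hE : E ⊆ Finset.Ioo 0 (i : ℤ)) :
    (keepLaw n δ).real {k | E ⊆ deleted m P (k ∘ σ)} ≤ (δ : ℝ) ^ E.card := by
  classical
  set S := Finset.univ.filter fun p : Fin n => ∃ e ∈ E, P e.toNat = (σ.symm p).val + 1 with hS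
  have hpos : ∀ e ∈ E, 1 ≤ P e.toNat ∧ P e.toNat ≤ n := by
    intro e he
    have h1 := Finset.mem_Ioo.1 (hE he)
    have h2 := hP (by omega : 0 < e.toNat)
    have h3 := hP (by omega : e.toNat < m)
    omega
  have hcard : E.card ≤ S.card := by
    refine Finset.card_le_card_of_forall_subsingleton (fun e p => P e.toNat = (σ.symm p).val + 1) ?_ ?_
    · intro e he
      have h1 := hpos e he
      refine ⟨σ ⟨P e.toNat - 1, by omega⟩, ?_, ?_⟩
      · rw [hS, Finset.mem_filter]
        refine ⟨Finset.mem_univ _, e, he, ?_⟩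
        simp; omega
      · simp; omega
    · rintro p - e ⟨he, h1⟩ e' ⟨he', h2⟩
      have h3 := hP.injective (h1.trans h2.symm)
      have h4 := Finset.mem_Ioo.1 (hE he)
      have h5 := Finset.mem_Ioo.1 (hE he')
      omega
  calc (keepLaw n δ).real {k | E ⊆ deleted m P (k ∘ σ)}
      ≤ (keepLaw n δ).real {k | ∀ p ∈ S, k p = false} := by
        refine measureReal_mono ?_ (measure_ne_top _ _)
        intro k hk p hp
        obtain ⟨e, he, hep⟩ := (Finset.mem_filter.1 hp).2
        have h1 := (Finset.mem_filter.1 (hk he)).2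
        rw [hep, ext_succ (σ.symm p).2] at h1
        simpa using h1
    _ = (δ : ℝ) ^ S.card := keepLaw_real_forall_eq_false S
    _ ≤ (δ : ℝ) ^ E.card := pow_le_pow_of_le_one δ.2.1 δ.2.2 hcard

/-- Here both lines are `lineX`, so the diagonal matches exactly and `exists_cover` applies with `ε
= 2 / D`. A union bound over the cover gives the claim. -/
theorem measureReal_lags_le (hP : StrictMono P) (h0 : P 0 = 0) (hm : P m = n + 1)
    (σ : Equiv.Perm (Fin n)) {c : ℕ} (hc : 100 * (n + 1) ^ 5 ≤ 2 ^ c)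
    (hD : 2000 * (4 * c + 1) ^ 2 ≤ D) (hδ : (δ : ℝ) ≤ hitWeight / 2) {i : ℕ} (hi : i ≤ m) :
    (keepLaw n δ).real {k | Lags (δ : ℝ) D m P (k ∘ σ) i} ≤ 1 / 20 := by
  have hD0 : (0 : ℝ) < D := by
    have : 0 < D := lt_of_lt_of_le (by positivity) hD
    exact_mod_cast this
  rcases Nat.eq_zero_or_pos i with rfl | hi0
  · have : {k : Fin n → Bool | Lags (δ : ℝ) D m P (k ∘ σ) 0} = ∅ := by
      ext k
      simp only [Set.mem_ofPred_eq, Set.mem_empty_iff_false, iff_false]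
      intro h
      have := Emb.le_right h
      simp at this
    rw [this, measureReal_empty]
    norm_num
  have hmn : m ≤ n + 1 := by
    have := hP.id_le m
    rwa [hm] at this
  have hδ1 : (δ : ℝ) < 1 := by
    have : hitWeight / 2 < 1 := by norm_num [hitWeight]
    linarith
  have hX := lineX_strictMono hδ1 (n := n) (m := m) hP
  obtain ⟨F, hF1, hF2, hF3⟩ := exists_cover (ε := 2 / D) (δ := δ) (N := n + 1) hX hX hc (by positivity)
    (by
      rw [div_mul_eq_mul_div, div_le_one hD0]
      have : (2000 * (4 * c + 1) ^ 2 : ℝ) ≤ D := by exact_mod_cast hD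
      push_cast
      linarith)
    δ.2.1 hδ (by
      intro u _ _
      have := hX (by omega : u - 1 < u)
      unfold Matches
      rw [sub_self, abs_zero]
      exact mul_nonneg (by positivity) (by linarith)) (r := i) (by omega) (by push_cast; omega)
  have hsub : {k : Fin n → Bool | Lags (δ : ℝ) D m P (k ∘ σ) i} ⊆
      ⋃ E ∈ F, {k | E ⊆ deleted m P (k ∘ σ)} := by
    intro k hk
    obtain ⟨E, h1, h2⟩ := hF3 _ hk
    simp only [Set.mem_iUnion]
    exact ⟨E, h1, h2⟩
  refine (measureReal_mono hsub (measure_ne_top _ _)).trans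
    ((measureReal_biUnion_finset_le _ _).trans (le_trans ?_ hF2))
  exact Finset.sum_le_sum fun E hE => measureReal_subset_deleted_le hP h0 hm σ hi (hF1 E hE)

/-- The numbers of retained zeros in a gap, counted when the gap is visible. -/
theorem hasSubgaussianMGF_visible {x : Fin n → Bool} (hx : IsOnes x m P) (Y Y' : ℕ → ℕ) {i : ℕ}
    (him : i < m) :
    HasSubgaussianMGF (fun k : Fin n → Bool => if GapVisible D m P Y Y' x k i then
      ((cnt k (P (i + 1) - 1) : ℝ) - cnt k (P i)) - (1 - (δ : ℝ)) * ((P (i + 1) - 1 - P i : ℕ) : ℝ) else 0)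
      ((n : NNReal) / 4) (keepLaw n δ) := by
  have hle := hx.le_last (by omega : i + 1 ≤ m)
  have hlt := hx.mono (by omega : i < i + 1)
  set W : (Fin n → Bool) → ℝ := fun k => ((cnt k (P (i + 1) - 1) : ℝ) - cnt k (P i)) -
    (1 - (δ : ℝ)) * ((P (i + 1) - 1 - P i : ℕ) : ℝ) with hW
  have hWs : HasSubgaussianMGF W (((P (i + 1) - 1 - P i : ℕ) : NNReal) / 4) (keepLaw n δ) := by
    have h := hasSubgaussianMGF_cnt (n := n) (δ := δ) (a := P i) (b := P (i + 1) - 1) (by omega) (by omega)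
    convert h using 4
    exact Nat.cast_sub (by omega)
  have hWn : ∀ t, mgf W (keepLaw n δ) t ≤ Real.exp ((n : ℝ) / 4 * t ^ 2 / 2) := by
    intro t
    refine (hWs.mgf_le t).trans ?_
    have : ((P (i + 1) - 1 - P i : ℕ) : ℝ) ≤ n := by exact_mod_cast (by omega)
    rw [NNReal.coe_div, NNReal.coe_natCast, NNReal.coe_ofNat]
    gcongr
  have hext : ∀ (p : ℕ) (u v : Fin n → Bool), (∀ h : 1 ≤ p ∧ p ≤ n, u ⟨p - 1, by omega⟩ = v ⟨p - 1, by omega⟩) →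
      ext u p = ext v p := by
    intro p u v h
    unfold ext
    split_ifs with h1
    · exact h h1
    · rfl
  refine ⟨fun t => Integrable.of_finite, fun t => ?_⟩
  rw [NNReal.coe_div, NNReal.coe_natCast]
  -- Visibility is decided outside the gap and the deviation inside it. Fix the outside: either the
  -- deviation is replaced by 0, whose moment generating function is 1, or it is the full deviation
  -- with its Hoeffding bound.
  have key := lintegral_diag_le (fun _ : Fin n => bernoulliMeasure false true δ)
    (fun q => q.val + 1 ≤ P i ∨ P (i + 1) ≤ q.val + 1)
    (fun u v => ENNReal.ofReal (Real.exp (t * if GapVisible D m P Y Y' x u i then W v else 0)))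
    (ENNReal.ofReal (Real.exp ((n : ℝ) / 4 * t ^ 2 / 2))) (by
      intro u u' v h
      have := GapVisible.congr (m := m) (D := D) (Y := Y) (Y' := Y') (x := x) hle (keep := u) (keep' := u') fun q hq =>
        hext q u u' fun h1 => h _ (by simp only; omega)
      simp only [if_congr this rfl rfl]) (by
      intro u v v' h
      have : W v = W v' := by
        simp only [hW]
        congr 1
        rw [cnt_sub_eq_sum v (by omega) (by omega), cnt_sub_eq_sum v' (by omega) (by omega)]
        refine Finset.sum_congr rfl fun p hp => ?_
        rw [Finset.mem_filter] at hp
        rw [h p (by omega)]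
      simp only [this]) (by
      intro u
      by_cases hu : GapVisible D m P Y Y' x u i
      · simp only [hu, if_true]
        rw [← ofReal_integral_eq_lintegral_ofReal Integrable.of_finite (ae_of_all _ fun _ => (Real.exp_pos _).le)]
        exact ENNReal.ofReal_le_ofReal (hWn t)
      · simp only [hu, if_false, mul_zero, Real.exp_zero]
        rw [lintegral_const, measure_univ, mul_one]
        refine ENNReal.ofReal_le_ofReal ?_
        rw [← Real.exp_zero]
        exact Real.exp_le_exp.2 (by positivity))
  rw [mgf, keepLaw, integral_eq_lintegral_of_nonneg_ae (ae_of_all _ fun _ => (Real.exp_pos _).le)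
    Measurable.of_discrete.aestronglyMeasurable]
  exact ENNReal.toReal_le_of_le_ofReal (Real.exp_pos _).le key

/-- A sum over `S` has variance proxy |S| n / 4, and a deviation |S| / 10 then has exponent |S| /
(50 n). This is why about n log n traces are needed. -/
theorem measureReal_abs_sum_ge_le {N : ℕ} (S : Finset (Fin N)) {X : (Fin n → Bool) → ℝ} (hn : 1 ≤ n)
    (h : HasSubgaussianMGF X ((n : NNReal) / 4) (keepLaw n δ)) :
    (keepLaws N n δ).real {ω | (S.card : ℝ) / 10 ≤ |∑ a ∈ S, X (ω a)|} ≤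
      2 * Real.exp (-(S.card / (50 * n))) := by
  have hsum := HasSubgaussianMGF.sum_of_iIndepFun (μ := keepLaws N n δ)
    (X := fun (a : Fin N) (ω : Fin N → Fin n → Bool) => X (ω a)) (c := fun _ => (n : NNReal) / 4) (s := S)
    (iIndepFun_eval (fun _ : Fin N => keepLaw n δ) (f := fun _ c => X c) fun _ => Measurable.of_discrete)
    (fun a _ => by
      have hmp := measurePreserving_eval (fun _ : Fin N => keepLaw n δ) a
      refine HasSubgaussianMGF.of_map (Y := Function.eval a) (X := X) hmp.measurable.aemeasurable ?_
      rw [keepLaws, hmp.map_eq]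
      exact h)
  refine (measureReal_abs_ge_le hsum (by positivity)).trans (le_of_eq ?_)
  congr 2
  have hn' : (0 : ℝ) < n := by exact_mod_cast hn
  simp only [Finset.sum_const, nsmul_eq_mul]
  rcases Nat.eq_zero_or_pos S.card with h | h
  · simp [h]
  · have : (0 : ℝ) < S.card := by exact_mod_cast h
    push_cast
    field_simp
    ring

end single

/-- The retention patterns, with patterns that retain nothing appended. -/
def extendKeeps {N n : ℕ} (ω : Fin N → Fin n → Bool) (a : ℕ) : Fin n → Bool :=
  if h : a < N then ω ⟨a, h⟩ else fun _ => false

theorem trace_extendKeeps {N n : ℕ} (x : Fin n → Bool) (ω : Fin N → Fin n → Bool) (a : ℕ) :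
    trace x (extendKeeps ω a) = if h : a < N then trace x (ω ⟨a, h⟩) else [] := by
  unfold extendKeeps
  split_ifs
  · rfl
  · simp [trace]

/-- The indices from `lo` to `hi`. -/
def between (N lo hi : ℕ) : Finset (Fin N) := Finset.univ.filter fun a => lo ≤ a.val ∧ a.val < hi

theorem sum_Ico_extendKeeps {M : Type*} [AddCommMonoid M] {N n lo hi : ℕ} (h : hi ≤ N)
    (ω : Fin N → Fin n → Bool) (f : (Fin n → Bool) → M) :
    ∑ a ∈ Finset.Ico lo hi, f (extendKeeps ω a) = ∑ a ∈ between N lo hi, f (ω a) := by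
  have : Finset.Ico lo hi = (between N lo hi).map Fin.valEmbedding := by
    ext a
    simp only [between, Finset.mem_Ico, Finset.mem_map, Finset.mem_filter, Finset.mem_univ, true_and,
      Fin.valEmbedding_apply]
    constructor
    · intro ha
      exact ⟨⟨a, by omega⟩, ha, rfl⟩
    · rintro ⟨b, hb, rfl⟩
      exact hb
  rw [this, Finset.sum_map]
  refine Finset.sum_congr rfl fun a _ => ?_
  simp [extendKeeps]

open Classical in
theorem card_filter_extendKeeps {N n lo hi : ℕ} (h : hi ≤ N) (ω : Fin N → Fin n → Bool)
    (Q : (Fin n → Bool) → Prop) :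
    ((Finset.Ico lo hi).filter fun a => Q (extendKeeps ω a)).card =
      ((between N lo hi).filter fun a => Q (ω a)).card := by
  rw [Finset.card_filter, Finset.card_filter]
  exact sum_Ico_extendKeeps h ω fun k => if Q k then 1 else 0

theorem card_between {N lo hi : ℕ} (h : hi ≤ N) : (between N lo hi).card = hi - lo := by
  have := sum_Ico_extendKeeps (n := 0) (lo := lo) h (fun _ _ => false) fun _ => 1
  simpa using this.symm

/-- The `i`-th and the next one are retained, and the scan does not lag. -/
def IsClean {n : ℕ} (δ : ℝ) (D m : ℕ) (P : ℕ → ℕ) (i : ℕ) (keep : Fin n → Bool) : Prop :=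
  ext keep (P i) = true ∧ ext keep (P (i + 1)) = true ∧ ¬ Lags δ D m P keep i

/-- The scan does not lag from either side of the `i`-th gap. -/
def IsCleanGap {n : ℕ} (δ : ℝ) (D m : ℕ) (P : ℕ → ℕ) (i : ℕ) (keep : Fin n → Bool) : Prop :=
  IsClean δ D m P i keep ∧ ¬ Lags δ D m (revOnes n m P) (keep ∘ Fin.rev) (m - (i + 1))

/-- The deviation of the number of retained zeros in the `i`-th gap from its mean, when the gap is
visible. -/
noncomputable def visibleDeviation {n : ℕ} (δ : ℝ) (D m : ℕ) (P Y Y' : ℕ → ℕ) (x : Fin n → Bool) (i : ℕ)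
    (keep : Fin n → Bool) : ℝ :=
  if GapVisible D m P Y Y' x keep i then
    ((cnt keep (P (i + 1) - 1) : ℝ) - cnt keep (P i)) - (1 - δ) * ((P (i + 1) - 1 - P i : ℕ) : ℝ) else 0

/-! ### Correctness on the good event -/

section deterministic

variable {n N L l m : ℕ} {δ : ℝ} {P : ℕ → ℕ} {x : Fin n → Bool} {ω : Fin N → Fin n → Bool}

open Classical in
theorem card_lt_of_few {lo hi : ℕ} (h : hi ≤ N) (Q : (Fin n → Bool) → Prop) :
    ((Finset.Ico lo hi).filter fun a => Q (extendKeeps ω a)).card +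
      ((between N lo hi).filter fun a => ω a ∈ {k | ¬ Q k}).card = hi - lo := by
  rw [card_filter_extendKeeps h, ← card_between h]
  exact Finset.card_filter_add_card_filter_not _

open Classical in
theorem coarseY_extendKeeps (hx : IsOnes x m P) (hδ : δ < 1) {D : ℕ} (hD : 2 ≤ D) (hN : n ≤ N)
    (hg : ∀ a, GapsClose δ D m P (ω a))
    (hclean : ∀ i < m, (((between N 0 n).filter fun a => ω a ∈ {k | ¬ IsClean δ D m P i k}).card : ℝ) <
      (6 / 100 + 2 / 5) * (between N 0 n).card) :
    IsAccurate δ n D m m P (coarseY n D (fun a => trace x (extendKeeps ω a)) (n + 2)) ∧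
      numOnes n (coarseY n D (fun a => trace x (extendKeeps ω a)) (n + 2)) = m := by
  have hm := hx.le_succ
  have := coarseY_spec (keeps := extendKeeps ω) hx hδ hD (fun a ha => by
    rw [extendKeeps, dif_pos (by omega)]
    exact hg _) (fun i hi => by
    have h1 := card_lt_of_few (ω := ω) (lo := 0) hN (IsClean δ D m P i)
    have h2 := hclean i hi
    rw [card_between hN] at h2
    rw [Nat.sub_zero] at h1 h2
    have h3 : (((Finset.Ico 0 n).filter fun a => IsClean δ D m P i (extendKeeps ω a)).card : ℝ) +
      ((between N 0 n).filter fun a => ω a ∈ {k | ¬ IsClean δ D m P i k}).card = n := by exact_mod_cast h1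
    -- Fewer than 46 per cent of the first batch are bad, which leaves a strict majority.
    have h4 : (n : ℝ) < 2 * ((Finset.Ico 0 n).filter fun a => IsClean δ D m P i (extendKeeps ω a)).card := by
      linarith [(Nat.cast_nonneg n : (0 : ℝ) ≤ n)]
    have h5 : n < 2 * ((Finset.Ico 0 n).filter fun a => IsClean δ D m P i (extendKeeps ω a)).card := by
      exact_mod_cast h4
    rw [Finset.range_eq_Ico]
    convert h5 using 4
    exact Iff.rfl) (n + 2)
  rw [min_eq_right (by omega)] at this
  exact ⟨this.1, numOnes_eq hm this.2.1 this.2.2 this.1.zero⟩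

open Classical in
theorem reconstruct_extendKeeps (hx : IsOnes x m P) (hsep : IsSeparated L x) (hn : 1 ≤ n) (hN : n < N)
    (hδ0 : 0 ≤ δ) (hδ : δ ≤ 1 / 100) (hD : 2 ≤ errScale n N) (hl : l ≤ L) (hln : l ≤ n)
    (hDn : 128 * errScale n N ≤ n)
    (h1 : ∀ a, Concentrated δ (errScale n N) l (ω a))
    (h2 : ∀ i < m, (((between N 0 n).filter fun a => ω a ∈
      {k | ¬ IsClean δ (errScale n N) m P i k}).card : ℝ) < (6 / 100 + 2 / 5) * (between N 0 n).card)
    (h3 : ∀ i < m, (((between N 0 n).filter fun a => ω a ∈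
      {k | ¬ IsClean δ (errScale n N) m (revOnes n m P) i (k ∘ Fin.rev)}).card : ℝ) <
        (6 / 100 + 2 / 5) * (between N 0 n).card)
    (h4 : ∀ i < m, i + 1 < m → (((between N n N).filter fun a => ω a ∈
      {k | ¬ IsCleanGap δ (errScale n N) m P i k}).card : ℝ) < (11 / 100 + 9 / 100) * (between N n N).card)
    (h5 : ∀ i < m, |∑ a ∈ between N n N, visibleDeviation δ (errScale n N) m P
      (coarseY n (errScale n N) (fun a => trace x (extendKeeps ω a)) (n + 2))
      (coarseY n (errScale n N) (fun a => (trace x (extendKeeps ω a)).reverse) (n + 2)) x i (ω a)| < ((between N n N).card : ℝ) / 10)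
    (h6 : |∑ a ∈ between N n N, ((cnt (ω a) n : ℝ) - cnt (ω a) 0 - (1 - δ) * (n - (0 : ℕ)))| <
      ((between N n N).card : ℝ) / 10) (t : Fin n) :
    reconstruct n N (fun a => trace x (extendKeeps ω a)) t = (x t).toNat := by
  set D := errScale n N with hDdef
  have hδ1 : δ < 1 := by linarith
  have hg : ∀ a, GapsClose δ D m P (ω a) := fun a =>
    (h1 a).gapsClose hx hsep hδ0 (by linarith) hD hl hln hDn
  have hg' : ∀ a, GapsClose δ D m (revOnes n m P) (ω a ∘ Fin.rev) := fun a =>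
    (h1 a).rev.gapsClose hx.rev hsep.rev hδ0 (by linarith) hD hl hln hDn
  obtain ⟨hY, hnum⟩ := coarseY_extendKeeps hx hδ1 hD hN.le hg h2
  have hrevk : ∀ a, extendKeeps ω a ∘ Fin.rev = extendKeeps (fun b => ω b ∘ Fin.rev) a := by
    intro a
    unfold extendKeeps
    split_ifs <;> rfl
  have hY' := (coarseY_extendKeeps (ω := fun b => ω b ∘ Fin.rev) hx.rev hδ1 hD hN.le hg' h3).1
  have hys : (fun a => (trace x (extendKeeps ω a)).reverse) =
      fun a => trace (x ∘ Fin.rev) (extendKeeps (fun b => ω b ∘ Fin.rev) a) := by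
    funext a
    rw [reverse_trace, hrevk]
  rw [← hys] at hY'
  refine reconstruct_eq hx hnum (fun i him => ?_) t
  set Y := coarseY n D (fun a => trace x (extendKeeps ω a)) (n + 2)
  set Y' := coarseY n D (fun a => (trace x (extendKeeps ω a)).reverse) (n + 2)
  have hgk : ∀ a < N, GapsClose δ D m P (extendKeeps ω a) := by
    intro a ha
    rw [extendKeeps, dif_pos ha]
    exact hg _
  have hgk' : ∀ a < N, GapsClose δ D m (revOnes n m P) (extendKeeps ω a ∘ Fin.rev) := by
    intro a ha
    rw [extendKeeps, dif_pos ha]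
    exact hg' _
  have hcard := card_between (N := N) (lo := n) le_rfl
  refine gapEstimate_eq (δ := δ) hx hnum hn hN hY hY' hδ hD hgk hgk' him ?_ ?_ ?_
  · have e1 := card_lt_of_few (ω := ω) (lo := n) le_rfl (IsCleanGap δ D m P i)
    have e2 := h4 i (by omega) him
    rw [hcard] at e2
    have e3 : (((Finset.Ico n N).filter fun a => IsCleanGap δ D m P i (extendKeeps ω a)).card : ℝ) +
      ((between N n N).filter fun a => ω a ∈ {k | ¬ IsCleanGap δ D m P i k}).card = (N - n : ℕ) := by
      exact_mod_cast e1
    -- Clean gaps are visible, and fewer than 20 per cent of the second batch are not clean; this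
    -- gives the fraction 4/5 that rounding requires.
    have e4 : ((Finset.Ico n N).filter fun a => IsCleanGap δ D m P i (extendKeeps ω a)).card ≤
        visibleCount n N D m P Y Y' x (extendKeeps ω) i := by
      refine Finset.card_le_card fun a ha => ?_
      rw [Finset.mem_filter] at ha ⊢
      obtain ⟨ha1, ⟨c1, c2, c3⟩, c4⟩ := ha
      rw [Finset.mem_Ico] at ha1
      exact ⟨Finset.mem_Ico.2 ha1, gapVisible_of hx hY hY' hδ1 hD (hgk a ha1.2) (hgk' a ha1.2) him c1 c2 c3 c4⟩
    have e5 : (((Finset.Ico n N).filter fun a => IsCleanGap δ D m P i (extendKeeps ω a)).card : ℝ) ≤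
        visibleCount n N D m P Y Y' x (extendKeeps ω) i := by exact_mod_cast e4
    linarith
  · have := (h5 i (by omega)).le
    rw [hcard] at this
    exact (congrArg abs (sum_Ico_extendKeeps le_rfl ω (visibleDeviation δ D m P Y Y' x i))).trans_le this
  · have := h6.le
    rw [hcard] at this
    rw [sum_Ico_extendKeeps le_rfl ω fun k => (cnt k n : ℝ) - (1 - δ) * n]
    simpa [cnt] using this

end deterministic

/-! ### Probability of the bad events -/

section probabilistic

variable {n N L l m : ℕ} {δ : unitInterval} {P : ℕ → ℕ} {x : Fin n → Bool}

theorem measureReal_not_clean_le {D : ℕ} (hx : IsOnes x m P) (σ : Equiv.Perm (Fin n)) {c : ℕ}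
    (hc : 100 * (n + 1) ^ 5 ≤ 2 ^ c) (hD : 2000 * (4 * c + 1) ^ 2 ≤ D) (hδ : (δ : ℝ) ≤ hitWeight / 2)
    {i : ℕ} (hi : i ≤ m) :
    (keepLaw n δ).real {k | ¬ IsClean (δ : ℝ) D m P i (k ∘ σ)} ≤ 6 / 100 := by
  have hsub : {k : Fin n → Bool | ¬ IsClean (δ : ℝ) D m P i (k ∘ σ)} ⊆
      ({k | ext (k ∘ σ) (P i) = false} ∪ {k | ext (k ∘ σ) (P (i + 1)) = false}) ∪
        {k | Lags (δ : ℝ) D m P (k ∘ σ) i} := by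
    intro k hk
    by_contra hc
    simp only [Set.mem_union, Set.mem_ofPred_eq, not_or, Bool.not_eq_false] at hc
    exact hk ⟨hc.1.1, hc.1.2, hc.2⟩
  have h1 := measureReal_ext_eq_false_le (δ := δ) σ (P i)
  have h2 := measureReal_ext_eq_false_le (δ := δ) σ (P (i + 1))
  have h3 := measureReal_lags_le hx.mono hx.zero hx.last σ hc hD hδ hi
  have h4 : hitWeight ≤ 1 / 100 := by norm_num [hitWeight]
  have h5 := measureReal_union_le (μ := keepLaw n δ) {k | ext (k ∘ σ) (P i) = false}
    {k | ext (k ∘ σ) (P (i + 1)) = false}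
  have h6 := (measureReal_mono hsub (measure_ne_top (keepLaw n δ) _)).trans (measureReal_union_le _ _)
  linarith

theorem measureReal_not_cleanGap_le {D : ℕ} (hx : IsOnes x m P) {c : ℕ}
    (hc : 100 * (n + 1) ^ 5 ≤ 2 ^ c) (hD : 2000 * (4 * c + 1) ^ 2 ≤ D) (hδ : (δ : ℝ) ≤ hitWeight / 2)
    {i : ℕ} (hi : i ≤ m) :
    (keepLaw n δ).real {k | ¬ IsCleanGap (δ : ℝ) D m P i k} ≤ 11 / 100 := by
  have hsub : {k : Fin n → Bool | ¬ IsCleanGap (δ : ℝ) D m P i k} ⊆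
      {k | ¬ IsClean (δ : ℝ) D m P i (k ∘ (1 : Equiv.Perm (Fin n)))} ∪
        {k | Lags (δ : ℝ) D m (revOnes n m P) (k ∘ Fin.revPerm) (m - (i + 1))} := by
    intro k hk
    by_contra hc
    simp only [Set.mem_union, Set.mem_ofPred_eq, not_or, not_not] at hc
    exact hk ⟨hc.1, hc.2⟩
  have h1 := measureReal_not_clean_le hx 1 hc hD hδ hi
  have h3 := measureReal_lags_le hx.rev.mono hx.rev.zero hx.rev.last Fin.revPerm hc hD hδ
    (by omega : m - (i + 1) ≤ m)
  have h6 := (measureReal_mono hsub (measure_ne_top (keepLaw n δ) _)).trans (measureReal_union_le _ _)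
  linarith

/-- The pictures are functions of the first `n` traces and the sum runs over the others, so for the
estimate the pictures may be frozen. -/
theorem measureReal_sum_visible_le (hx : IsOnes x m P) (hn : 1 ≤ n) (D : ℕ) {i : ℕ} (hi : i < m) :
    (keepLaws N n δ).real {ω | ((between N n N).card : ℝ) / 10 ≤
      |∑ a ∈ between N n N, visibleDeviation δ D m P
      (coarseY n D (fun a => trace x (extendKeeps ω a)) (n + 2))
      (coarseY n D (fun a => (trace x (extendKeeps ω a)).reverse) (n + 2)) x i (ω a)|} ≤
      2 * Real.exp (-((between N n N).card / (50 * n))) := by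
  refine measureReal_diag_le (fun _ : Fin N => keepLaw n δ) (fun a => a.val < n)
    (fun ω η => ((between N n N).card : ℝ) / 10 ≤
      |∑ a ∈ between N n N, visibleDeviation δ D m P
      (coarseY n D (fun a => trace x (extendKeeps ω a)) (n + 2))
      (coarseY n D (fun a => (trace x (extendKeeps ω a)).reverse) (n + 2)) x i (η a)|) (by positivity) ?_ ?_ ?_
  · intro ω ω' η h
    have hk : ∀ a < n, extendKeeps ω a = extendKeeps ω' a := by
      intro a ha
      unfold extendKeeps
      split_ifs with h1
      · exact h ⟨a, h1⟩ ha
      · rfl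
    rw [coarseY_congr (zs := fun a => trace x (extendKeeps ω' a)) fun a ha => by rw [hk a ha],
      coarseY_congr (ys := fun a => (trace x (extendKeeps ω a)).reverse)
        (zs := fun a => (trace x (extendKeeps ω' a)).reverse) fun a ha => by rw [hk a ha]]
  · intro ω η η' h
    have : ∀ a ∈ between N n N, η a = η' a := by
      intro a ha
      refine h a ?_
      rw [between, Finset.mem_filter] at ha
      omega
    have hs : ∀ f : (Fin n → Bool) → ℝ, ∑ a ∈ between N n N, f (η a) = ∑ a ∈ between N n N, f (η' a) :=
      fun f => Finset.sum_congr rfl fun a ha => by rw [this a ha]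
    rw [hs]
  · intro ω
    exact measureReal_abs_sum_ge_le (between N n N) hn (hasSubgaussianMGF_visible hx _ _ hi)

open Classical in
/-- The algorithm fails with small probability. -/
theorem measureReal_failure_le (hsep : IsSeparated L x) (hn : 1 ≤ n) (hN : n < N)
    (hδ : (δ : ℝ) ≤ hitWeight / 2) (hl0 : 1 ≤ l) (hl : l ≤ L) (hln : l ≤ n)
    (hDn : 128 * errScale n N ≤ n) {c : ℕ} (hc : 100 * (n + 1) ^ 5 ≤ 2 ^ c)
    (hD : 2000 * (4 * c + 1) ^ 2 ≤ errScale n N) :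
    (keepLaws N n δ).real {ω | ¬ ∀ t : Fin n,
      reconstruct n N (fun a => trace x (extendKeeps ω a)) t = (x t).toNat} ≤
      N * ((n + 1) ^ 2 * (2 * Real.exp (-(2 * l / (128 * errScale n N) ^ 2)))) +
      2 * ((n + 1) * Real.exp (-(2 * (2 / 5) ^ 2 * n))) +
      (n + 1) * Real.exp (-(2 * (9 / 100) ^ 2 * (N - n : ℕ))) +
      (n + 2) * (2 * Real.exp (-((N - n : ℕ) / (50 * n)))) := by
  obtain ⟨m, P, hx⟩ := exists_isOnes x
  have hm := hx.le_succ
  have hm' : (m : ℝ) ≤ n + 1 := by exact_mod_cast hm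
  have hδ' : (δ : ℝ) ≤ 1 / 100 := hδ.trans (by norm_num [hitWeight])
  have hD2 : 2 ≤ errScale n N := by
    have : 1 ≤ (4 * c + 1) ^ 2 := Nat.one_le_pow _ _ (by omega)
    omega
  set D := errScale n N with hDdef
  set μ := keepLaws N n δ
  -- The six ways to fail: lengths not concentrated, too few clean traces for the picture from the
  -- left or from the right, too few visible gaps, a biased count of zeros, and a biased total
  -- length.
  set E1 : Set (Fin N → Fin n → Bool) := ⋃ a ∈ (Finset.univ : Finset (Fin N)),
    {ω | ω a ∈ {k | ¬ Concentrated (δ : ℝ) D l k}}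
  set E2 : Set (Fin N → Fin n → Bool) := ⋃ i ∈ Finset.range m, {ω | (6 / 100 + 2 / 5) *
    ((between N 0 n).card : ℝ) ≤ (((between N 0 n).filter fun a => ω a ∈
      {k | ¬ IsClean (δ : ℝ) D m P i (k ∘ (1 : Equiv.Perm (Fin n)))}).card : ℝ)}
  set E3 : Set (Fin N → Fin n → Bool) := ⋃ i ∈ Finset.range m, {ω | (6 / 100 + 2 / 5) *
    ((between N 0 n).card : ℝ) ≤ (((between N 0 n).filter fun a => ω a ∈
      {k | ¬ IsClean (δ : ℝ) D m (revOnes n m P) i (k ∘ Fin.revPerm)}).card : ℝ)}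
  set E4 : Set (Fin N → Fin n → Bool) := ⋃ i ∈ Finset.range m, {ω | (11 / 100 + 9 / 100) *
    ((between N n N).card : ℝ) ≤ (((between N n N).filter fun a => ω a ∈
      {k | ¬ IsCleanGap (δ : ℝ) D m P i k}).card : ℝ)}
  set E5 : Set (Fin N → Fin n → Bool) := ⋃ i ∈ Finset.range m, {ω | ((between N n N).card : ℝ) / 10 ≤
      |∑ a ∈ between N n N, visibleDeviation δ D m P
      (coarseY n D (fun a => trace x (extendKeeps ω a)) (n + 2))
      (coarseY n D (fun a => (trace x (extendKeeps ω a)).reverse) (n + 2)) x i (ω a)|}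
  set E6 : Set (Fin N → Fin n → Bool) := {ω | ((between N n N).card : ℝ) / 10 ≤
    |∑ a ∈ between N n N, ((cnt (ω a) n : ℝ) - cnt (ω a) 0 - (1 - (δ : ℝ)) * (n - (0 : ℕ)))|}
  have hsub : {ω : Fin N → Fin n → Bool | ¬ ∀ t : Fin n,
      reconstruct n N (fun a => trace x (extendKeeps ω a)) t = (x t).toNat} ⊆
      ((((E1 ∪ E2) ∪ E3) ∪ E4) ∪ E5) ∪ E6 := by
    intro ω hω
    by_contra hcon
    simp only [Set.mem_union, not_or] at hcon
    obtain ⟨⟨⟨⟨⟨c1, c2⟩, c3⟩, c4⟩, c5⟩, c6⟩ := hcon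
    simp only [E1, E2, E3, E4, E5, E6, Set.mem_iUnion, Set.mem_ofPred_eq, not_exists, not_le, Finset.mem_univ,
      Finset.mem_range, true_implies, not_not] at c1 c2 c3 c4 c5 c6
    refine hω fun t => reconstruct_extendKeeps hx hsep hn hN δ.2.1 hδ' hD2 hl hln hDn c1 c2 c3
      (fun i hi _ => c4 i hi) c5 c6 t
  have b1 : μ.real E1 ≤ N * ((n + 1) ^ 2 * (2 * Real.exp (-(2 * l / (128 * D) ^ 2)))) := by
    refine (measureReal_biUnion_finset_le _ _).trans ((Finset.sum_le_card_nsmul _ _ _ fun a _ =>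
      (measureReal_eval_keepLaws a _).trans_le (measureReal_not_concentrated_le (by omega) hl0)).trans ?_)
    simp
  have hsum : ∀ (E : ℕ → Set (Fin N → Fin n → Bool)) (b : ℝ), 0 ≤ b → (∀ i < m, μ.real (E i) ≤ b) →
      μ.real (⋃ i ∈ Finset.range m, E i) ≤ (n + 1) * b := by
    intro E b hb h
    refine (measureReal_biUnion_finset_le _ _).trans ((Finset.sum_le_card_nsmul _ _ _ fun i hi =>
      h i (Finset.mem_range.1 hi)).trans ?_)
    rw [Finset.card_range, nsmul_eq_mul]
    gcongr
  have hc0 := card_between (N := N) (lo := 0) hN.le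
  have hc1 := card_between (N := N) (lo := n) le_rfl
  rw [Nat.sub_zero] at hc0
  have b2 : μ.real E2 ≤ (n + 1) * Real.exp (-(2 * (2 / 5) ^ 2 * n)) := hsum _ _ (Real.exp_pos _).le
    fun i hi => by
      have := measureReal_card_ge_le (N := N) (between N 0 n)
        {k | ¬ IsClean (δ : ℝ) D m P i (k ∘ (1 : Equiv.Perm (Fin n)))} (ε := 2 / 5)
        (measureReal_not_clean_le hx 1 hc hD hδ hi.le) (by norm_num)
      rw [hc0] at this ⊢
      convert this
  have b3 : μ.real E3 ≤ (n + 1) * Real.exp (-(2 * (2 / 5) ^ 2 * n)) := hsum _ _ (Real.exp_pos _).le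
    fun i hi => by
      have := measureReal_card_ge_le (N := N) (between N 0 n)
        {k | ¬ IsClean (δ : ℝ) D m (revOnes n m P) i (k ∘ Fin.revPerm)} (ε := 2 / 5)
        (measureReal_not_clean_le hx.rev Fin.revPerm hc hD hδ hi.le) (by norm_num)
      rw [hc0] at this ⊢
      convert this
  have b4 : μ.real E4 ≤ (n + 1) * Real.exp (-(2 * (9 / 100) ^ 2 * (N - n : ℕ))) :=
    hsum _ _ (Real.exp_pos _).le fun i hi => by
      have := measureReal_card_ge_le (N := N) (between N n N)
        {k | ¬ IsCleanGap (δ : ℝ) D m P i k} (ε := 9 / 100)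
        (measureReal_not_cleanGap_le hx hc hD hδ hi.le) (by norm_num)
      rw [hc1] at this ⊢
      convert this
  have b5 : μ.real E5 ≤ (n + 1) * (2 * Real.exp (-((N - n : ℕ) / (50 * n)))) :=
    hsum _ _ (by positivity) fun i hi => by
      have := measureReal_sum_visible_le (N := N) (δ := δ) hx hn D hi
      rwa [hc1] at this ⊢
  have b6 : μ.real E6 ≤ 2 * Real.exp (-((N - n : ℕ) / (50 * n))) := by
    have := measureReal_abs_sum_ge_le (N := N) (between N n N) hn (by
      simpa using hasSubgaussianMGF_cnt (n := n) (δ := δ) (Nat.zero_le n) le_rfl)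
    rw [hc1] at this
    simpa [E6, hc1] using this
  have u1 := measureReal_union_le (μ := μ) E1 E2
  have u2 := measureReal_union_le (μ := μ) (E1 ∪ E2) E3
  have u3 := measureReal_union_le (μ := μ) ((E1 ∪ E2) ∪ E3) E4
  have u4 := measureReal_union_le (μ := μ) (((E1 ∪ E2) ∪ E3) ∪ E4) E5
  have u5 := measureReal_union_le (μ := μ) ((((E1 ∪ E2) ∪ E3) ∪ E4) ∪ E5) E6
  have u6 := measureReal_mono hsub (measure_ne_top μ _)
  linarith

end probabilistic

/-! ### Constants -/

theorem le_numTraces (K n : ℕ) : (K : ℝ) * n * Real.log n ≤ numTraces K n := Nat.le_ceil _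

theorem numTraces_le (K n : ℕ) : (numTraces K n : ℝ) ≤ K * n * Real.log n + 1 :=
  (Nat.ceil_lt_add_one (mul_nonneg (by positivity) (Real.log_natCast_nonneg n))).le

theorem numTraces_le_sq (K n : ℕ) : numTraces K n ≤ K * n ^ 2 + 1 := by
  have h1 := numTraces_le K n
  have h2 : Real.log n ≤ n := Real.log_le_self (Nat.cast_nonneg n)
  have h3 : (K : ℝ) * n * Real.log n ≤ K * n * n := by gcongr
  have : (numTraces K n : ℝ) ≤ ((K * n ^ 2 + 1 : ℕ) : ℝ) := by
    push_cast
    nlinarith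
  exact_mod_cast this

theorem eval_le_eval (p : Polynomial ℕ) {a b : ℕ} (h : a ≤ b) : p.eval a ≤ p.eval b := by
  rw [Polynomial.eval_eq_sum_range, Polynomial.eval_eq_sum_range]
  gcongr

/-- The separation constant. -/
def sepConst : ℝ := 5 * (128 * 3001 ^ 2) ^ 2

theorem exp_neg_le_pow {n : ℕ} (hn : 1 ≤ n) {y : ℝ} (h : 10 * Real.log n ≤ y) :
    Real.exp (-y) ≤ ((n : ℝ) ^ 10)⁻¹ := by
  have hn' : (0 : ℝ) < n := by exact_mod_cast hn
  rw [Real.exp_neg]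
  gcongr
  calc (n : ℝ) ^ 10 = Real.exp (10 * Real.log n) := by
        rw [mul_comm, Real.exp_mul, Real.exp_log hn']
        norm_cast
    _ ≤ Real.exp y := Real.exp_le_exp.2 h

set_option maxHeartbeats 1000000 in
theorem measureReal_failure_le_inv {n L N : ℕ} {δ : unitInterval} {x : Fin n → Bool} (hn : 128 ≤ n)
    (hlog : 1 ≤ Real.log n) (hnC : sepConst * Real.log n ^ 8 ≤ n) (hLC : sepConst * Real.log n ^ 8 ≤ L)
    (hδ : (δ : ℝ) ≤ hitWeight / 2) (hsep : IsSeparated L x)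
    (hN1 : 3000 * n * Real.log n ≤ N) (hN2 : (N : ℝ) ≤ 3000 * n * Real.log n + 1) :
    (keepLaws N n δ).real {ω | ¬ ∀ t : Fin n,
      reconstruct n N (fun a => trace x (extendKeeps ω a)) t = (x t).toNat} ≤
      ((n : ℝ) ^ 3)⁻¹ ∧ n ≤ N := by
  set ℓ := Real.log n with hℓ
  have hn' : (128 : ℝ) ≤ n := by exact_mod_cast hn
  have hn0 : (0 : ℝ) < n := by linarith
  have hN3 : (N : ℝ) ≤ 3001 * n ^ 2 := by
    have := Real.log_le_self hn0.le
    nlinarith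
  have hnN : n < N := by
    have : (n : ℝ) < N := by nlinarith
    exact_mod_cast this
  refine ⟨?_, hnN.le⟩
  set d := N / n with hd
  have hd1 : (d : ℝ) ≤ 3001 * ℓ := by
    have h1 : (d : ℝ) * n ≤ N := by exact_mod_cast Nat.div_mul_le_self N n
    have : (d : ℝ) * n ≤ 3001 * ℓ * n := by nlinarith
    exact le_of_mul_le_mul_right this hn0
  have hd2 : 2999 * ℓ ≤ d := by
    have h1 : (N : ℝ) < (d + 1) * n := by
      have h2 : N < (N / n + 1) * n := by
        have := Nat.lt_div_mul_add (a := N) (b := n) (by omega)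
        rw [add_mul, one_mul]
        exact this
      exact_mod_cast h2
    have : 3000 * ℓ * n < (d + 1) * n := by nlinarith
    have := lt_of_mul_lt_mul_right this hn0.le
    linarith
  have hD : errScale n N = d * d := errScale_eq (by omega) N
  have hDle : (errScale n N : ℝ) ≤ 3001 ^ 2 * ℓ ^ 2 := by
    rw [hD]
    push_cast
    calc (d : ℝ) * d ≤ (3001 * ℓ) * (3001 * ℓ) := by gcongr
      _ = _ := by ring
  have hℓ28 : ℓ ^ 2 ≤ ℓ ^ 8 := pow_le_pow_right₀ hlog (by norm_num)
  have hℓ18 : ℓ ≤ ℓ ^ 8 := le_self_pow₀ hlog (by norm_num)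
  have hℓ15 : ℓ ^ 5 ≤ ℓ ^ 8 := pow_le_pow_right₀ hlog (by norm_num)
  have hC : sepConst = 5 * (128 * 3001 ^ 2) ^ 2 := rfl
  -- the exponent in the error scale
  set c := ⌈14 * ℓ⌉₊ with hcdef
  have hc1 : 14 * ℓ ≤ c := Nat.le_ceil _
  have hc2 : (c : ℝ) ≤ 15 * ℓ := by
    have := (Nat.ceil_lt_add_one (by linarith : (0 : ℝ) ≤ 14 * ℓ)).le
    linarith
  -- The left side is at most `n ^ 7`, and 14 log 2 exceeds 7.
  have hc : 100 * (n + 1) ^ 5 ≤ 2 ^ c := by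
    have h1 : (100 * (n + 1) ^ 5 : ℝ) ≤ n ^ 7 := by
      calc (100 * (n + 1) ^ 5 : ℝ) ≤ n * (2 * n) ^ 5 := by
            gcongr <;> linarith
        _ = n ^ 6 * 32 := by ring
        _ ≤ n ^ 6 * n := by gcongr; linarith
        _ = n ^ 7 := by ring
    have h2 : (n : ℝ) ^ 7 ≤ 2 ^ c := by
      calc (n : ℝ) ^ 7 = Real.exp (7 * ℓ) := by
            rw [mul_comm, Real.exp_mul, Real.exp_log hn0]
            norm_cast
        _ ≤ Real.exp (Real.log 2 * c) := by
            apply Real.exp_le_exp.2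
            have := Real.log_two_gt_d9
            nlinarith
        _ = 2 ^ c := by
            rw [Real.exp_mul, Real.exp_log (by norm_num)]
            norm_cast
    exact_mod_cast h1.trans h2
  -- Here the constant 3000 in the number of traces is needed: 2000 · 61² is below 2999².
  have hDc : 2000 * (4 * c + 1) ^ 2 ≤ errScale n N := by
    have : (2000 * (4 * c + 1) ^ 2 : ℝ) ≤ (errScale n N : ℕ) := by
      rw [hD]
      push_cast
      calc (2000 * (4 * c + 1) ^ 2 : ℝ) ≤ 2000 * (61 * ℓ) ^ 2 := by gcongr; linarith
        _ = 7442000 * ℓ ^ 2 := by ring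
        _ ≤ (2999 * ℓ) * (2999 * ℓ) := by nlinarith
        _ ≤ d * d := by gcongr
    exact_mod_cast this
  have hDn : 128 * errScale n N ≤ n := by
    have : (128 * errScale n N : ℝ) ≤ n := by
      calc (128 * errScale n N : ℝ) ≤ 128 * (3001 ^ 2 * ℓ ^ 2) := by gcongr
        _ ≤ sepConst * ℓ ^ 8 := by
          rw [hC]
          nlinarith
        _ ≤ n := hnC
    exact_mod_cast this
  have hDpos : (0 : ℝ) < errScale n N := by
    have : 0 < errScale n N := lt_of_lt_of_le (by positivity) hDc
    exact_mod_cast this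
  have hlC : sepConst * ℓ ^ 8 ≤ (min L n : ℕ) := by
    rw [Nat.cast_min]
    exact le_min hLC hnC
  have hl1 : 1 ≤ min L n := by
    have : (1 : ℝ) ≤ (min L n : ℕ) := by
      refine le_trans ?_ hlC
      rw [hC]
      nlinarith
    exact_mod_cast this
  have hfail := measureReal_failure_le (δ := δ) hsep (by omega) hnN hδ hl1 (min_le_left L n)
    (min_le_right L n) hDn hc hDc
  have hNn : 2999 * ℓ * n ≤ ((N - n : ℕ) : ℝ) := by
    rw [Nat.cast_sub hnN.le]
    nlinarith
  -- Since the error scale is of order (log n)^2, this exponent has order l / (log n)^4, and the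
  -- lower bound for `l` makes it at least 10 log n.
  have x1 := exp_neg_le_pow (n := n) (by omega)
    (y := 2 * ((min L n : ℕ) : ℝ) / (128 * errScale n N) ^ 2) (by
      rw [le_div_iff₀ (by positivity), ← hℓ]
      calc 10 * ℓ * (128 * (errScale n N : ℝ)) ^ 2 ≤ 10 * ℓ * (128 * (3001 ^ 2 * ℓ ^ 2)) ^ 2 := by gcongr
        _ = 2 * (sepConst * ℓ ^ 5) := by rw [hC]; ring
        _ ≤ 2 * (sepConst * ℓ ^ 8) := by
          have : 0 ≤ sepConst := by rw [hC]; positivity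
          gcongr
        _ ≤ 2 * (min L n : ℕ) := by gcongr)
  have hn100 : 100 * ℓ ≤ n := by
    refine le_trans ?_ hnC
    rw [hC]
    nlinarith
  have x2 := exp_neg_le_pow (n := n) (by omega) (y := 2 * (2 / 5) ^ 2 * n) (by
    rw [← hℓ]; linarith)
  have x3 := exp_neg_le_pow (n := n) (by omega) (y := 2 * (9 / 100) ^ 2 * (N - n : ℕ)) (by
    rw [← hℓ]; nlinarith)
  have x4 := exp_neg_le_pow (n := n) (by omega) (y := (N - n : ℕ) / (50 * n)) (by
    rw [← hℓ, le_div_iff₀ (by positivity)]; nlinarith)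
  set q := ((n : ℝ) ^ 10)⁻¹ with hq
  have hq0 : 0 < q := by positivity
  refine hfail.trans ?_
  calc _ ≤ 3001 * n ^ 2 * ((2 * n) ^ 2 * (2 * q)) + 2 * ((2 * n) * q) + (2 * n) * q + (3 * n) * (2 * q) := by
        gcongr <;> linarith
    _ = (24008 * n ^ 4 + 12 * n) * q := by ring
    _ ≤ n ^ 7 * q := by
        gcongr
        have h4 : (n : ℝ) ≤ n ^ 4 := le_self_pow₀ (by linarith) (by norm_num)
        have h3 : (128 : ℝ) ^ 3 ≤ n ^ 3 := by gcongr
        have h5 : (0 : ℝ) ≤ n ^ 4 := by positivity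
        have h6 : (128 : ℝ) ^ 3 * n ^ 4 ≤ n ^ 3 * n ^ 4 := by gcongr
        have h7 : (n : ℝ) ^ 3 * n ^ 4 = n ^ 7 := by ring
        linarith
    _ = ((n : ℝ) ^ 3)⁻¹ := by
        rw [hq]
        field_simp

theorem exists_threshold : ∃ n₀ : ℕ, 1 ≤ n₀ ∧ ∀ n : ℕ, n₀ ≤ n → 128 ≤ n ∧ 1 ≤ Real.log n ∧
    sepConst * Real.log n ^ 8 ≤ n := by
  have h1 := (Real.isLittleO_pow_log_id_atTop (n := 8)).bound (c := sepConst⁻¹) (by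
    unfold sepConst; positivity)
  have h2 := tendsto_natCast_atTop_atTop (R := ℝ) |>.eventually h1
  have h3 := tendsto_natCast_atTop_atTop (R := ℝ) |>.eventually
    (Real.tendsto_log_atTop.eventually_ge_atTop 1)
  obtain ⟨n₀, h⟩ := Filter.eventually_atTop.1 ((h2.and h3).and (Filter.eventually_ge_atTop 128))
  refine ⟨max n₀ 1, le_max_right _ _, fun n hn => ?_⟩
  obtain ⟨⟨h4, h5⟩, h6⟩ := h n ((le_max_left _ _).trans hn)
  refine ⟨h6, h5, ?_⟩
  have hC : 0 < sepConst := by unfold sepConst; positivity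
  rw [id, Real.norm_of_nonneg (by positivity), Real.norm_of_nonneg (Nat.cast_nonneg n), inv_mul_eq_div,
    le_div_iff₀ hC] at h4
  linarith

end TraceReconstruction

/-! ### The main theorem -/

open TraceReconstruction in
theorem theorem1 :
    ∃ C c₀ : ℝ, 0 < C ∧ 0 < c₀ ∧ c₀ < 1 ∧
      ∃ (P : Prog) (K : ℕ) (A : ℝ) (T : Polynomial ℕ),
        -- on all inputs, `P` halts within `T(n)` steps
        (∀ n : ℕ, 1 ≤ n → ∀ y : Fin (numTraces K n) → List Bool, (∀ i, (y i).length ≤ n) →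
          ∃ t s, t ≤ T.eval n ∧ Exec P (initState n y) t s) ∧
        -- with high probability over the traces, `P` outputs `x`
        (∀ n : ℕ, 1 ≤ n → ∀ (δ : unitInterval), (δ : ℝ) ≤ c₀ →
          ∀ L : ℕ, C * Real.log n ^ 8 ≤ L →
          ∀ x : Fin n → Bool, IsSeparated L x →
            1 - A / (n : ℝ) ^ 3 ≤
              (keepLaws (numTraces K n) n δ).real
                {ω | Reconstructs P (T.eval n) (fun i => trace x (ω i)) x}) := by
  obtain ⟨n₀, hn₀, hlarge⟩ := exists_threshold
  -- The time bound is a polynomial in `n + N + 2`; the non-polynomial number of traces is replaced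
  -- by its bound `3000 * n ^ 2 + 1`.
  set T : Polynomial ℕ := (reconstructS.time + 3).comp (Polynomial.X + (3000 * Polynomial.X ^ 2 + 1) + 2)
    with hT
  have hTle : ∀ n, (reconstructS.time + 3).eval (n + numTraces 3000 n + 2) ≤ T.eval n := by
    intro n
    rw [hT, Polynomial.eval_comp]
    refine eval_le_eval _ ?_
    have := numTraces_le_sq 3000 n
    simp only [Polynomial.eval_add, Polynomial.eval_X, Polynomial.eval_mul, Polynomial.eval_ofNat,
      Polynomial.eval_pow, Polynomial.eval_one]
    omega
  refine ⟨sepConst, hitWeight / 2, by unfold sepConst; positivity, by norm_num [hitWeight],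
    by norm_num [hitWeight], reconstructS.program, 3000, (n₀ : ℝ) ^ 3, T, ?_, ?_⟩
  · intro n _ y _
    obtain ⟨t, s, h1, h2, -⟩ := exists_exec n y
    exact ⟨t, s, h1.trans (hTle n), h2⟩
  · intro n hn δ hδ L hL x hsep
    have hn' : (0 : ℝ) < n := by exact_mod_cast hn
    rcases lt_or_ge n n₀ with hlt | hge
    -- Below the threshold the choice A = n₀³ makes the claimed probability nonpositive.
    · refine le_trans ?_ measureReal_nonneg
      rw [sub_nonpos, le_div_iff₀ (by positivity), one_mul]
      gcongr
    · obtain ⟨h128, hlog, hnC⟩ := hlarge n hge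
      obtain ⟨hfail, hnN⟩ := measureReal_failure_le_inv h128 hlog hnC hL hδ hsep
        (N := numTraces 3000 n) (by simpa using le_numTraces 3000 n) (by simpa using numTraces_le 3000 n)
      set μ := keepLaws (numTraces 3000 n) n δ
      set F := {ω : Fin (numTraces 3000 n) → Fin n → Bool | ¬ ∀ t : Fin n,
        reconstruct n (numTraces 3000 n) (fun a => trace x (extendKeeps ω a)) t = (x t).toNat}
      have hsub : Fᶜ ⊆ {ω | Reconstructs reconstructS.program (T.eval n) (fun i => trace x (ω i)) x} := by
        intro ω hω
        simp only [F, Set.mem_compl_iff, Set.mem_ofPred_eq, not_not] at hω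
        obtain ⟨t, s, h1, h2, h3⟩ := exists_exec n fun i => trace x (ω i)
        refine ⟨t, s, h1.trans (hTle n), h2, fun i => ?_⟩
        rw [h3 hnN (fun i => by rw [length_trace]; exact cnt_le n) i i.2, ← hω i]
        congr 1
        funext a
        rw [trace_extendKeeps]
      have h1 : (1 : ℝ) ≤ n₀ ^ 3 := one_le_pow₀ (by exact_mod_cast hn₀)
      calc 1 - (n₀ : ℝ) ^ 3 / (n : ℝ) ^ 3 ≤ 1 - ((n : ℝ) ^ 3)⁻¹ := by
            rw [inv_eq_one_div]
            gcongr
        _ ≤ 1 - μ.real F := by linarith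
        _ = μ.real Fᶜ := (probReal_compl_eq_one_sub (Set.toFinite F).measurableSet).symm
        _ ≤ _ := measureReal_mono hsub (measure_ne_top μ _)
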